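/- Let $n\ge 2$ and let $\epsilon_1,\dots,\epsilon_n$ be the standard basis of $\mathbf Z^n$. The simple roots of type $D_n$ are $\alpha_i=\epsilon_i-\epsilon_{i+1}$ $(1\le i<n)$ and $\alpha_n=\epsilon_{n-1}+\epsilon_n$; the positive roots are $\beta_{i,k}=\epsilon_i-\epsilon_{k+1}$ $(1\le i\le k\le n-1)$ and $\gamma_{i,k}=\epsilon_i+\epsilon_k$ $(1\le i<k\le n)$; $\langle\alpha_i^\vee,\cdot\rangle$ is the standard inner product with $\alpha_i$. *Brackets.* In a sequence of brackets, cancel $()$-pairs successively until it has the form $)\cdots)(\cdots($; the brackets left over are called uncanceled. *Tableaux.* Let $J$ be the alphabet $1\prec\cdots\prec n-1\prec n,\overline n\prec\overline{n-1}\prec\cdots\prec\overline 1$, where $n$ and $\overline n$ are incomparable. Let $\mathcal T(\infty)$ be the set of tableaux with rows $R_1,\dots,R_{n-1}$ (from top to bottom) in the alphabet $J$ such that: the first column is $1,2,\dots,n-1$; rows weakly increase; the number of letters $j$ in $R_j$ is one more than the length of $R_{j+1}$ (with $R_n=\emptyset$); all entries of $R_j$ are $\preceq\overline{\jmath}$;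 no row contains both $n$ and $\overline n$. For $1\le i\le n-1$ the $i$-arrows are $i\to i+1$ and $\overline{\imath+1}\to\overline{\imath}$; the $n$-arrows are $n-1\to\overline n$ and $n\to\overline{n-1}$. Read the rows of $T$ from top to bottom, each from right to left, and write `)' for each letter which an $i$-arrow enters and `(' for each letter which an $i$-arrow leaves. Then $f_iT$ is obtained by moving the letter of the leftmost uncanceled `(' along its $i$-arrow and, if the result is not in $\mathcal T(\infty)$, inserting one column $1,\dots,\min(i,n-1)$; $e_iT$ is obtained by moving the letter of the rightmost uncanceled `)' back along its $i$-arrow and, if the result is not in $\mathcal T(\infty)$, deleting one such column; $e_iT=0$ if there is no uncanceled `)'. Let $\varepsilon_i(T)$ be the number of uncanceled `)', let $\mathrm{wt}(T)$ be the sum, over all boxes, of $\pm\epsilon_k-\epsilon_j$, where $j$ is the row of the box and the sign is $+$ if its letter is $k$, $-$ if its letter is $\overline k$, and let $\varphi_i=\varepsilon_i+\langle\alpha_i^\vee,\mathrm{wt}\rangle$. *Kostant partitions.* Let $\mathrm{Kp}(\infty)$ be the set of formal sums $\boldsymbol\alpha=\sum_\beta c_\beta(\beta)$ over the positive roots, $c_\beta\in\mathbf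 Z_{\ge0}$, with $(0)=0$. For $1\le i\le n-1$ let $\Phi_i$ be the sequence of the roots $\beta_{k,i},\beta_{k,i-1},\gamma_{k,i},\gamma_{k,i+1}$ for $k=1,\dots,i-1$ in turn, followed by $\beta_{i,i}$; let $\Phi_n$ be the sequence of the roots $\gamma_{k,n},\beta_{k,n-2},\gamma_{k,n-1},\beta_{k,n-1}$ for $k=1,\dots,n-2$ in turn, followed by $\gamma_{n-1,n}$. Going through $\Phi_i$, write $c_\beta$ brackets `)' if $\beta-\alpha_i$ is a positive root or $0$, and $c_\beta$ brackets `(' if $\beta+\alpha_i$ is a positive root. If $\beta$ is the root of the leftmost uncanceled `(', then $f_i\boldsymbol\alpha=\boldsymbol\alpha-(\beta)+(\beta+\alpha_i)$, and $f_i\boldsymbol\alpha=\boldsymbol\alpha+(\alpha_i)$ if there is none. If $\beta$ is the root of the rightmost uncanceled `)', then $e_i\boldsymbol\alpha=\boldsymbol\alpha-(\beta)+(\beta-\alpha_i)$, and $e_i\boldsymbol\alpha=0$ (the formal zero) if there is none. Let $\varepsilon_i(\boldsymbol\alpha)$ be the number of uncanceled `)', $\mathrm{wt}(\boldsymbol\alpha)=-\sum_\beta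 c_\beta\beta$ and $\varphi_i=\varepsilon_i+\langle\alpha_i^\vee,\mathrm{wt}\rangle$. **Theorem.** With these maps $\mathcal T(\infty)$ and $\mathrm{Kp}(\infty)$ are crystals of type $D_n$. There is exactly one crystal isomorphism $\Psi:\mathcal T(\infty)\to\mathrm{Kp}(\infty)$, i.e. exactly one bijection that preserves $\mathrm{wt},\varepsilon_i,\varphi_i$ and commutes with $e_i,f_i$ for all $1\le i\le n$. It is given by $\Psi(T)=\sum_{j=1}^{n-1}\Psi(R_j)$, where $\Psi(R_j)$ is the sum of the following contributions (the letters $j$ in $R_j$ are placeholders and contribute nothing): 1. each $\overline{\jmath}$ contributes $(\beta_{j,j})+(\gamma_{j,j+1})$; 2. for each $j<k\le n-1$, the letters $k$ and $\overline k$ are paired as far as possible, and each pair $k,\overline k$ contributes $(\beta_{j,k})+(\gamma_{j,k+1})$; 3. each remaining $k$ with $j<k\le n$ contributes $(\beta_{j,k-1})$; 4. each remaining $\overline k$ with $j<k\le n$ contributes $(\gamma_{j,k})$. -/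

import Mathlib

namespace TypeD

/-! ### Roots and weights of type `D_n`

All weights that occur lie in `ℤ ε_1 ⊕ ⋯ ⊕ ℤ ε_n`; they are written in the coordinates
`ε_1, …, ε_n`. Indices of `ε`, of simple roots and of rows are the usual ones, starting at `1`. -/

/-- Integral weights, in the coordinates `ε_1, …, ε_n`. -/
abbrev Weight (n : ℕ) : Type := Fin n → ℤ

/-- The basis vector `ε_i`, for `1 ≤ i ≤ n`. -/
def ep (n i : ℕ) : Weight n := fun j => if (j : ℕ) + 1 = i then 1 else 0

/-- `α_i = ε_i - ε_{i+1}` for `i < n`, and `α_n = ε_{n-1} + ε_n`. -/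
def simpleRoot (n i : ℕ) : Weight n :=
  if i = n then ep n (n - 1) + ep n n else ep n i - ep n (i + 1)

/-- `⟨α_i^∨, w⟩`; type `D_n` is simply laced, so this is the standard inner product with `α_i`. -/
def pairing (n i : ℕ) (w : Weight n) : ℤ := ∑ j, simpleRoot n i j * w j

/-- `β_{i,k} = α_i + ⋯ + α_k = ε_i - ε_{k+1}`. -/
def beta (n i k : ℕ) : Weight n := ep n i - ep n (k + 1)

/-- `γ_{i,k} = (α_i + ⋯ + α_{n-2}) + α_n + (α_{n-1} + ⋯ + α_k) = ε_i + ε_k`. -/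
def gamma (n i k : ℕ) : Weight n := ep n i + ep n k

/-- The positive roots: `β_{i,k}` for `1 ≤ i ≤ k ≤ n-1` and `γ_{i,k}` for `1 ≤ i < k ≤ n`. -/
def posRoots (n : ℕ) : Finset (Weight n) :=
  ((Finset.Icc 1 (n - 1) ×ˢ Finset.Icc 1 (n - 1)).filter (fun p => p.1 ≤ p.2)).image
      (fun p => beta n p.1 p.2) ∪
    ((Finset.Icc 1 n ×ˢ Finset.Icc 1 n).filter (fun p => p.1 < p.2)).image
      (fun p => gamma n p.1 p.2)

/-! ### Crystals -/

/-- The maps of a crystal of type `D_n` on a set `B`. The value `none` is the formal zero.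
Only the indices `1 ≤ i ≤ n` are meaningful. -/
structure CrystalData (n : ℕ) (B : Type) where
  wt : B → Weight n
  eps : ℕ → B → ℤ
  phi : ℕ → B → ℤ
  e : ℕ → B → Option B
  f : ℕ → B → Option B

/-- Kashiwara's axioms for a crystal (with integral `ε_i`, `φ_i`). -/
structure CrystalData.IsCrystal {n : ℕ} {B : Type} (C : CrystalData n B) : Prop where
  phi_eq : ∀ i, 1 ≤ i → i ≤ n → ∀ b, C.phi i b = C.eps i b + pairing n i (C.wt b)
  of_e : ∀ i, 1 ≤ i → i ≤ n → ∀ b b', C.e i b = some b' →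
    C.wt b' = C.wt b + simpleRoot n i ∧ C.eps i b' = C.eps i b - 1 ∧ C.phi i b' = C.phi i b + 1
  of_f : ∀ i, 1 ≤ i → i ≤ n → ∀ b b', C.f i b = some b' →
    C.wt b' = C.wt b - simpleRoot n i ∧ C.eps i b' = C.eps i b + 1 ∧ C.phi i b' = C.phi i b - 1
  f_iff_e : ∀ i, 1 ≤ i → i ≤ n → ∀ b b', C.f i b = some b' ↔ C.e i b' = some b

/-- `F` is an isomorphism of crystals: a bijection that preserves `wt`, `ε_i`, `φ_i` and commutes
with all `e_i`, `f_i` (where `F` sends the formal zero to the formal zero). -/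
structure IsCrystalIso {n : ℕ} {B B' : Type} (C : CrystalData n B) (C' : CrystalData n B')
    (F : B → B') : Prop where
  bijective : Function.Bijective F
  wt_eq : ∀ b, C'.wt (F b) = C.wt b
  eps_eq : ∀ i, 1 ≤ i → i ≤ n → ∀ b, C'.eps i (F b) = C.eps i b
  phi_eq : ∀ i, 1 ≤ i → i ≤ n → ∀ b, C'.phi i (F b) = C.phi i b
  e_eq : ∀ i, 1 ≤ i → i ≤ n → ∀ b, C'.e i (F b) = (C.e i b).map F
  f_eq : ∀ i, 1 ≤ i → i ≤ n → ∀ b, C'.f i (F b) = (C.f i b).map F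

/-! ### Cancellation of brackets -/

/-- `opening` is `(` and `closing` is `)`. -/
inductive Bracket
  | opening
  | closing
  deriving DecidableEq

/-- One step of the cancellation, reading a bracket sequence from left to right. The state consists
of the uncanceled `)` and the uncanceled `(` so far, each in order of occurrence; a new `)` cancels
the last uncanceled `(`, if there is one. -/
def cancelStep {A : Type} (s : List A × List A) (b : Bracket × A) : List A × List A :=
  match b.1 with
  | .opening => (s.1, s.2 ++ [b.2])
  | .closing => if s.2.isEmpty then (s.1 ++ [b.2], []) else (s.1, s.2.dropLast)

/-- The labels of the uncanceled `)` and of the uncanceled `(`, each from left to right, after all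
`()`-pairs of a sequence of labelled brackets have been successively canceled. -/
def uncanceled {A : Type} (l : List (Bracket × A)) : List A × List A :=
  l.foldl cancelStep ([], [])

/-! ### Marginally large tableaux -/

/-- Letters: `pos k` is `k` and `neg k` is `k` with a bar. -/
inductive Letter
  | pos (k : ℕ)
  | neg (k : ℕ)
  deriving DecidableEq

open Letter

/-- The letters of the alphabet `J(D_n)`. -/
def Letter.InAlphabet (n : ℕ) : Letter → Prop
  | pos k => 1 ≤ k ∧ k ≤ n
  | neg k => 1 ≤ k ∧ k ≤ n

/-- Height of a letter in `1 ≺ ⋯ ≺ n-1 ≺ n, n̄ ≺ (n-1)̄ ≺ ⋯ ≺ 1̄`; only `n` and `n̄` have the same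
height. -/
def Letter.height (n : ℕ) : Letter → ℕ
  | pos k => k
  | neg k => 2 * n - k

/-- The partial order `≼` on `J(D_n)`, in which `n` and `n̄` are incomparable. -/
def Letter.Le (n : ℕ) (x y : Letter) : Prop := x = y ∨ x.height n < y.height n

/-- The end of the `i`-arrow that leaves a letter in the fundamental crystal
`1 → ⋯ → n-1 → n, n̄ → (n-1)̄ → ⋯ → 1̄`, if there is such an arrow. -/
def Letter.next (n i : ℕ) : Letter → Option Letter
  | pos k =>
    if i < n ∧ k = i then some (pos (i + 1))
    else if i = n ∧ k = n - 1 then some (neg n)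
    else if i = n ∧ k = n then some (neg (n - 1))
    else none
  | neg k => if i < n ∧ k = i + 1 then some (neg i) else none

/-- The origin of the `i`-arrow that enters a letter in the fundamental crystal, if there is such
an arrow. -/
def Letter.prev (n i : ℕ) : Letter → Option Letter
  | pos k => if i < n ∧ k = i + 1 then some (pos i) else none
  | neg k =>
    if i < n ∧ k = i then some (neg (i + 1))
    else if i = n ∧ k = n then some (pos (n - 1))
    else if i = n ∧ k = n - 1 then some (pos n)
    else none

/-- The rows of a filling: `R j` is the `j`-th row from the top, read from left to right. -/
abbrev Filling : Type := ℕ → List Letter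

/-- `R` is a marginally large tableau of type `D_n`, with rows `1, …, n-1`. -/
structure IsMarginallyLarge (n : ℕ) (R : Filling) : Prop where
  rows : ∀ j, ¬ (1 ≤ j ∧ j < n) → R j = []
  alphabet : ∀ j, ∀ x ∈ R j, x.InAlphabet n
  first_column : ∀ j, 1 ≤ j → j < n → (R j).head? = some (pos j)
  weakly_increasing : ∀ j, (R j).Pairwise (Letter.Le n)
  marginal : ∀ j, 1 ≤ j → j < n → (R j).count (pos j) = (R (j + 1)).length + 1
  bounded : ∀ j, ∀ x ∈ R j, x.Le n (neg j)
  not_both : ∀ j, ¬ (pos n ∈ R j ∧ neg n ∈ R j)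

/-- The set `T(∞)` of marginally large tableaux of type `D_n`. -/
abbrev MLT (n : ℕ) : Type := {R : Filling // IsMarginallyLarge n R}

/-- The boxes, as triples (row, column, letter), in the order of the reading word: rows from top to
bottom, each row from right to left. Columns are numbered from `0`. -/
def boxes (n : ℕ) (R : Filling) : List (ℕ × ℕ × Letter) :=
  (List.range' 1 (n - 1)).flatMap
    (fun j => ((R j).zipIdx.map (fun p => (j, p.2, p.1))).reverse)

/-- The bracketing sequence `br_i`, each bracket labelled by its box. -/
def brackets (n i : ℕ) (R : Filling) : List (Bracket × (ℕ × ℕ × Letter)) :=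
  (boxes n R).filterMap (fun b =>
    if (b.2.2.prev n i).isSome then some (Bracket.closing, b)
    else if (b.2.2.next n i).isSome then some (Bracket.opening, b)
    else none)

/-- Replace the letter of the box in row `j` and column `c` by `x`. -/
def setBox (R : Filling) (j c : ℕ) (x : Letter) : Filling :=
  Function.update R j ((R j).set c x)

/-- Insert a column with the entries `1, 2, …, i` (`1, …, n-1` if `i = n`). -/
def insertColumn (n i : ℕ) (R : Filling) : Filling :=
  fun j => if 1 ≤ j ∧ j ≤ i ∧ j < n then pos j :: R j else R j

/-- Delete a column with the entries `1, 2, …, i` (`1, …, n-1` if `i = n`): row `j` loses one of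
the letters `j` with which it starts. -/
def deleteColumn (n i : ℕ) (R : Filling) : Filling :=
  fun j => if 1 ≤ j ∧ j ≤ i ∧ j < n then (R j).tail else R j

open Classical in
/-- `R` if it is a marginally large tableau, otherwise the correction `R'`. -/
noncomputable def correct (n : ℕ) (R R' : Filling) : Option (MLT n) :=
  if h : IsMarginallyLarge n R then some ⟨R, h⟩
  else if h' : IsMarginallyLarge n R' then some ⟨R', h'⟩
  else none

/-- `e_i` on tableaux: acts on the box of the rightmost uncanceled `)`. -/
noncomputable def tabE (n i : ℕ) (T : MLT n) : Option (MLT n) :=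
  (uncanceled (brackets n i T.1)).1.getLast?.bind (fun b =>
    (b.2.2.prev n i).bind (fun x =>
      correct n (setBox T.1 b.1 b.2.1 x) (deleteColumn n i (setBox T.1 b.1 b.2.1 x))))

/-- `f_i` on tableaux: acts on the box of the leftmost uncanceled `(`. -/
noncomputable def tabF (n i : ℕ) (T : MLT n) : Option (MLT n) :=
  (uncanceled (brackets n i T.1)).2.head?.bind (fun b =>
    (b.2.2.next n i).bind (fun x =>
      correct n (setBox T.1 b.1 b.2.1 x) (insertColumn n i (setBox T.1 b.1 b.2.1 x))))

/-- The weight of a letter: `ε_k` for `k` and `-ε_k` for `k̄`. -/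
def Letter.weight (n : ℕ) : Letter → Weight n
  | pos k => ep n k
  | neg k => - ep n k

/-- The weight of a tableau: the weights of all letters, minus those of the tableau of the same
shape in which all letters in row `j` are `j`. -/
def tabWt (n : ℕ) (R : Filling) : Weight n :=
  ∑ j ∈ Finset.Icc 1 (n - 1), ((R j).map (fun x => x.weight n - ep n j)).sum

/-- The number of uncanceled `)` in `br_i`. -/
def tabEps (n i : ℕ) (R : Filling) : ℤ := ((uncanceled (brackets n i R)).1.length : ℤ)

/-- The crystal `T(∞)`. -/
noncomputable def tabCrystal (n : ℕ) : CrystalData n (MLT n) where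
  wt T := tabWt n T.1
  eps i T := tabEps n i T.1
  phi i T := tabEps n i T.1 + pairing n i (tabWt n T.1)
  e i T := tabE n i T
  f i T := tabF n i T

/-! ### Kostant partitions -/

/-- Kostant partitions `∑ c_β (β)`, given by their coefficients `c_β ∈ ℤ_{≥0}`, `β ∈ Φ⁺`
(a finite set). -/
abbrev Kp (n : ℕ) : Type := {v : Weight n // v ∈ posRoots n} → ℕ

/-- The Kostant partition `(v)` if `v` is a positive root, and `0` otherwise; so `(0) = 0`. -/
def part (n : ℕ) (v : Weight n) : Kp n := fun b => if b.1 = v then 1 else 0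

/-- The coefficient `c_v` (zero if `v` is not a positive root). -/
def coeff (n : ℕ) (a : Kp n) (v : Weight n) : ℕ := if h : v ∈ posRoots n then a ⟨v, h⟩ else 0

/-- The roots in `Φ_i`, in increasing order. -/
def rootList (n i : ℕ) : List (Weight n) :=
  if i = n then
    (List.range' 1 (n - 2)).flatMap
      (fun k => [gamma n k n, beta n k (n - 2), gamma n k (n - 1), beta n k (n - 1)])
      ++ [gamma n (n - 1) n]
  else
    (List.range' 1 (i - 1)).flatMap
      (fun k => [beta n k i, beta n k (i - 1), gamma n k i, gamma n k (i + 1)])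
      ++ [beta n i i]

/-- The bracketing sequence `S_i`, each bracket labelled by its root: `c_v` brackets `)` if
`v - α_i` is a positive root or zero, `c_v` brackets `(` if `v + α_i` is a positive root. -/
def kpBrackets (n i : ℕ) (a : Kp n) : List (Bracket × Weight n) :=
  (rootList n i).flatMap (fun v =>
    if v - simpleRoot n i ∈ posRoots n ∨ v = simpleRoot n i then
      List.replicate (coeff n a v) (Bracket.closing, v)
    else if v + simpleRoot n i ∈ posRoots n then
      List.replicate (coeff n a v) (Bracket.opening, v)
    else [])

/-- `e_i` on Kostant partitions. -/
def kpE (n i : ℕ) (a : Kp n) : Option (Kp n) :=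
  (uncanceled (kpBrackets n i a)).1.getLast?.map (fun v =>
    a - part n v + part n (v - simpleRoot n i))

/-- `f_i` on Kostant partitions. -/
def kpF (n i : ℕ) (a : Kp n) : Kp n :=
  match (uncanceled (kpBrackets n i a)).2.head? with
  | some v => a - part n v + part n (v + simpleRoot n i)
  | none => a + part n (simpleRoot n i)

/-- `wt(∑ c_β (β)) = -∑ c_β β`. -/
def kpWt (n : ℕ) (a : Kp n) : Weight n := - ∑ b, a b • b.1

/-- The number of uncanceled `)` in `S_i`. -/
def kpEps (n i : ℕ) (a : Kp n) : ℤ := ((uncanceled (kpBrackets n i a)).1.length : ℤ)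

/-- The crystal `Kp(∞)`. -/
def kpCrystal (n : ℕ) : CrystalData n (Kp n) where
  wt a := kpWt n a
  eps i a := kpEps n i a
  phi i a := kpEps n i a + pairing n i (kpWt n a)
  e i a := kpE n i a
  f i a := some (kpF n i a)

/-! ### The map from tableaux to Kostant partitions -/

/-- The number of pairs `k, k̄` in a row. -/
def pairs (r : List Letter) (k : ℕ) : ℕ := min (r.count (pos k)) (r.count (neg k))

/-- The image of a row `r` in position `j`. The letters `j` in row `j` are placeholders and
contribute nothing; a row never contains both `n` and `n̄`. -/
def psiRow (n j : ℕ) (r : List Letter) : Kp n :=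
  r.count (neg j) • (part n (beta n j j) + part n (gamma n j (j + 1)))
    + ∑ k ∈ Finset.Icc (j + 1) (n - 1),
        pairs r k • (part n (beta n j k) + part n (gamma n j (k + 1)))
    + ∑ k ∈ Finset.Icc (j + 1) n, (r.count (pos k) - pairs r k) • part n (beta n j (k - 1))
    + ∑ k ∈ Finset.Icc (j + 1) n, (r.count (neg k) - pairs r k) • part n (gamma n j k)

/-- `Ψ(T)` is the sum of the images of the rows of `T`. -/
def psi (n : ℕ) (T : MLT n) : Kp n := ∑ j ∈ Finset.Icc 1 (n - 1), psiRow n j (T.1 j)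

end TypeD

/-! For a fixed colour `i` only four letters matter: the arrows are s → B and C → s̄, where s = i
and B, C are i+1 and its bar if i < n, while s = n-1, B = n̄, C = n if i = n. The structure `Arrows`
records this, so that all arguments are uniform in the colour. The positive roots are ε_j - wt(z)
for a row j and a letter z whose index lies in j+1, …, n (`root`, `IsRt`); hence a Kostant partition
decomposes into rows, just as a tableau does.

Let row j < s of a tableau contain a, b, c, d letters s, B, C, s̄. It is read as d times `)`, c
times `(`, b times `)`, a times `(`. Row j of a Kostant partition is read in the order B, s, s̄, C,
again as four runs `)`, `(`, `)`, `(`. Put p = min(a,d), o = min(b,c), and let q be the number of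
pairs of index s-1 (each j̄ in row j counts as a pair). The map Ψ produces the coefficients q+a-p,
p+b-o, p+c-o, q+d-p at s, B, C, s̄. A direct computation shows that the two rows have equally many
uncanceled `)` and equally many uncanceled `(` (`kpSig_psi`). These numbers multiply as in the
bicyclic monoid, so the signature rule selects the same row on both sides (`SelF`, `SelE`), and in
this row the two changes correspond under Ψ (`fStep_numbers`, `psi_fStep_row`). In row s the
coefficient of α_i is the number of uncanceled `)` of the tableau row, and the placeholders always
leave a `(` that the lower rows cannot cancel; this matches the rule that f_i adds (α_i) when no `(`
is left (`cf_psi_last`, `sig_lowerBrackets_lt`, `psi_fStep_last`).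

Thus Ψ commutes with the operators. It is injective because the numbers of pairs can be recovered
from the coefficients (`pr_eq_min`). Every Kostant partition is reached from 0 by the f_i
(`kp_induction`); this gives surjectivity, the comparison of weights, and uniqueness. The crystal
axioms are checked on Kostant partitions only and transported to tableaux along Ψ. -/

namespace TypeD

open Letter

/-! ### Cancellation of brackets -/

section Brackets

variable {A : Type}

theorem uncanceled_concat (l : List (Bracket × A)) (b : Bracket × A) :
    uncanceled (l ++ [b]) = cancelStep (uncanceled l) b := by
  simp [uncanceled]

/-- The uncanceled `)` of `l` use up the stored `(` from the right, one each; those that exceed the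
number of stored `(` join the uncanceled `)`. Subtraction in ℕ covers both cases at once. -/
theorem foldl_cancelStep (l : List (Bracket × A)) (c o : List A) :
    l.foldl cancelStep (c, o) = (c ++ (uncanceled l).1.drop o.length,
      o.take (o.length - (uncanceled l).1.length) ++ (uncanceled l).2) := by
  induction l using List.reverseRecOn with
  | nil => simp [uncanceled]
  | append_singleton l b ih =>
    rw [List.foldl_append, ih, uncanceled_concat]
    obtain ⟨b, x⟩ := b
    generalize uncanceled l = u
    obtain ⟨c', o'⟩ := u
    cases b with
    | opening => simp [cancelStep]
    | closing =>
      rcases List.eq_nil_or_concat' o' with rfl | ⟨o'', y, rfl⟩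
      · by_cases h : o.length ≤ c'.length
        · simp [cancelStep, List.drop_append_of_le_length h, Nat.sub_eq_zero_of_le h,
            Nat.sub_eq_zero_of_le (Nat.le_succ_of_le h)]
        · have h1 : ¬ (o.length - c'.length = 0 ∨ o = []) := by
            rintro (h2 | rfl)
            · omega
            · simp at h
          have h2 : (o.take (o.length - c'.length)).dropLast =
              o.take (o.length - (c'.length + 1)) := by
            rw [List.dropLast_eq_take, List.take_take, List.length_take]
            congr 1
            omega
          simp [cancelStep, h1, List.drop_eq_nil_of_le (show c'.length ≤ o.length by omega),
            List.drop_eq_nil_of_le (show (c' ++ [x]).length ≤ o.length by simp; omega),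
            h2]
      · simp [cancelStep, ← List.append_assoc]

theorem uncanceled_append (l₁ l₂ : List (Bracket × A)) :
    uncanceled (l₁ ++ l₂) =
      ((uncanceled l₁).1 ++ (uncanceled l₂).1.drop (uncanceled l₁).2.length,
        (uncanceled l₁).2.take ((uncanceled l₁).2.length - (uncanceled l₂).1.length)
          ++ (uncanceled l₂).2) := by
  conv_lhs => rw [uncanceled, List.foldl_append]
  exact foldl_cancelStep l₂ _ _

theorem uncanceled_map_closing (l : List A) :
    uncanceled (l.map (Prod.mk Bracket.closing)) = (l, []) := by
  induction l using List.reverseRecOn with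
  | nil => rfl
  | append_singleton l x ih => simp [uncanceled_concat, ih, cancelStep]

theorem uncanceled_map_opening (l : List A) :
    uncanceled (l.map (Prod.mk Bracket.opening)) = ([], l) := by
  induction l using List.reverseRecOn with
  | nil => rfl
  | append_singleton l x ih => simp [uncanceled_concat, ih, cancelStep]

/-- The bracket sequence `)⋯)(⋯()⋯)(⋯(` with the given labels. -/
def fourRuns (p u v q : List A) : List (Bracket × A) :=
  p.map (Prod.mk Bracket.closing) ++ u.map (Prod.mk Bracket.opening) ++
    v.map (Prod.mk Bracket.closing) ++ q.map (Prod.mk Bracket.opening)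

theorem uncanceled_fourRuns (p u v q : List A) :
    uncanceled (fourRuns p u v q) =
      (p ++ v.drop u.length, u.take (u.length - v.length) ++ q) := by
  simp [fourRuns, uncanceled_append, uncanceled_map_closing, uncanceled_map_opening]

/-- The numbers of uncanceled `)` and `(`. -/
def sig (l : List (Bracket × A)) : ℕ × ℕ :=
  ((uncanceled l).1.length, (uncanceled l).2.length)

/-- The product of the bicyclic monoid, which computes `sig` of a concatenation. -/
def bmul (p q : ℕ × ℕ) : ℕ × ℕ := (p.1 + (q.1 - p.2), (p.2 - q.1) + q.2)

theorem sig_append (l₁ l₂ : List (Bracket × A)) : sig (l₁ ++ l₂) = bmul (sig l₁) (sig l₂) := by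
  simp [sig, bmul, uncanceled_append]

theorem sig_fourRuns (p u v q : List A) :
    sig (fourRuns p u v q) =
      (p.length + (v.length - u.length), (u.length - v.length) + q.length) := by
  simp [sig, uncanceled_fourRuns]

theorem bmul_assoc (p q r : ℕ × ℕ) : bmul (bmul p q) r = bmul p (bmul q r) := by
  simp only [bmul, Prod.mk.injEq]
  constructor <;> omega

theorem sig_fst_le_length (l : List (Bracket × A)) : (sig l).1 ≤ l.length := by
  induction l using List.reverseRecOn with
  | nil => simp [sig, uncanceled]
  | append_singleton l b ih =>
    obtain ⟨b, x⟩ := b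
    simp only [sig, uncanceled_concat, List.length_append] at ih ⊢
    cases b
    · simp only [cancelStep]; omega
    · simp only [cancelStep]; split_ifs <;> simp <;> omega

/-- By `hX` no `(` of `X` survives the brackets `)` of `l`. By `hZ` the brackets `)` of `Z` do not
exhaust the `(` of `l`, and since they cancel from the right, the leftmost one remains. -/
theorem head?_uncanceled_append (X l Z : List (Bracket × A)) (hX : (sig X).2 ≤ (sig l).1)
    (hZ : (sig Z).1 < (sig l).2) :
    (uncanceled (X ++ (l ++ Z))).2.head? = (uncanceled l).2.head? := by
  simp only [sig] at hX hZ
  simp only [uncanceled_append, List.length_append, List.length_drop]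
  rw [Nat.sub_eq_zero_of_le (by omega)]
  rcases h : (uncanceled l).2 with _ | ⟨y, ys⟩
  · simp [h] at hZ
  · rw [h] at hZ
    obtain ⟨k, hk⟩ : ∃ k, (y :: ys).length - (uncanceled Z).1.length = k + 1 :=
      ⟨(y :: ys).length - (uncanceled Z).1.length - 1, by omega⟩
    rw [hk]
    simp

theorem getLast?_uncanceled_append (X l Z : List (Bracket × A)) (hX : (sig X).2 < (sig l).1)
    (hZ : (sig Z).1 ≤ (sig l).2) :
    (uncanceled (X ++ (l ++ Z))).1.getLast? = (uncanceled l).1.getLast? := by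
  simp only [sig] at hX hZ
  simp only [uncanceled_append]
  rw [List.drop_eq_nil_of_le hZ, List.append_nil]
  have h : (uncanceled l).1.drop (uncanceled X).2.length ≠ [] := by
    simpa using hX
  rw [List.getLast?_append_of_ne_nil _ h, List.getLast?_drop, if_neg (by omega)]

end Brackets

/-! ### Selection of a row -/

/-- The product of the signatures `g j` over a list of rows. -/
def sigProd (g : ℕ → ℕ × ℕ) : List ℕ → ℕ × ℕ
  | [] => (0, 0)
  | j :: js => bmul (g j) (sigProd g js)

theorem sigProd_append (g : ℕ → ℕ × ℕ) (js ks : List ℕ) :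
    sigProd g (js ++ ks) = bmul (sigProd g js) (sigProd g ks) := by
  induction js with
  | nil => simp [sigProd, bmul]
  | cons j js ih => simp [sigProd, ih, bmul_assoc]

theorem sigProd_congr {g g' : ℕ → ℕ × ℕ} {js : List ℕ} (h : ∀ j ∈ js, g j = g' j) :
    sigProd g js = sigProd g' js := by
  induction js with
  | nil => rfl
  | cons j js ih =>
    simp only [List.mem_cons, forall_eq_or_imp] at h
    simp [sigProd, h.1, ih h.2]

theorem sig_flatMap {A : Type} (t : ℕ → List (Bracket × A)) (js : List ℕ) :
    sig (js.flatMap t) = sigProd (fun j => sig (t j)) js := by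
  induction js with
  | nil => rfl
  | cons j js ih => simp [sigProd, sig_append, ih]

/-- The leftmost uncanceled `(` of the rows `js`, followed by a row with `y` brackets `)` after
cancellation, is in the row `j`. -/
def SelF (g : ℕ → ℕ × ℕ) (js : List ℕ) (y j : ℕ) : Prop :=
  ∃ pre post, js = pre ++ j :: post ∧ (sigProd g pre).2 ≤ (g j).1 ∧
    (bmul (sigProd g post) (y, 0)).1 < (g j).2

/-- The rightmost uncanceled `)` of the rows `js`, followed by a row with `y` brackets `)` after
cancellation, is in the row `j`. -/
def SelE (g : ℕ → ℕ × ℕ) (js : List ℕ) (y j : ℕ) : Prop :=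
  ∃ pre post, js = pre ++ j :: post ∧ (sigProd g pre).2 < (g j).1 ∧
    (bmul (sigProd g post) (y, 0)).1 ≤ (g j).2

theorem SelF.mem {g : ℕ → ℕ × ℕ} {js : List ℕ} {y j : ℕ} (h : SelF g js y j) : j ∈ js := by
  obtain ⟨pre, post, rfl, -⟩ := h
  simp

theorem SelE.mem {g : ℕ → ℕ × ℕ} {js : List ℕ} {y j : ℕ} (h : SelE g js y j) : j ∈ js := by
  obtain ⟨pre, post, rfl, -⟩ := h
  simp

theorem SelF.pos {g : ℕ → ℕ × ℕ} {js : List ℕ} {y j : ℕ} (h : SelF g js y j) : 0 < (g j).2 := by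
  obtain ⟨pre, post, -, -, h⟩ := h
  omega

theorem SelE.pos {g : ℕ → ℕ × ℕ} {js : List ℕ} {y j : ℕ} (h : SelE g js y j) : 0 < (g j).1 := by
  obtain ⟨pre, post, -, h, -⟩ := h
  omega

/-- In the first alternative the `y` closing brackets of the last row cancel every `(` of the rows
`js`, so that the operator acts beyond these rows. -/
theorem exists_selF (g : ℕ → ℕ × ℕ) (js : List ℕ) (y : ℕ) :
    (sigProd g js).2 ≤ y ∨ ∃ j, SelF g js y j := by
  induction js with
  | nil => simp [sigProd]
  | cons j js ih =>
    by_cases hj : (bmul (sigProd g js) (y, 0)).1 < (g j).2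
    · exact Or.inr ⟨j, [], js, rfl, by simp [sigProd], hj⟩
    rcases ih with ih | ⟨k, pre, post, rfl, h1, h2⟩
    · left
      simp only [sigProd, bmul] at hj ⊢
      omega
    · right
      refine ⟨k, j :: pre, post, rfl, ?_, h2⟩
      simp only [sigProd, bmul, sigProd_append] at *
      omega

/-- The three alternatives: the rightmost uncanceled `)` is in the last row, it is in one of the
rows `js`, or there is none. -/
theorem exists_selE (g : ℕ → ℕ × ℕ) (js : List ℕ) (y : ℕ) :
    (sigProd g js).2 < y ∨ (∃ j, SelE g js y j) ∨ (bmul (sigProd g js) (y, 0)).1 = 0 := by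
  induction js with
  | nil => simp [sigProd, bmul]; omega
  | cons j js ih =>
    by_cases hj : (bmul (sigProd g js) (y, 0)).1 ≤ (g j).2
    · by_cases h0 : (g j).1 = 0
      · right; right
        simp only [sigProd, bmul] at *
        omega
      · exact Or.inr (Or.inl ⟨j, [], js, rfl, by simp only [sigProd]; omega, hj⟩)
    rcases ih with ih | ⟨k, pre, post, rfl, h1, h2⟩ | ih
    · left
      simp only [sigProd, bmul] at *
      omega
    · right; left
      refine ⟨k, j :: pre, post, rfl, ?_, h2⟩
      simp only [sigProd, bmul, sigProd_append] at *
      omega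
    · omega

theorem SelF.congr {g g' : ℕ → ℕ × ℕ} {js : List ℕ} {y j : ℕ} (h : ∀ k ∈ js, g k = g' k)
    (hs : SelF g js y j) : SelF g' js y j := by
  obtain ⟨pre, post, rfl, h1, h2⟩ := hs
  refine ⟨pre, post, rfl, ?_, ?_⟩
  · rwa [← sigProd_congr fun k hk => h k (by simp [hk]), ← h j (by simp)]
  · rwa [← sigProd_congr fun k hk => h k (by simp [hk]), ← h j (by simp)]

theorem SelE.congr {g g' : ℕ → ℕ × ℕ} {js : List ℕ} {y j : ℕ} (h : ∀ k ∈ js, g k = g' k)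
    (hs : SelE g js y j) : SelE g' js y j := by
  obtain ⟨pre, post, rfl, h1, h2⟩ := hs
  refine ⟨pre, post, rfl, ?_, ?_⟩
  · rwa [← sigProd_congr fun k hk => h k (by simp [hk]), ← h j (by simp)]
  · rwa [← sigProd_congr fun k hk => h k (by simp [hk]), ← h j (by simp)]

/-- `g'` arises from `g` by turning a `(` in row `j` into a `)`. -/
structure Flip (g g' : ℕ → ℕ × ℕ) (js : List ℕ) (j : ℕ) : Prop where
  fst_eq : (g' j).1 = (g j).1 + 1
  snd_eq : (g j).2 = (g' j).2 + 1
  off : ∀ k ∈ js, k ≠ j → g k = g' k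

theorem Flip.sigProd_eq {g g' : ℕ → ℕ × ℕ} {pre post : List ℕ} {j : ℕ}
    (hf : Flip g g' (pre ++ j :: post) j) (hn : (pre ++ j :: post).Nodup) :
    sigProd g pre = sigProd g' pre ∧ sigProd g post = sigProd g' post := by
  have h1 : j ∉ pre ++ post := (List.nodup_middle.1 hn).notMem
  simp only [List.mem_append, not_or] at h1
  constructor
  · exact sigProd_congr fun k hk => hf.off k (by simp [hk]) (by rintro rfl; exact h1.1 hk)
  · exact sigProd_congr fun k hk => hf.off k (by simp [hk]) (by rintro rfl; exact h1.2 hk)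

/-- Once a `(` of the selected row has become `)`, that row holds the rightmost uncanceled `)`: the
bounds x ≤ y and x < y + 1 are the same. With its converse this makes e_i and f_i mutually inverse
at the level of rows. -/
theorem SelF.selE {g g' : ℕ → ℕ × ℕ} {js : List ℕ} {y j : ℕ} (hn : js.Nodup)
    (hf : Flip g g' js j) (hs : SelF g js y j) : SelE g' js y j := by
  obtain ⟨pre, post, rfl, h1, h2⟩ := hs
  obtain ⟨e1, e2⟩ := hf.sigProd_eq hn
  have := hf.fst_eq
  have := hf.snd_eq
  exact ⟨pre, post, rfl, by rw [← e1]; omega, by rw [← e2]; omega⟩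

theorem SelE.selF {g g' : ℕ → ℕ × ℕ} {js : List ℕ} {y j : ℕ} (hn : js.Nodup)
    (hf : Flip g g' js j) (hs : SelE g' js y j) : SelF g js y j := by
  obtain ⟨pre, post, rfl, h1, h2⟩ := hs
  obtain ⟨e1, e2⟩ := hf.sigProd_eq hn
  have := hf.fst_eq
  have := hf.snd_eq
  exact ⟨pre, post, rfl, by rw [e1]; omega, by rw [e2]; omega⟩

theorem SelF.bmul_sigProd_fst {g g' : ℕ → ℕ × ℕ} {js : List ℕ} {y j : ℕ} (hn : js.Nodup)
    (hf : Flip g g' js j) (hs : SelF g js y j) :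
    (bmul (sigProd g' js) (y, 0)).1 = (bmul (sigProd g js) (y, 0)).1 + 1 := by
  obtain ⟨pre, post, rfl, h1, h2⟩ := hs
  obtain ⟨e1, e2⟩ := hf.sigProd_eq hn
  have := hf.fst_eq
  have := hf.snd_eq
  simp only [sigProd_append, sigProd, ← e1, ← e2]
  simp only [bmul] at *
  omega

section Brackets

variable {A : Type} {t : ℕ → List (Bracket × A)} {js : List ℕ} {Y : List (Bracket × A)} {j : ℕ}

theorem SelF.head?_eq (hs : SelF (fun j => sig (t j)) js (sig Y).1 j) :
    (uncanceled (js.flatMap t ++ Y)).2.head? = (uncanceled (t j)).2.head? := by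
  obtain ⟨pre, post, rfl, h1, h2⟩ := hs
  have := head?_uncanceled_append (pre.flatMap t) (t j) (post.flatMap t ++ Y)
    (by rwa [sig_flatMap]) (by rw [sig_append, sig_flatMap]; exact h2)
  simpa [List.append_assoc] using this

theorem SelE.getLast?_eq (hs : SelE (fun j => sig (t j)) js (sig Y).1 j) :
    (uncanceled (js.flatMap t ++ Y)).1.getLast? = (uncanceled (t j)).1.getLast? := by
  obtain ⟨pre, post, rfl, h1, h2⟩ := hs
  have := getLast?_uncanceled_append (pre.flatMap t) (t j) (post.flatMap t ++ Y)
    (by rwa [sig_flatMap]) (by rw [sig_append, sig_flatMap]; exact h2)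
  simpa [List.append_assoc] using this

end Brackets

/-! ### Roots -/

/-- The index `k` of the letters `k` and `k̄`. -/
def Letter.idx : Letter → ℕ
  | pos k => k
  | neg k => k

@[simp] theorem Letter.idx_pos (k : ℕ) : (pos k).idx = k := rfl

@[simp] theorem Letter.idx_neg (k : ℕ) : (neg k).idx = k := rfl

/-- `ε_j` minus the weight of a letter: `β_{j,k}` and `γ_{j,k}` belong to the letters `k+1` and
`k̄`. -/
def root (n j : ℕ) (z : Letter) : Weight n := ep n j - z.weight n

/-- The pairs of a row `j` and a letter for which `root n j z` is a positive root. -/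
def IsRt (n j : ℕ) (z : Letter) : Prop := 1 ≤ j ∧ j < z.idx ∧ z.idx ≤ n

theorem beta_eq_root (n j k : ℕ) : beta n j k = root n j (pos (k + 1)) := rfl

theorem gamma_eq_root (n j k : ℕ) : gamma n j k = root n j (neg k) := by
  simp [gamma, root, Letter.weight]

theorem mem_posRoots {n : ℕ} {v : Weight n} :
    v ∈ posRoots n ↔ ∃ j z, IsRt n j z ∧ v = root n j z := by
  simp only [posRoots, Finset.mem_union, Finset.mem_image, Finset.mem_filter, Finset.mem_product,
    Finset.mem_Icc, Prod.exists]
  constructor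
  · rintro (⟨j, k, ⟨⟨h1, h2⟩, h3⟩, rfl⟩ | ⟨j, k, ⟨⟨h1, h2⟩, h3⟩, rfl⟩)
    · exact ⟨j, pos (k + 1), ⟨h1.1, by simp; omega, by simp; omega⟩, rfl⟩
    · exact ⟨j, neg k, ⟨h1.1, by simp; omega, by simp; omega⟩, gamma_eq_root n j k⟩
  · rintro ⟨j, z, ⟨h1, h2, h3⟩, rfl⟩
    cases z with
    | pos k =>
      simp only [idx_pos] at h2 h3
      exact Or.inl ⟨j, k - 1, ⟨⟨⟨h1, by omega⟩, by omega, by omega⟩, by omega⟩, by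
        rw [beta_eq_root, Nat.sub_add_cancel (by omega)]⟩
    | neg k =>
      simp only [idx_neg] at h2 h3
      exact Or.inr ⟨j, k, ⟨⟨⟨h1, by omega⟩, by omega, by omega⟩, by omega⟩, gamma_eq_root n j k⟩

theorem root_mem {n j : ℕ} {z : Letter} (h : IsRt n j z) : root n j z ∈ posRoots n :=
  mem_posRoots.2 ⟨j, z, h, rfl⟩

/-- The coefficient of `ε_m` in the weight of a letter. -/
def Letter.sgn (m : ℕ) : Letter → ℤ
  | pos k => if m = k then 1 else 0
  | neg k => if m = k then -1 else 0

theorem root_apply {n j m : ℕ} {z : Letter} (h1 : 1 ≤ m) (h2 : m ≤ n) :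
    root n j z ⟨m - 1, by omega⟩ = (if m = j then 1 else 0) - z.sgn m := by
  cases z <;> simp [root, ep, Letter.weight, Letter.sgn, Nat.sub_add_cancel h1]
  split_ifs <;> simp

theorem Letter.ext_sgn {z z' : Letter} (h : z.sgn z.idx = z'.sgn z.idx) : z = z' := by
  cases z <;> cases z' <;> simp only [Letter.sgn, idx_pos, idx_neg, if_true] at h <;>
    split_ifs at h <;> simp_all

theorem Letter.sgn_of_ne {z : Letter} {m : ℕ} (h : m ≠ z.idx) : z.sgn m = 0 := by
  cases z <;> simp_all [Letter.sgn]

/-- The row is the position of the first nonzero coordinate, because the index of the letter is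
larger; the coordinate at this index then determines the letter. -/
theorem root_inj {n j j' : ℕ} {z z' : Letter} (h : IsRt n j z) (h' : IsRt n j' z') :
    root n j z = root n j' z' ↔ j = j' ∧ z = z' := by
  refine ⟨fun e => ?_, by rintro ⟨rfl, rfl⟩; rfl⟩
  obtain ⟨a1, a2, a3⟩ := h
  obtain ⟨b1, b2, b3⟩ := h'
  have key : ∀ m, 1 ≤ m → m ≤ n →
      (if m = j then 1 else 0) - z.sgn m = (if m = j' then 1 else 0) - z'.sgn m := by
    intro m h1 h2
    rw [← root_apply h1 h2, ← root_apply h1 h2, e]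
  have hj : j = j' := by
    rcases lt_trichotomy j j' with hlt | rfl | hlt
    · have := key j a1 (by omega)
      rw [if_pos rfl, if_neg (by omega), sgn_of_ne (by omega), sgn_of_ne (by omega)] at this
      omega
    · rfl
    · have := key j' b1 (by omega)
      rw [if_pos rfl, if_neg (by omega), sgn_of_ne (by omega), sgn_of_ne (by omega)] at this
      omega
  subst hj
  exact ⟨rfl, Letter.ext_sgn (by have := key z.idx (by omega) a3; omega)⟩

theorem posRoots_apply_bounds {n : ℕ} {v : Weight n} (h : v ∈ posRoots n) (m : ℕ) (h1 : 1 ≤ m)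
    (h2 : m ≤ n) : -1 ≤ v ⟨m - 1, by omega⟩ ∧ v ⟨m - 1, by omega⟩ ≤ 1 := by
  obtain ⟨j, z, ⟨a1, a2, a3⟩, rfl⟩ := mem_posRoots.1 h
  rw [root_apply h1 h2]
  by_cases hm : m = z.idx
  · rw [if_neg (by omega)]
    cases z <;> simp only [Letter.sgn] <;> split_ifs <;> omega
  · rw [sgn_of_ne hm]
    split_ifs <;> omega

theorem zero_notMem_posRoots (n : ℕ) : (0 : Weight n) ∉ posRoots n := by
  intro h
  obtain ⟨j, z, ⟨a1, a2, a3⟩, e⟩ := mem_posRoots.1 h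
  have := root_apply (z := z) (j := j) a1 (show j ≤ n by omega)
  rw [← e, if_pos rfl, sgn_of_ne (by omega)] at this
  simp at this

/-! ### The arrows of a given colour -/

/-- The arrows of colour `i` in the fundamental crystal are `s → B` and `C → s̄`. -/
structure Arrows (n i s : ℕ) (B C : Letter) : Prop where
  one_le : 1 ≤ s
  lt : s < n
  cases : (B = pos (s + 1) ∧ C = neg (s + 1)) ∨ (s + 1 = n ∧ B = neg n ∧ C = pos n)
  next_eq : ∀ z : Letter,
    z.next n i = if z = pos s then some B else if z = C then some (neg s) else none
  prev_eq : ∀ z : Letter,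
    z.prev n i = if z = B then some (pos s) else if z = neg s then some C else none
  simpleRoot_eq : simpleRoot n i = root n s B
  rootList_eq : rootList n i = (List.range' 1 (s - 1)).flatMap
    (fun k => [root n k B, root n k (pos s), root n k (neg s), root n k C]) ++ [root n s B]
  column_iff : ∀ j, (1 ≤ j ∧ j ≤ i ∧ j < n) ↔ (1 ≤ j ∧ j ≤ s)

theorem arrows_of_lt {n i : ℕ} (h1 : 1 ≤ i) (h2 : i < n) :
    Arrows n i i (pos (i + 1)) (neg (i + 1)) where
  one_le := h1
  lt := h2
  cases := Or.inl ⟨rfl, rfl⟩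
  next_eq z := by
    cases z <;> simp [Letter.next, h2, h2.ne]
  prev_eq z := by
    cases z <;> simp [Letter.prev, h2, h2.ne]
  simpleRoot_eq := by simp [simpleRoot, h2.ne, root, Letter.weight]
  rootList_eq := by
    rw [rootList, if_neg h2.ne]
    simp only [beta_eq_root, gamma_eq_root, Nat.sub_add_cancel h1]
  column_iff j := by omega

theorem arrows_self {n : ℕ} (hn : 2 ≤ n) : Arrows n n (n - 1) (neg n) (pos n) where
  one_le := by omega
  lt := by omega
  cases := Or.inr ⟨by omega, rfl, rfl⟩
  next_eq z := by
    cases z <;> simp [Letter.next]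
  prev_eq z := by
    cases z <;> simp [Letter.prev]
  simpleRoot_eq := by simp [simpleRoot, root, Letter.weight]
  rootList_eq := by
    rw [rootList, if_pos rfl, gamma_eq_root, show n - 1 - 1 = n - 2 by omega]
    congr 1
    refine List.flatMap_congr fun k hk => ?_
    have : n - 2 + 1 = n - 1 := by omega
    have : n - 1 + 1 = n := by omega
    simp only [beta_eq_root, gamma_eq_root, *]
  column_iff j := by omega

theorem exists_arrows {n i : ℕ} (hn : 2 ≤ n) (h1 : 1 ≤ i) (h2 : i ≤ n) :
    ∃ s B C, Arrows n i s B C := by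
  rcases h2.lt_or_eq with h | rfl
  · exact ⟨_, _, _, arrows_of_lt h1 h⟩
  · exact ⟨_, _, _, arrows_self hn⟩

namespace Arrows

variable {n i s : ℕ} {B C : Letter}

theorem idx_B (h : Arrows n i s B C) : B.idx = s + 1 := by
  rcases h.cases with ⟨rfl, rfl⟩ | ⟨e, rfl, rfl⟩ <;> simp [*]

theorem idx_C (h : Arrows n i s B C) : C.idx = s + 1 := by
  rcases h.cases with ⟨rfl, rfl⟩ | ⟨e, rfl, rfl⟩ <;> simp [*]

theorem B_ne_C (h : Arrows n i s B C) : B ≠ C := by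
  rcases h.cases with ⟨rfl, rfl⟩ | ⟨e, rfl, rfl⟩ <;> simp

theorem eq_of_idx (h : Arrows n i s B C) {z : Letter} (hz : z.idx = s + 1) : z = B ∨ z = C := by
  rcases h.cases with ⟨rfl, rfl⟩ | ⟨e, rfl, rfl⟩ <;> cases z <;> simp_all

theorem B_ne_pos (h : Arrows n i s B C) : B ≠ pos s := by
  intro e
  have := h.idx_B
  simp [e] at this

theorem B_ne_neg (h : Arrows n i s B C) : B ≠ neg s := by
  intro e
  have := h.idx_B
  simp [e] at this

theorem C_ne_pos (h : Arrows n i s B C) : C ≠ pos s := by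
  intro e
  have := h.idx_C
  simp [e] at this

theorem C_ne_neg (h : Arrows n i s B C) : C ≠ neg s := by
  intro e
  have := h.idx_C
  simp [e] at this

theorem weight_B_add_C (h : Arrows n i s B C) : B.weight n + C.weight n = 0 := by
  rcases h.cases with ⟨rfl, rfl⟩ | ⟨e, rfl, rfl⟩ <;> simp [Letter.weight]

theorem root_pos_add (h : Arrows n i s B C) (j : ℕ) :
    root n j (pos s) + simpleRoot n i = root n j B := by
  simp [h.simpleRoot_eq, root, Letter.weight]

theorem root_C_add (h : Arrows n i s B C) (j : ℕ) :
    root n j C + simpleRoot n i = root n j (neg s) := by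
  have := h.weight_B_add_C
  simp only [h.simpleRoot_eq, root, show (neg s).weight n = -ep n s from rfl]
  rw [eq_neg_of_add_eq_zero_left this]
  abel

theorem isRt_B (h : Arrows n i s B C) {j : ℕ} (h1 : 1 ≤ j) (h2 : j ≤ s) : IsRt n j B :=
  ⟨h1, by rw [h.idx_B]; omega, by rw [h.idx_B]; exact h.lt⟩

theorem isRt_C (h : Arrows n i s B C) {j : ℕ} (h1 : 1 ≤ j) (h2 : j ≤ s) : IsRt n j C :=
  ⟨h1, by rw [h.idx_C]; omega, by rw [h.idx_C]; exact h.lt⟩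

theorem isRt_pos (h : Arrows n i s B C) {j : ℕ} (h1 : 1 ≤ j) (h2 : j < s) : IsRt n j (pos s) :=
  ⟨h1, h2, h.lt.le⟩

theorem isRt_neg (h : Arrows n i s B C) {j : ℕ} (h1 : 1 ≤ j) (h2 : j < s) : IsRt n j (neg s) :=
  ⟨h1, h2, h.lt.le⟩

/-- The coordinate at ε_s would be -2. This excludes the `)` alternative, which takes precedence in
`kpBrackets`. -/
theorem root_pos_sub_notMem (h : Arrows n i s B C) {j : ℕ} (h2 : j < s) :
    root n j (pos s) - simpleRoot n i ∉ posRoots n := by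
  intro hm
  have := (posRoots_apply_bounds hm s h.one_le h.lt.le).1
  rw [h.simpleRoot_eq, Pi.sub_apply, root_apply h.one_le h.lt.le, root_apply h.one_le h.lt.le,
    sgn_of_ne (z := B) (by rw [h.idx_B]; omega)] at this
  simp [Letter.sgn, h2.ne'] at this

/-- The coordinate at ε_{s+1} would be 2 or -2, as B and C have opposite weights. -/
theorem root_C_sub_notMem (h : Arrows n i s B C) {j : ℕ} (h2 : j < s) :
    root n j C - simpleRoot n i ∉ posRoots n := by
  intro hm
  have h3 := posRoots_apply_bounds hm (s + 1) (by omega) h.lt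
  rw [h.simpleRoot_eq, Pi.sub_apply, root_apply (by omega) h.lt, root_apply (by omega) h.lt,
    if_neg (by omega), if_neg (by omega)] at h3
  rcases h.cases with ⟨rfl, rfl⟩ | ⟨e, rfl, rfl⟩ <;> simp_all [Letter.sgn]

end Arrows

/-! ### Coefficients of Kostant partitions -/

/-- The coefficient of `root n j z`. -/
def cf (n : ℕ) (a : Kp n) (j : ℕ) (z : Letter) : ℕ := coeff n a (root n j z)

theorem cf_eq {n j : ℕ} {z : Letter} (a : Kp n) (h : IsRt n j z) :
    cf n a j z = a ⟨root n j z, root_mem h⟩ := by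
  simp [cf, coeff, root_mem h]

theorem ext_cf {n : ℕ} {a b : Kp n} (h : ∀ j z, IsRt n j z → cf n a j z = cf n b j z) :
    a = b := by
  funext ⟨v, hv⟩
  obtain ⟨j, z, hz, rfl⟩ := mem_posRoots.1 hv
  have := h j z hz
  rwa [cf_eq a hz, cf_eq b hz] at this

theorem cf_add {n j : ℕ} {z : Letter} (a b : Kp n) :
    cf n (a + b) j z = cf n a j z + cf n b j z := by
  simp only [cf, coeff]
  split_ifs <;> simp

theorem cf_sub {n j : ℕ} {z : Letter} (a b : Kp n) :
    cf n (a - b) j z = cf n a j z - cf n b j z := by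
  simp only [cf, coeff]
  split_ifs <;> simp

theorem cf_zero {n j : ℕ} {z : Letter} : cf n 0 j z = 0 := by
  simp [cf, coeff]

theorem cf_smul {n j : ℕ} {z : Letter} (m : ℕ) (a : Kp n) :
    cf n (m • a) j z = m * cf n a j z := by
  simp only [cf, coeff]
  split_ifs <;> simp

theorem cf_sum {n j : ℕ} {z : Letter} {ι : Type*} (S : Finset ι) (a : ι → Kp n) :
    cf n (∑ k ∈ S, a k) j z = ∑ k ∈ S, cf n (a k) j z := by
  classical
  induction S using Finset.induction_on with
  | empty => simp [cf_zero]
  | insert k S hk ih => simp [Finset.sum_insert hk, cf_add, ih]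

theorem cf_part {n j j' : ℕ} {z z' : Letter} (h : IsRt n j z) (h' : IsRt n j' z') :
    cf n (part n (root n j' z')) j z = if j = j' ∧ z = z' then 1 else 0 := by
  simp [cf_eq _ h, part, root_inj h h']

theorem part_zero (n : ℕ) : part n 0 = 0 := by
  funext ⟨v, hv⟩
  have : v ≠ 0 := by rintro rfl; exact zero_notMem_posRoots n hv
  simp [part, this]

/-- Replace a part `root n j x` by `root n j x'`. -/
def move (n : ℕ) (a : Kp n) (j : ℕ) (x x' : Letter) : Kp n :=
  a - part n (root n j x) + part n (root n j x')

theorem cf_move {n j k : ℕ} {x x' z : Letter} (a : Kp n) (h : IsRt n j x) (h' : IsRt n j x')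
    (hz : IsRt n k z) : cf n (move n a j x x') k z =
      cf n a k z - (if k = j ∧ z = x then 1 else 0) + (if k = j ∧ z = x' then 1 else 0) := by
  rw [move, cf_add, cf_sub, cf_part hz h, cf_part hz h']

/-- Subtraction of parts is truncated, so a part `root n j x` must be present for the move to be
reversible. -/
theorem move_move {n j : ℕ} {x x' : Letter} (a : Kp n) (h : IsRt n j x) (h' : IsRt n j x')
    (hx : x ≠ x') (hpos : 0 < cf n a j x) : move n (move n a j x x') j x' x = a := by
  refine ext_cf fun k z hz => ?_
  rw [cf_move _ h' h hz, cf_move _ h h' hz]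
  by_cases hk : k = j ∧ z = x
  · obtain ⟨rfl, rfl⟩ := hk
    simp [hx]
    omega
  · simp [hk]

/-! ### Brackets of Kostant partitions -/

/-- The brackets of a Kostant partition in row `j`. -/
def kpRow (n s : ℕ) (B C : Letter) (a : Kp n) (j : ℕ) : List (Bracket × Weight n) :=
  fourRuns (List.replicate (cf n a j B) (root n j B))
    (List.replicate (cf n a j (pos s)) (root n j (pos s)))
    (List.replicate (cf n a j (neg s)) (root n j (neg s)))
    (List.replicate (cf n a j C) (root n j C))

/-- The signature of a Kostant partition in row `j`. -/
def kpSig (n s : ℕ) (B C : Letter) (a : Kp n) (j : ℕ) : ℕ × ℕ :=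
  (cf n a j B + (cf n a j (neg s) - cf n a j (pos s)),
    (cf n a j (pos s) - cf n a j (neg s)) + cf n a j C)

theorem sig_kpRow (n s : ℕ) (B C : Letter) (a : Kp n) :
    (fun j => sig (kpRow n s B C a j)) = kpSig n s B C a := by
  funext j
  simp [kpRow, sig_fourRuns, kpSig]

/-- The brackets of a Kostant partition for its last root. -/
def kpLast (n s : ℕ) (B : Letter) (a : Kp n) : List (Bracket × Weight n) :=
  (List.replicate (cf n a s B) (root n s B)).map (Prod.mk Bracket.closing)

theorem sig_kpLast (n s : ℕ) (B : Letter) (a : Kp n) :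
    sig (kpLast n s B a) = (cf n a s B, 0) := by
  simp only [sig, kpLast, uncanceled_map_closing]
  simp

namespace Arrows

variable {n i s : ℕ} {B C : Letter}

theorem kpBrackets_eq (h : Arrows n i s B C) (a : Kp n) : kpBrackets n i a =
    (List.range' 1 (s - 1)).flatMap (kpRow n s B C a) ++ kpLast n s B a := by
  rw [kpBrackets, h.rootList_eq, List.flatMap_append]
  congr 1
  · rw [List.flatMap_assoc]
    refine List.flatMap_congr fun j hj => ?_
    have h1 : 1 ≤ j := by simp at hj; omega
    have h2 : j < s := by simp at hj; omega
    have e1 : root n j B - simpleRoot n i ∈ posRoots n := by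
      rw [← h.root_pos_add, add_sub_cancel_right]
      exact root_mem (h.isRt_pos h1 h2)
    have e2 : root n j (neg s) - simpleRoot n i ∈ posRoots n := by
      rw [← h.root_C_add, add_sub_cancel_right]
      exact root_mem (h.isRt_C h1 h2.le)
    have e3 : root n j (pos s) + simpleRoot n i ∈ posRoots n := by
      rw [h.root_pos_add]
      exact root_mem (h.isRt_B h1 h2.le)
    have e4 : root n j C + simpleRoot n i ∈ posRoots n := by
      rw [h.root_C_add]
      exact root_mem (h.isRt_neg h1 h2)
    have e5 : root n j (pos s) ≠ simpleRoot n i := by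
      rw [h.simpleRoot_eq, Ne, root_inj (h.isRt_pos h1 h2) (h.isRt_B h.one_le le_rfl)]
      omega
    have e6 : root n j C ≠ simpleRoot n i := by
      rw [h.simpleRoot_eq, Ne, root_inj (h.isRt_C h1 h2.le) (h.isRt_B h.one_le le_rfl)]
      omega
    simp [e1, e2, e3, e4, e5, e6, h.root_pos_sub_notMem h2, h.root_C_sub_notMem h2, kpRow, fourRuns,
      cf]
  · simp [h.simpleRoot_eq, kpLast, cf]

theorem kpEps_eq (h : Arrows n i s B C) (a : Kp n) : kpEps n i a =
    ((bmul (sigProd (kpSig n s B C a) (List.range' 1 (s - 1))) (cf n a s B, 0)).1 : ℕ) := by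
  rw [kpEps, h.kpBrackets_eq]
  change ((sig _).1 : ℤ) = _
  rw [sig_append, sig_flatMap, sig_kpRow, sig_kpLast]

/-- The copies of α_i are the only brackets of row s, and they are all closing. If they cancel every
`(` above, none is left and a new (α_i) is added. -/
theorem kpF_last (h : Arrows n i s B C) {a : Kp n}
    (hs : (sigProd (kpSig n s B C a) (List.range' 1 (s - 1))).2 ≤ cf n a s B) :
    kpF n i a = a + part n (root n s B) := by
  have : (uncanceled (kpBrackets n i a)).2 = [] := by
    rw [← List.length_eq_zero_iff, h.kpBrackets_eq]
    change (sig _).2 = 0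
    rw [sig_append, sig_flatMap, sig_kpRow, sig_kpLast]
    simp only [bmul]
    omega
  simp [kpF, this, h.simpleRoot_eq]

theorem kpE_last (h : Arrows n i s B C) {a : Kp n}
    (hs : (sigProd (kpSig n s B C a) (List.range' 1 (s - 1))).2 < cf n a s B) :
    kpE n i a = some (a - part n (root n s B)) := by
  have h1 : (uncanceled (kpBrackets n i a)).1.getLast? = some (root n s B) := by
    have := getLast?_uncanceled_append ((List.range' 1 (s - 1)).flatMap (kpRow n s B C a))
      (kpLast n s B a) [] (by rw [sig_flatMap, sig_kpRow, sig_kpLast]; exact hs)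
      (by simp [sig, uncanceled])
    rw [h.kpBrackets_eq]
    rw [List.append_nil] at this
    rw [this, kpLast, uncanceled_map_closing, List.getLast?_replicate, if_neg (by omega)]
  -- The rule adds the part (α_i - α_i), which is (0) = 0.
  simp [kpE, h1, h.simpleRoot_eq, part_zero]

theorem kpE_none (h : Arrows n i s B C) {a : Kp n}
    (hs : (bmul (sigProd (kpSig n s B C a) (List.range' 1 (s - 1))) (cf n a s B, 0)).1 = 0) :
    kpE n i a = none := by
  have : (uncanceled (kpBrackets n i a)).1 = [] := by
    rw [← List.length_eq_zero_iff, h.kpBrackets_eq]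
    change (sig _).1 = 0
    rwa [sig_append, sig_flatMap, sig_kpRow, sig_kpLast]
  simp [kpE, this]

/-- In the selected row the `(` of s come before those of C, but are canceled first by the `)` of
s̄; one of them survives exactly if s occurs more often than s̄. -/
theorem kpF_row (h : Arrows n i s B C) {a : Kp n} {j : ℕ}
    (hs : SelF (kpSig n s B C a) (List.range' 1 (s - 1)) (cf n a s B) j) :
    kpF n i a = if cf n a j (neg s) < cf n a j (pos s) then move n a j (pos s) B
      else move n a j C (neg s) := by
  have hp := hs.pos
  rw [← sig_kpRow] at hs
  have h1 := SelF.head?_eq (Y := kpLast n s B a) (by rw [sig_kpLast]; exact hs)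
  rw [← h.kpBrackets_eq, kpRow, uncanceled_fourRuns] at h1
  simp only [kpSig, List.length_replicate, List.take_replicate, List.head?_append,
    List.head?_replicate] at h1 hp
  split_ifs with hc
  · rw [if_neg (by omega)] at h1
    simp [kpF, h1, move, h.root_pos_add]
  · rw [if_pos (by omega), if_neg (by omega)] at h1
    simp [kpF, h1, move, h.root_C_add]

theorem kpE_row (h : Arrows n i s B C) {a : Kp n} {j : ℕ}
    (hs : SelE (kpSig n s B C a) (List.range' 1 (s - 1)) (cf n a s B) j) :
    kpE n i a = some (if cf n a j (pos s) < cf n a j (neg s) then move n a j (neg s) C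
      else move n a j B (pos s)) := by
  have hp := hs.pos
  rw [← sig_kpRow] at hs
  have h1 := SelE.getLast?_eq (Y := kpLast n s B a) (by rw [sig_kpLast]; exact hs)
  rw [← h.kpBrackets_eq, kpRow, uncanceled_fourRuns] at h1
  simp only [kpSig, List.length_replicate, List.drop_replicate, List.getLast?_append,
    List.getLast?_replicate] at h1 hp
  split_ifs with hc
  · rw [if_neg (by omega)] at h1
    simp [kpE, h1, move, ← h.root_C_add]
  · rw [if_pos (by omega), if_neg (by omega)] at h1
    simp [kpE, h1, move, ← h.root_pos_add]

end Arrows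

/-! ### The crystal of Kostant partitions -/

theorem kpWt_add {n : ℕ} (a b : Kp n) : kpWt n (a + b) = kpWt n a + kpWt n b := by
  simp only [kpWt, Pi.add_apply, add_smul, Finset.sum_add_distrib, neg_add]

theorem kpWt_zero (n : ℕ) : kpWt n 0 = 0 := by
  simp [kpWt]

theorem kpWt_part {n j : ℕ} {z : Letter} (h : IsRt n j z) :
    kpWt n (part n (root n j z)) = -root n j z := by
  rw [kpWt, Finset.sum_eq_single ⟨root n j z, root_mem h⟩]
  · simp [part]
  · intro b _ hb
    have : b.1 ≠ root n j z := fun e => hb (Subtype.ext e)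
    simp [part, this]
  · simp

theorem sub_part_add {n j : ℕ} {z : Letter} {a : Kp n} (h : IsRt n j z) (hp : 0 < cf n a j z) :
    a - part n (root n j z) + part n (root n j z) = a := by
  refine ext_cf fun k y hy => ?_
  rw [cf_add, cf_sub, cf_part hy h]
  split_ifs with e
  · obtain ⟨rfl, rfl⟩ := e
    omega
  · omega

theorem kpWt_move {n j : ℕ} {x x' : Letter} {a : Kp n} (h : IsRt n j x) (h' : IsRt n j x')
    (hp : 0 < cf n a j x) :
    kpWt n (move n a j x x') = kpWt n a + root n j x - root n j x' := by
  have h1 := congrArg (kpWt n) (sub_part_add h hp)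
  rw [kpWt_add, kpWt_part h] at h1
  rw [move, kpWt_add, kpWt_part h', ← h1]
  abel

theorem pairing_sub {n i : ℕ} (v w : Weight n) :
    pairing n i (v - w) = pairing n i v - pairing n i w := by
  simp [pairing, mul_sub, Finset.sum_sub_distrib]

theorem pairing_ep {n i k : ℕ} (h1 : 1 ≤ k) (h2 : k ≤ n) :
    pairing n i (ep n k) = simpleRoot n i ⟨k - 1, by omega⟩ := by
  rw [pairing, Finset.sum_eq_single ⟨k - 1, by omega⟩]
  · simp [ep, Nat.sub_add_cancel h1]
  · rintro ⟨b, hb⟩ - hne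
    have : b + 1 ≠ k := by
      rintro rfl
      simp at hne
    simp [ep, this]
  · simp

theorem Letter.weight_eq_smul {n : ℕ} (z : Letter) : z.weight n = z.sgn z.idx • ep n z.idx := by
  cases z <;> simp [Letter.weight, Letter.sgn]

theorem Letter.sgn_mul_self (z : Letter) : z.sgn z.idx * z.sgn z.idx = 1 := by
  cases z <;> simp [Letter.sgn]

theorem pairing_smul {n i : ℕ} (c : ℤ) (v : Weight n) :
    pairing n i (c • v) = c * pairing n i v := by
  simp [pairing, Finset.mul_sum, mul_left_comm]

namespace Arrows

variable {n i s : ℕ} {B C : Letter}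

theorem pairing_simpleRoot (h : Arrows n i s B C) : pairing n i (simpleRoot n i) = 2 := by
  have hB := h.idx_B
  have hs := h.one_le
  have hlt := h.lt
  conv_lhs => rw [h.simpleRoot_eq, root, Letter.weight_eq_smul, pairing_sub, pairing_smul,
    pairing_ep (by omega) (by omega), pairing_ep (by omega) (by omega)]
  rw [h.simpleRoot_eq, root_apply (by omega) (by omega), root_apply (by omega) (by omega),
    if_pos rfl, if_neg (by omega), sgn_of_ne (by omega), zero_sub, mul_neg, B.sgn_mul_self]
  norm_num

theorem flip_move_pos (h : Arrows n i s B C) {a : Kp n} {j : ℕ} {js : List ℕ} (h1 : 1 ≤ j)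
    (h2 : j < s) (hjs : ∀ k ∈ js, 1 ≤ k ∧ k < s) (hc : cf n a j (neg s) < cf n a j (pos s)) :
    Flip (kpSig n s B C a) (kpSig n s B C (move n a j (pos s) B)) js j := by
  have key : ∀ k z, IsRt n k z → _ := fun k z hz =>
    cf_move a (h.isRt_pos h1 h2) (h.isRt_B h1 h2.le) (k := k) (z := z) hz
  have d1 := h.B_ne_C
  have d2 := h.B_ne_pos
  have d3 := h.B_ne_neg
  have d4 := h.C_ne_pos
  refine ⟨?_, ?_, fun k hk hne => ?_⟩
  · simp only [kpSig, key _ _ (h.isRt_pos h1 h2), key _ _ (h.isRt_neg h1 h2),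
      key _ _ (h.isRt_B h1 h2.le), d2, d2.symm, d3.symm, true_and, if_true, if_false, reduceCtorEq]
    omega
  · simp only [kpSig, key _ _ (h.isRt_pos h1 h2), key _ _ (h.isRt_neg h1 h2),
      key _ _ (h.isRt_C h1 h2.le), d1.symm, d2.symm, d3.symm, d4, true_and, if_true, if_false,
      reduceCtorEq]
    omega
  · obtain ⟨k1, k2⟩ := hjs k hk
    simp [kpSig, key _ _ (h.isRt_pos k1 k2), key _ _ (h.isRt_neg k1 k2),
      key _ _ (h.isRt_B k1 k2.le), key _ _ (h.isRt_C k1 k2.le), hne]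

theorem flip_move_C (h : Arrows n i s B C) {a : Kp n} {j : ℕ} {js : List ℕ} (h1 : 1 ≤ j)
    (h2 : j < s) (hjs : ∀ k ∈ js, 1 ≤ k ∧ k < s) (hc : cf n a j (pos s) ≤ cf n a j (neg s))
    (hp : 0 < cf n a j C) :
    Flip (kpSig n s B C a) (kpSig n s B C (move n a j C (neg s))) js j := by
  have key : ∀ k z, IsRt n k z → _ := fun k z hz =>
    cf_move a (h.isRt_C h1 h2.le) (h.isRt_neg h1 h2) (k := k) (z := z) hz
  have d1 := h.B_ne_C
  have d3 := h.B_ne_neg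
  have d4 := h.C_ne_pos
  have d5 := h.C_ne_neg
  refine ⟨?_, ?_, fun k hk hne => ?_⟩
  · simp only [kpSig, key _ _ (h.isRt_pos h1 h2), key _ _ (h.isRt_neg h1 h2),
      key _ _ (h.isRt_B h1 h2.le), d1, d3, d4.symm, d5.symm, true_and, if_true, if_false,
      reduceCtorEq]
    omega
  · simp only [kpSig, key _ _ (h.isRt_pos h1 h2), key _ _ (h.isRt_neg h1 h2),
      key _ _ (h.isRt_C h1 h2.le), d4.symm, d5.symm, d5, true_and, if_true, if_false,
      reduceCtorEq]
    omega
  · obtain ⟨k1, k2⟩ := hjs k hk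
    simp [kpSig, key _ _ (h.isRt_pos k1 k2), key _ _ (h.isRt_neg k1 k2),
      key _ _ (h.isRt_B k1 k2.le), key _ _ (h.isRt_C k1 k2.le), hne]

theorem kpSig_add_part (h : Arrows n i s B C) (a : Kp n) :
    sigProd (kpSig n s B C (a + part n (root n s B))) (List.range' 1 (s - 1)) =
      sigProd (kpSig n s B C a) (List.range' 1 (s - 1)) := by
  refine sigProd_congr fun k hk => ?_
  have k1 : 1 ≤ k := by simp at hk; omega
  have k2 : k < s := by simp at hk; omega
  have hB := h.isRt_B h.one_le le_rfl
  simp [kpSig, cf_add, cf_part (h.isRt_pos k1 k2) hB, cf_part (h.isRt_neg k1 k2) hB,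
      cf_part (h.isRt_B k1 k2.le) hB, cf_part (h.isRt_C k1 k2.le) hB, k2.ne]

theorem cf_add_part_self (h : Arrows n i s B C) (a : Kp n) :
    cf n (a + part n (root n s B)) s B = cf n a s B + 1 := by
  have hB := h.isRt_B h.one_le le_rfl
  simp [cf_add, cf_part hB hB]

theorem cf_move_last (h : Arrows n i s B C) {a : Kp n} {j : ℕ} {x x' : Letter} (h2 : j < s)
    (hx : IsRt n j x) (hx' : IsRt n j x') : cf n (move n a j x x') s B = cf n a s B := by
  rw [cf_move a hx hx' (h.isRt_B h.one_le le_rfl)]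
  simp [h2.ne']

theorem mem_rows {s j : ℕ} (hj : j ∈ List.range' 1 (s - 1)) : 1 ≤ j ∧ j < s := by
  simp at hj
  omega

/-- The move made by f_i is a `Flip` of its row, so e_i selects the same row; the comparison of the
coefficients of s and s̄ after the move shows that e_i makes the inverse move. -/
theorem kpE_kpF (h : Arrows n i s B C) (a : Kp n) : kpE n i (kpF n i a) = some a := by
  rcases exists_selF (kpSig n s B C a) (List.range' 1 (s - 1)) (cf n a s B) with hs | ⟨j, hs⟩
  · rw [h.kpF_last hs, h.kpE_last (by rw [h.kpSig_add_part, h.cf_add_part_self]; omega),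
      add_tsub_cancel_right]
  · obtain ⟨h1, h2⟩ := mem_rows hs.mem
    have hp := hs.pos
    rw [h.kpF_row hs]
    split_ifs with hc
    · have hx := h.isRt_pos h1 h2
      have hx' := h.isRt_B h1 h2.le
      rw [h.kpE_row (j := j), if_neg, move_move a hx hx' h.B_ne_pos.symm (by omega)]
      · rw [cf_move a hx hx' hx, cf_move a hx hx' (h.isRt_neg h1 h2)]
        simp [h.B_ne_pos.symm, h.B_ne_neg.symm]
        omega
      · rw [h.cf_move_last h2 hx hx']
        exact hs.selE List.nodup_range' (h.flip_move_pos h1 h2 (fun k => mem_rows) hc)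
    · have hx := h.isRt_C h1 h2.le
      have hx' := h.isRt_neg h1 h2
      have hC : 0 < cf n a j C := by
        simp only [kpSig] at hp
        omega
      rw [h.kpE_row (j := j), if_pos, move_move a hx hx' h.C_ne_neg hC]
      · rw [cf_move a hx hx' hx', cf_move a hx hx' (h.isRt_pos h1 h2)]
        simp [h.C_ne_neg.symm, h.C_ne_pos.symm]
        omega
      · rw [h.cf_move_last h2 hx hx']
        exact hs.selE List.nodup_range' (h.flip_move_C h1 h2 (fun k => mem_rows) (by omega) hC)

theorem kpEps_kpF (h : Arrows n i s B C) (a : Kp n) :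
    kpEps n i (kpF n i a) = kpEps n i a + 1 := by
  rw [h.kpEps_eq, h.kpEps_eq]
  norm_cast
  rcases exists_selF (kpSig n s B C a) (List.range' 1 (s - 1)) (cf n a s B) with hs | ⟨j, hs⟩
  · rw [h.kpF_last hs, h.kpSig_add_part, h.cf_add_part_self]
    simp only [bmul]
    omega
  · obtain ⟨h1, h2⟩ := mem_rows hs.mem
    have hp := hs.pos
    rw [h.kpF_row hs]
    split_ifs with hc
    · rw [h.cf_move_last h2 (h.isRt_pos h1 h2) (h.isRt_B h1 h2.le)]
      exact hs.bmul_sigProd_fst List.nodup_range' (h.flip_move_pos h1 h2 (fun k => mem_rows) hc)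
    · rw [h.cf_move_last h2 (h.isRt_C h1 h2.le) (h.isRt_neg h1 h2)]
      refine hs.bmul_sigProd_fst List.nodup_range'
        (h.flip_move_C h1 h2 (fun k => mem_rows) (by omega) ?_)
      simp only [kpSig] at hp
      omega

theorem kpWt_kpF (h : Arrows n i s B C) (a : Kp n) :
    kpWt n (kpF n i a) = kpWt n a - simpleRoot n i := by
  rcases exists_selF (kpSig n s B C a) (List.range' 1 (s - 1)) (cf n a s B) with hs | ⟨j, hs⟩
  · rw [h.kpF_last hs, kpWt_add, kpWt_part (h.isRt_B h.one_le le_rfl), h.simpleRoot_eq]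
    abel
  · obtain ⟨h1, h2⟩ := mem_rows hs.mem
    have hp := hs.pos
    rw [h.kpF_row hs]
    split_ifs with hc
    · rw [kpWt_move (h.isRt_pos h1 h2) (h.isRt_B h1 h2.le) (by omega), ← h.root_pos_add]
      abel
    · rw [kpWt_move (h.isRt_C h1 h2.le) (h.isRt_neg h1 h2), ← h.root_C_add]
      · abel
      · simp only [kpSig] at hp
        omega

theorem kpF_of_kpE (h : Arrows n i s B C) {a a' : Kp n} (e : kpE n i a = some a') :
    kpF n i a' = a := by
  rcases exists_selE (kpSig n s B C a) (List.range' 1 (s - 1)) (cf n a s B) with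
    hs | ⟨j, hs⟩ | hs
  · rw [h.kpE_last hs, Option.some.injEq] at e
    have ha := sub_part_add (a := a) (h.isRt_B h.one_le le_rfl) (by omega)
    rw [e] at ha
    rw [h.kpF_last, ha]
    rw [← ha, h.kpSig_add_part, h.cf_add_part_self] at hs
    omega
  · obtain ⟨h1, h2⟩ := mem_rows hs.mem
    have hp := hs.pos
    rw [h.kpE_row hs, Option.some.injEq] at e
    simp only [kpSig] at hp
    split_ifs at e with hc
    · have hx := h.isRt_neg h1 h2
      have hx' := h.isRt_C h1 h2.le
      have ha := move_move a hx hx' h.C_ne_neg.symm (by omega)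
      have e1 : cf n a' j (pos s) ≤ cf n a' j (neg s) := by
        rw [← e, cf_move a hx hx' hx, cf_move a hx hx' (h.isRt_pos h1 h2)]
        simp [h.C_ne_pos.symm, h.C_ne_neg.symm]
        omega
      have e2 : 0 < cf n a' j C := by
        rw [← e, cf_move a hx hx' hx']
        simp
      have e3 := h.cf_move_last (a := a) h2 hx hx'
      rw [e] at ha e3
      rw [h.kpF_row (j := j), if_neg (by omega), ha]
      rw [e3]
      refine hs.selF List.nodup_range' ?_
      rw [← ha]
      exact h.flip_move_C h1 h2 (fun k => mem_rows) e1 e2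
    · have hx := h.isRt_B h1 h2.le
      have hx' := h.isRt_pos h1 h2
      have ha := move_move a hx hx' h.B_ne_pos (by omega)
      have e1 : cf n a' j (neg s) < cf n a' j (pos s) := by
        rw [← e, cf_move a hx hx' hx', cf_move a hx hx' (h.isRt_neg h1 h2)]
        simp [h.B_ne_pos.symm, h.B_ne_neg.symm]
        omega
      have e3 := h.cf_move_last (a := a) h2 hx hx'
      rw [e] at ha e3
      rw [h.kpF_row (j := j), if_pos e1, ha]
      rw [e3]
      refine hs.selF List.nodup_range' ?_
      rw [← ha]
      exact h.flip_move_pos h1 h2 (fun k => mem_rows) e1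
  · rw [h.kpE_none hs] at e
    simp at e

end Arrows

theorem kpCrystal_isCrystal {n : ℕ} (hn : 2 ≤ n) : (kpCrystal n).IsCrystal := by
  have hf : ∀ i, 1 ≤ i → i ≤ n → ∀ a : Kp n,
      kpWt n (kpF n i a) = kpWt n a - simpleRoot n i ∧
      kpEps n i (kpF n i a) = kpEps n i a + 1 ∧
      kpEps n i (kpF n i a) + pairing n i (kpWt n (kpF n i a)) =
        kpEps n i a + pairing n i (kpWt n a) - 1 := by
    intro i h1 h2 a
    obtain ⟨s, B, C, h⟩ := exists_arrows hn h1 h2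
    refine ⟨h.kpWt_kpF a, h.kpEps_kpF a, ?_⟩
    rw [h.kpWt_kpF, h.kpEps_kpF, pairing_sub, h.pairing_simpleRoot]
    ring
  have he : ∀ i, 1 ≤ i → i ≤ n → ∀ a a' : Kp n, kpE n i a = some a' → kpF n i a' = a := by
    intro i h1 h2 a a' e
    obtain ⟨s, B, C, h⟩ := exists_arrows hn h1 h2
    exact h.kpF_of_kpE e
  refine ⟨fun i _ _ a => rfl, ?_, ?_, ?_⟩
  · intro i h1 h2 a a' e
    have e1 := he i h1 h2 a a' e
    obtain ⟨f1, f2, f3⟩ := hf i h1 h2 a'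
    rw [e1] at f1 f2 f3
    refine ⟨?_, ?_, ?_⟩
    · change kpWt n a' = kpWt n a + _
      rw [f1]
      abel
    · change kpEps n i a' = kpEps n i a - 1
      omega
    · change kpEps n i a' + pairing n i (kpWt n a') =
        kpEps n i a + pairing n i (kpWt n a) + 1
      omega
  · intro i h1 h2 a a' e
    obtain rfl : kpF n i a = a' := Option.some.inj e
    exact hf i h1 h2 a
  · intro i h1 h2 a a'
    constructor
    · intro e
      obtain rfl : kpF n i a = a' := Option.some.inj e
      obtain ⟨s, B, C, h⟩ := exists_arrows hn h1 h2
      exact h.kpE_kpF a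
    · intro e
      exact congrArg some (he i h1 h2 a' a e)

/-! ### Connectedness of the crystal of Kostant partitions, and uniqueness. -/

/-- If `k` is the first nonzero row, an uncanceled `)` within row `k` has no `(` before it that
could cancel it, so e_i does not vanish. -/
theorem Arrows.exists_kpE {n i s : ℕ} {B C : Letter} (h : Arrows n i s B C) {a : Kp n} {k : ℕ}
    (h1 : 1 ≤ k) (h2 : k ≤ s) (h0 : ∀ j < k, ∀ z, IsRt n j z → cf n a j z = 0)
    (hk : 0 < cf n a k B ∨ k < s ∧ cf n a k (pos s) < cf n a k (neg s)) :
    ∃ a', kpE n i a = some a' := by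
  rcases exists_selE (kpSig n s B C a) (List.range' 1 (s - 1)) (cf n a s B) with
    hs | ⟨j, hs⟩ | hs
  · exact ⟨_, h.kpE_last hs⟩
  · exact ⟨_, h.kpE_row hs⟩
  exfalso
  have hpre : sigProd (kpSig n s B C a) (List.range' 1 (k - 1)) = (0, 0) := by
    have : ∀ js : List ℕ, sigProd (fun _ => (0, 0)) js = (0, 0) := by
      intro js
      induction js with
      | nil => rfl
      | cons j js ih => simp [sigProd, ih, bmul]
    rw [← this (List.range' 1 (k - 1))]
    refine sigProd_congr fun j hj => ?_
    obtain ⟨j1, j2⟩ := Arrows.mem_rows hj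
    have j3 : j < s := by omega
    simp [kpSig, h0 j j2 _ (h.isRt_B j1 j3.le), h0 j j2 _ (h.isRt_C j1 j3.le),
      h0 j j2 _ (h.isRt_pos j1 j3), h0 j j2 _ (h.isRt_neg j1 j3)]
  rcases h2.lt_or_eq with h2 | rfl
  · have e := @List.range'_append_1 1 (k - 1) (s - k)
    rw [show 1 + (k - 1) = k by omega, show s - k = (s - 1 - k) + 1 by omega, List.range'_succ,
      show k - 1 + (s - 1 - k + 1) = s - 1 by omega] at e
    rw [← e, sigProd_append, hpre] at hs
    simp only [sigProd, bmul, kpSig] at hs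
    omega
  · rw [hpre] at hs
    simp only [bmul] at hs
    omega

/-- Only the zero partition is annihilated by all `e_i`. -/
theorem exists_kpE_of_ne_zero {n : ℕ} (hn : 2 ≤ n) {a : Kp n} (ha : a ≠ 0) :
    ∃ i a', 1 ≤ i ∧ i ≤ n ∧ kpE n i a = some a' := by
  classical
  have hex : ∃ k z, IsRt n k z ∧ cf n a k z ≠ 0 := by
    by_contra! hc
    exact ha (ext_cf fun j z hz => by rw [hc j z hz, cf_zero])
  obtain ⟨z, ⟨h1, h2, h3⟩, hz⟩ := Nat.find_spec hex
  have hmin : ∀ j < Nat.find hex, ∀ z, IsRt n j z → cf n a j z = 0 := by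
    intro j hj z hz
    by_contra hne
    exact Nat.find_min hex hj ⟨z, hz, hne⟩
  generalize Nat.find hex = k at *
  -- If an unbarred letter m occurs in the first nonzero row, colour m-1 works, because there B = m.
  -- Otherwise some m̄ occurs: colour m works if m < n, as no letter m can cancel the `)` of m̄, and
  -- colour n works if m = n, where B = n̄.
  by_cases hp : ∃ m, k < m ∧ m ≤ n ∧ cf n a k (pos m) ≠ 0
  · obtain ⟨m, m1, m2, m3⟩ := hp
    have h := arrows_of_lt (n := n) (i := m - 1) (by omega) (by omega)
    rw [Nat.sub_add_cancel (by omega)] at h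
    obtain ⟨a', e⟩ := h.exists_kpE h1 (by omega) hmin (Or.inl (by omega))
    exact ⟨m - 1, a', by omega, by omega, e⟩
  push Not at hp
  cases z with
  | pos m => exact absurd (hp m h2 h3) hz
  | neg m =>
    simp only [idx_neg] at h2 h3
    rcases h3.lt_or_eq with h3 | rfl
    · obtain ⟨a', e⟩ := (arrows_of_lt (by omega) h3).exists_kpE h1 h2.le hmin
        (Or.inr ⟨h2, by rw [hp m h2 h3.le]; omega⟩)
      exact ⟨m, a', by omega, by omega, e⟩
    · obtain ⟨a', e⟩ := (arrows_self hn).exists_kpE h1 (by omega) hmin (Or.inl (by omega))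
      exact ⟨m, a', by omega, le_rfl, e⟩

/-- The height of a weight. -/
def hgt (n : ℕ) (v : Weight n) : ℤ := ∑ m : Fin n, ((n : ℤ) - 1 - m) * v m

theorem hgt_sub {n : ℕ} (v w : Weight n) : hgt n (v - w) = hgt n v - hgt n w := by
  simp [hgt, mul_sub, Finset.sum_sub_distrib]

theorem hgt_smul {n : ℕ} (c : ℤ) (v : Weight n) : hgt n (c • v) = c * hgt n v := by
  simp [hgt, Finset.mul_sum, mul_left_comm]

theorem hgt_ep {n k : ℕ} (h1 : 1 ≤ k) (h2 : k ≤ n) : hgt n (ep n k) = n - k := by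
  rw [hgt, Finset.sum_eq_single ⟨k - 1, by omega⟩]
  · simp [ep, Nat.sub_add_cancel h1]
    omega
  · rintro ⟨b, hb⟩ - hne
    have : b + 1 ≠ k := by
      rintro rfl
      simp at hne
    simp [ep, this]
  · simp

theorem hgt_root_pos {n j : ℕ} {z : Letter} (h : IsRt n j z) : 0 < hgt n (root n j z) := by
  obtain ⟨h1, h2, h3⟩ := h
  rw [root, Letter.weight_eq_smul, hgt_sub, hgt_smul, hgt_ep h1 (by omega),
    hgt_ep (by omega) h3]
  cases z <;> simp [Letter.sgn] at * <;> omega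

theorem hgt_neg_kpWt {n : ℕ} (a : Kp n) :
    hgt n (-kpWt n a) = ∑ b : {v // v ∈ posRoots n}, (a b : ℤ) * hgt n b.1 := by
  simp only [kpWt, neg_neg, hgt, Finset.mul_sum, Finset.sum_apply, Pi.smul_apply]
  rw [Finset.sum_comm]
  refine Finset.sum_congr rfl fun b _ => Finset.sum_congr rfl fun m _ => ?_
  rw [nsmul_eq_mul]
  ring

theorem hgt_pos {n : ℕ} (b : {v // v ∈ posRoots n}) : 0 < hgt n b.1 := by
  obtain ⟨j, z, hz, e⟩ := mem_posRoots.1 b.2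
  rw [e]
  exact hgt_root_pos hz

theorem hgt_neg_kpWt_nonneg {n : ℕ} (a : Kp n) : 0 ≤ hgt n (-kpWt n a) := by
  rw [hgt_neg_kpWt]
  exact Finset.sum_nonneg fun b _ => mul_nonneg (by positivity) (hgt_pos b).le

theorem eq_zero_of_kpWt_eq_zero {n : ℕ} {a : Kp n} (h : kpWt n a = 0) : a = 0 := by
  have h1 := hgt_neg_kpWt a
  rw [h, neg_zero, show hgt n 0 = 0 by simp [hgt], eq_comm, Finset.sum_eq_zero_iff_of_nonneg
    (fun b _ => mul_nonneg (by positivity) (hgt_pos b).le)] at h1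
  funext b
  have := h1 b (Finset.mem_univ _)
  have hb := hgt_pos b
  simpa [hb.ne'] using this

/-- Every Kostant partition is obtained from `0` by the operators `f_i`. -/
theorem kp_induction {n : ℕ} (hn : 2 ≤ n) {p : Kp n → Prop} (h0 : p 0)
    (hf : ∀ i a, 1 ≤ i → i ≤ n → p a → p (kpF n i a)) (a : Kp n) : p a := by
  induction hm : (hgt n (-kpWt n a)).toNat using Nat.strong_induction_on generalizing a with
  | _ m ih =>
    by_cases ha : a = 0
    · exact ha ▸ h0
    obtain ⟨i, a', h1, h2, e⟩ := exists_kpE_of_ne_zero hn ha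
    obtain ⟨s, B, C, h⟩ := exists_arrows hn h1 h2
    have ha' := h.kpF_of_kpE e
    rw [← ha']
    refine hf i a' h1 h2 (ih _ ?_ a' rfl)
    have hw := h.kpWt_kpF a'
    rw [ha'] at hw
    -- The height of -wt is a nonnegative integer that every e_i lowers; hence the descent to 0
    -- ends.
    have hr : 0 < hgt n (simpleRoot n i) := by
      rw [h.simpleRoot_eq]
      exact hgt_root_pos (h.isRt_B h.one_le le_rfl)
    have e1 : hgt n (-kpWt n a) = hgt n (-kpWt n a') + hgt n (simpleRoot n i) := by
      rw [hw, neg_sub, hgt_sub, ← zero_sub (kpWt n a'), hgt_sub]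
      simp [hgt]
      ring
    have := hgt_neg_kpWt_nonneg a'
    omega

/-- An isomorphism onto the crystal of Kostant partitions is unique. -/
theorem crystalIso_unique {n : ℕ} (hn : 2 ≤ n) {X : Type} {D : CrystalData n X} {F G : X → Kp n}
    (hF : IsCrystalIso D (kpCrystal n) F) (hG : IsCrystalIso D (kpCrystal n) G) : F = G := by
  suffices ∀ a : Kp n, ∀ x, G x = a → F x = a from funext fun x => this _ x rfl
  refine kp_induction hn ?_ ?_
  -- Both maps preserve weights, and 0 is the only Kostant partition of weight 0.
  · intro x hx
    apply eq_zero_of_kpWt_eq_zero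
    have h1 : kpWt n (F x) = D.wt x := hF.wt_eq x
    have h2 : kpWt n (G x) = D.wt x := hG.wt_eq x
    rw [h1, ← h2, hx, kpWt_zero]
  · intro i a h1 h2 ih x hx
    -- The element x is f_i y for the preimage y of `a` under G, so the two maps agree at x if they
    -- agree at y.
    obtain ⟨y, hy⟩ := hG.bijective.2 a
    have e1 : some (kpF n i (F y)) = (D.f i y).map F := hF.f_eq i h1 h2 y
    have e2 : some (kpF n i (G y)) = (D.f i y).map G := hG.f_eq i h1 h2 y
    rw [hy, ← hx, eq_comm, Option.map_eq_some_iff] at e2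
    obtain ⟨x', e3, e4⟩ := e2
    obtain rfl := hG.bijective.1 e4
    rw [e3, ih y hy] at e1
    exact (Option.some.inj e1).symm

/-! ### Rows of tableaux -/

/-- Given sortedness, the first column and the bound by j̄ amount to the single condition that all
indices in row j are at least j. Conversely, marginality forces a letter j in row j, and sortedness
puts one in front. -/
theorem isMarginallyLarge_iff {n : ℕ} {R : Filling} : IsMarginallyLarge n R ↔
    (∀ j, ¬ (1 ≤ j ∧ j < n) → R j = []) ∧ (∀ j, ∀ z ∈ R j, j ≤ z.idx ∧ z.idx ≤ n) ∧
    (∀ j, (R j).Pairwise (Letter.Le n)) ∧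
    (∀ j, 1 ≤ j → j < n → (R j).count (pos j) = (R (j + 1)).length + 1) ∧
    ∀ j, ¬ (pos n ∈ R j ∧ neg n ∈ R j) := by
  constructor
  · intro h
    refine ⟨h.rows, fun j z hz => ?_, h.weakly_increasing, h.marginal, h.not_both⟩
    by_cases hj : 1 ≤ j ∧ j < n
    · have h1 := h.alphabet j z hz
      have h2 := h.bounded j z hz
      have h3 : j ≤ z.height n := by
        have hf := h.first_column j hj.1 hj.2
        have hp := h.weakly_increasing j
        rcases hr : R j with _ | ⟨y, r⟩
        · simp [hr] at hz
        · rw [hr] at hf hp hz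
          obtain rfl : y = pos j := by simpa using hf
          rcases List.mem_cons.1 hz with rfl | hz
          · simp [Letter.height]
          · rcases (List.pairwise_cons.1 hp).1 z hz with rfl | hlt
            · simp [Letter.height]
            · simpa [Letter.height] using hlt.le
      cases z with
      | pos k => simp [Letter.InAlphabet, Letter.height] at *; omega
      | neg k =>
        simp [Letter.InAlphabet, Letter.height, Letter.Le] at *
        omega
    · simp [h.rows j hj] at hz
  · rintro ⟨h1, h2, h3, h4, h5⟩
    have hj : ∀ j, ∀ z ∈ R j, 1 ≤ j ∧ j < n := by
      intro j z hz
      by_contra hc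
      simp [h1 j hc] at hz
    refine ⟨h1, ?_, ?_, h3, h4, ?_, h5⟩
    · intro j z hz
      have := hj j z hz
      have := h2 j z hz
      cases z <;> simp [Letter.InAlphabet] at * <;> omega
    · intro j j1 j2
      have hm : pos j ∈ R j := List.count_pos_iff.1 (by rw [h4 j j1 j2]; omega)
      have hp := h3 j
      have hi := h2 j
      rcases hr : R j with _ | ⟨y, r⟩
      · simp [hr] at hm
      · rw [hr] at hm hp hi
        rcases List.mem_cons.1 hm with rfl | hm
        · rfl
        · have hy := hi y (by simp)
          rcases (List.pairwise_cons.1 hp).1 _ hm with rfl | hlt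
          · rfl
          · cases y <;> simp [Letter.height] at * <;> omega
    · intro j z hz
      have := hj j z hz
      have := h2 j z hz
      cases z <;> simp [Letter.Le, Letter.height] at * <;> omega

theorem Letter.Le.antisymm {n : ℕ} {x y : Letter} (h : x.Le n y) (h' : y.Le n x) : x = y := by
  rcases h with h | h
  · exact h
  · rcases h' with h' | h'
    · exact h'.symm
    · omega

/-- A weakly increasing row is determined by the multiplicities of its letters. -/
theorem row_ext {n : ℕ} {r r' : List Letter} (hr : r.Pairwise (Letter.Le n))
    (hr' : r'.Pairwise (Letter.Le n)) (hc : ∀ z, r.count z = r'.count z) : r = r' :=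
  (List.perm_iff_count.2 hc).eq_of_pairwise (fun _ _ _ _ => Letter.Le.antisymm) hr hr'

/-- A row with the letters `s`, `B`, `C`, `s̄` in separate runs. -/
def rowForm (s : ℕ) (B C : Letter) (L M N : List Letter) (a b c d : ℕ) : List Letter :=
  L ++ (List.replicate a (pos s) ++ (List.replicate b B ++ (M ++ (List.replicate c C ++
    (List.replicate d (neg s) ++ N)))))

/-- The remaining letters of a row lie before, between, and after the runs of `rowForm`. -/
structure Frame (n s : ℕ) (L M N : List Letter) : Prop where
  left : ∀ z ∈ L, z.height n < s
  middle : ∀ z ∈ M, s + 1 < z.height n ∧ z.height n + s + 1 < 2 * n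
  right : ∀ z ∈ N, 2 * n < z.height n + s
  left_sorted : L.Pairwise (Letter.Le n)
  middle_sorted : M.Pairwise (Letter.Le n)
  right_sorted : N.Pairwise (Letter.Le n)

namespace Arrows

variable {n i s : ℕ} {B C : Letter}

theorem height_B (h : Arrows n i s B C) : B.height n = s + 1 := by
  rcases h.cases with ⟨rfl, rfl⟩ | ⟨e, rfl, rfl⟩ <;> simp [Letter.height]
  omega

theorem height_C (h : Arrows n i s B C) : C.height n + s + 1 = 2 * n := by
  have := h.lt
  rcases h.cases with ⟨rfl, rfl⟩ | ⟨e, rfl, rfl⟩ <;> simp [Letter.height] <;> omega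

/-- B lies strictly below C unless s + 1 = n. In that case B and C are n and n̄ in some order, and
`hbc` keeps these incomparable letters apart. -/
theorem sorted_rowForm (h : Arrows n i s B C) {L M N : List Letter} (hf : Frame n s L M N)
    {a b c d : ℕ} (hbc : s + 1 = n → b = 0 ∨ c = 0) :
    (rowForm s B C L M N a b c d).Pairwise (Letter.Le n) := by
  have hlt := h.lt
  have hB := h.height_B
  have hC := h.height_C
  have hs : (pos s).height n = s := rfl
  have hs' : (neg s).height n = 2 * n - s := rfl
  have hrep : ∀ (k : ℕ) (z : Letter), (List.replicate k z).Pairwise (Letter.Le n) := fun k z =>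
    List.pairwise_replicate.2 (Or.inr (Or.inl rfl))
  simp only [rowForm, List.pairwise_append, List.mem_append, List.mem_replicate]
  refine ⟨hf.left_sorted, ⟨hrep _ _, ⟨hrep _ _, ⟨hf.middle_sorted, ⟨hrep _ _, ⟨hrep _ _,
    hf.right_sorted, ?_⟩, ?_⟩, ?_⟩, ?_⟩, ?_⟩, ?_⟩
  · rintro x ⟨-, rfl⟩ y hy
    have := hf.right y hy
    exact Or.inr (by omega)
  · rintro x ⟨-, rfl⟩ y (⟨-, rfl⟩ | hy)
    · exact Or.inr (by omega)
    · have := hf.right y hy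
      exact Or.inr (by omega)
  · rintro x hx y (⟨-, rfl⟩ | ⟨-, rfl⟩ | hy) <;> have := hf.middle x hx
    · exact Or.inr (by omega)
    · exact Or.inr (by omega)
    · have := hf.right y hy
      exact Or.inr (by omega)
  · rintro x ⟨hb, rfl⟩ y (hy | ⟨hc, rfl⟩ | ⟨-, rfl⟩ | hy)
    · have := hf.middle y hy
      exact Or.inr (by omega)
    · exact Or.inr (by omega)
    · exact Or.inr (by omega)
    · have := hf.right y hy
      exact Or.inr (by omega)
  · rintro x ⟨-, rfl⟩ y (⟨-, rfl⟩ | hy | ⟨-, rfl⟩ | ⟨-, rfl⟩ | hy)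
    · exact Or.inr (by omega)
    · have := hf.middle y hy
      exact Or.inr (by omega)
    · exact Or.inr (by omega)
    · exact Or.inr (by omega)
    · have := hf.right y hy
      exact Or.inr (by omega)
  · rintro x hx y (⟨-, rfl⟩ | ⟨-, rfl⟩ | hy | ⟨-, rfl⟩ | ⟨-, rfl⟩ | hy) <;>
      have := hf.left x hx
    · exact Or.inr (by omega)
    · exact Or.inr (by omega)
    · have := hf.middle y hy
      exact Or.inr (by omega)
    · exact Or.inr (by omega)
    · exact Or.inr (by omega)
    · have := hf.right y hy
      exact Or.inr (by omega)

/-- The three remaining parts are cut out by height. Both sides are weakly increasing, so it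
suffices to compare multiplicities. -/
theorem exists_rowForm (h : Arrows n i s B C) {r : List Letter}
    (hr : r.Pairwise (Letter.Le n)) (hi : ∀ z ∈ r, z.idx ≤ n)
    (hb : ¬ (pos n ∈ r ∧ neg n ∈ r)) : ∃ L M N, Frame n s L M N ∧
      r = rowForm s B C L M N (r.count (pos s)) (r.count B) (r.count C) (r.count (neg s)) := by
  have hlt := h.lt
  have hf : Frame n s (r.filter fun z => z.height n < s)
      (r.filter fun z => s + 1 < z.height n ∧ z.height n + s + 1 < 2 * n)
      (r.filter fun z => 2 * n < z.height n + s) := by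
    refine ⟨?_, ?_, ?_, hr.filter _, hr.filter _, hr.filter _⟩ <;>
    · intro z hz
      simpa using (List.mem_filter.1 hz).2
  refine ⟨_, _, _, hf, row_ext hr (h.sorted_rowForm hf ?_) fun z => ?_⟩
  · intro hs
    by_contra hc
    simp only [not_or, ← Nat.pos_iff_ne_zero, List.count_pos_iff] at hc
    rcases h.cases with ⟨rfl, rfl⟩ | ⟨e, rfl, rfl⟩
    · rw [hs] at hc
      exact hb hc
    · exact hb hc.symm
  · have key : ∀ p : Letter → Bool,
        (r.filter p).count z = if p z then r.count z else 0 := by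
      intro p
      split_ifs with hp
      · exact List.count_filter hp
      · exact List.count_eq_zero.2 fun hm => hp (List.mem_filter.1 hm).2
    simp only [rowForm, List.count_append, key, List.count_replicate, beq_iff_eq, decide_eq_true_eq]
    by_cases hz : z ∈ r
    swap
    · rw [List.count_eq_zero.2 hz]
      have : ∀ y, (if y = z then r.count y else 0) = 0 := by
        intro y
        split_ifs with e
        · rw [e, List.count_eq_zero.2 hz]
        · rfl
      simp [this]
    have hzi := hi z hz
    have hB := h.height_B
    have hC := h.height_C
    have hBC := h.B_ne_C
    have aux : ¬ z.height n < s → ¬ (s + 1 < z.height n ∧ z.height n + s + 1 < 2 * n) →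
        ¬ 2 * n < z.height n + s → z = pos s ∨ z = B ∨ z = C ∨ z = neg s := by
      intro q1 q2 q3
      by_cases e1 : z.idx = s
      · cases z <;> simp_all
      by_cases e2 : z.idx = s + 1
      · rcases h.eq_of_idx e2 with e | e <;> simp [e]
      cases z <;> simp only [idx_pos, idx_neg, Letter.height] at q1 q2 q3 e1 e2 hzi <;> omega
    have c1 : z = pos s → z.height n = s := by rintro rfl; rfl
    have c2 : z = B → z.height n = s + 1 := by rintro rfl; exact hB
    have c3 : z = C → z.height n + s + 1 = 2 * n := by rintro rfl; exact hC
    have c4 : z = neg s → z.height n = 2 * n - s := by rintro rfl; rfl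
    by_cases hor : z = pos s ∨ z = B ∨ z = C ∨ z = neg s
    · have q1 : ¬ z.height n < s := by
        rcases hor with e | e | e | e
        · have := c1 e; omega
        · have := c2 e; omega
        · have := c3 e; omega
        · have := c4 e; omega
      have q2 : ¬ (s + 1 < z.height n ∧ z.height n + s + 1 < 2 * n) := by
        rcases hor with e | e | e | e
        · have := c1 e; omega
        · have := c2 e; omega
        · have := c3 e; omega
        · have := c4 e; omega
      have q3 : ¬ 2 * n < z.height n + s := by
        rcases hor with e | e | e | e
        · have := c1 e; omega
        · have := c2 e; omega
        · have := c3 e; omega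
        · have := c4 e; omega
      rw [if_neg q1, if_neg q2, if_neg q3]
      rcases hor with rfl | rfl | rfl | rfl
      · simp [h.B_ne_pos, h.C_ne_pos]
      · simp [h.B_ne_pos.symm, h.B_ne_neg.symm, hBC.symm]
      · simp [h.C_ne_pos.symm, h.C_ne_neg.symm, hBC]
      · simp [h.B_ne_neg, h.C_ne_neg]
    · have hor' := hor
      simp only [not_or] at hor
      rw [if_neg (Ne.symm hor.1), if_neg (Ne.symm hor.2.1), if_neg (Ne.symm hor.2.2.1),
        if_neg (Ne.symm hor.2.2.2)]
      by_cases q1 : z.height n < s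
      · rw [if_pos q1, if_neg (by omega), if_neg (by omega)]
        simp
      by_cases q2 : s + 1 < z.height n ∧ z.height n + s + 1 < 2 * n
      · rw [if_neg q1, if_pos q2, if_neg (by omega)]
        simp
      by_cases q3 : 2 * n < z.height n + s
      · rw [if_neg q1, if_neg q2, if_pos q3]
        simp
      exact absurd (aux q1 q2 q3) hor'

end Arrows

/-! ### Brackets of a row -/

/-- The bracket of a box. -/
def boxBracket (n i : ℕ) (b : ℕ × ℕ × Letter) : Option (Bracket × (ℕ × ℕ × Letter)) :=
  if (b.2.2.prev n i).isSome then some (Bracket.closing, b)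
  else if (b.2.2.next n i).isSome then some (Bracket.opening, b)
  else none

/-- The brackets of a part of row `j` that starts in column `t`. -/
def segBrackets (n i j t : ℕ) (r : List Letter) : List (Bracket × (ℕ × ℕ × Letter)) :=
  (((r.zipIdx t).map (fun p => (j, p.2, p.1))).reverse).filterMap (boxBracket n i)

theorem brackets_eq (n i : ℕ) (R : Filling) :
    brackets n i R = (List.range' 1 (n - 1)).flatMap (fun j => segBrackets n i j 0 (R j)) := by
  rw [brackets, boxes, List.filterMap_flatMap]
  rfl

theorem segBrackets_append (n i j t : ℕ) (r r' : List Letter) :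
    segBrackets n i j t (r ++ r') =
      segBrackets n i j (t + r.length) r' ++ segBrackets n i j t r := by
  simp [segBrackets, List.zipIdx_append]

theorem length_segBrackets_le (n i j t : ℕ) (r : List Letter) :
    (segBrackets n i j t r).length ≤ r.length := by
  refine (List.length_filterMap_le _ _).trans ?_
  simp

theorem segBrackets_cons (n i j t : ℕ) (x : Letter) (r : List Letter) :
    segBrackets n i j t (x :: r) =
      segBrackets n i j (t + 1) r ++ (boxBracket n i (j, t, x)).toList := by
  simp only [segBrackets, List.zipIdx_cons, List.map_cons, List.reverse_cons,
    List.filterMap_append]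
  cases hb : boxBracket n i (j, t, x) <;> simp [hb]

theorem segBrackets_eq_nil {n i j t : ℕ} {r : List Letter}
    (h : ∀ z ∈ r, z.prev n i = none ∧ z.next n i = none) : segBrackets n i j t r = [] := by
  induction r generalizing t with
  | nil => rfl
  | cons x r ih =>
    have hx := h x (by simp)
    rw [segBrackets_cons, ih fun z hz => h z (by simp [hz])]
    simp [boxBracket, hx.1, hx.2]

/-- The boxes in row `j` and columns `t, …, t+k-1`, all with the letter `x`, from right to left. -/
def run (j t k : ℕ) (x : Letter) : List (ℕ × ℕ × Letter) :=
  ((List.range' t k).map (fun c => (j, c, x))).reverse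

theorem length_run (j t k : ℕ) (x : Letter) : (run j t k x).length = k := by
  simp [run]

theorem head?_run (j t k : ℕ) (x : Letter) : (run j t (k + 1) x).head? = some (j, t + k, x) := by
  rw [run, List.head?_reverse, List.getLast?_map, List.range'_1_concat]
  simp

theorem getLast?_run (j t k : ℕ) (x : Letter) :
    (run j t (k + 1) x).getLast? = some (j, t, x) := by
  simp [run, List.range'_succ]

theorem segBrackets_replicate {n i : ℕ} {x : Letter} {b : Bracket}
    (h : ∀ y : ℕ × ℕ × Letter, y.2.2 = x → boxBracket n i y = some (b, y)) (j t k : ℕ) :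
    segBrackets n i j t (List.replicate k x) = (run j t k x).map (Prod.mk b) := by
  induction k generalizing t with
  | zero => rfl
  | succ k ih =>
    rw [List.replicate_succ, segBrackets_cons, ih, h _ rfl]
    simp [run, List.range'_succ]

namespace Arrows

variable {n i s : ℕ} {B C : Letter}

theorem boxBracket_pos (h : Arrows n i s B C) (y : ℕ × ℕ × Letter) (hy : y.2.2 = pos s) :
    boxBracket n i y = some (Bracket.opening, y) := by
  simp [boxBracket, h.prev_eq, h.next_eq, hy, h.B_ne_pos.symm]

theorem boxBracket_B (h : Arrows n i s B C) (y : ℕ × ℕ × Letter) (hy : y.2.2 = B) :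
    boxBracket n i y = some (Bracket.closing, y) := by
  simp [boxBracket, h.prev_eq, hy]

theorem boxBracket_C (h : Arrows n i s B C) (y : ℕ × ℕ × Letter) (hy : y.2.2 = C) :
    boxBracket n i y = some (Bracket.opening, y) := by
  simp [boxBracket, h.prev_eq, h.next_eq, hy, h.B_ne_C.symm, h.C_ne_pos, h.C_ne_neg]

theorem boxBracket_neg (h : Arrows n i s B C) (y : ℕ × ℕ × Letter) (hy : y.2.2 = neg s) :
    boxBracket n i y = some (Bracket.closing, y) := by
  simp [boxBracket, h.prev_eq, hy, h.B_ne_neg.symm]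

theorem no_arrows (h : Arrows n i s B C) {z : Letter} (h1 : z.height n ≠ s)
    (h2 : z.height n ≠ s + 1) (h3 : z.height n + s + 1 ≠ 2 * n) (h4 : z.height n + s ≠ 2 * n) :
    z.prev n i = none ∧ z.next n i = none := by
  have hlt := h.lt
  have e1 : z ≠ pos s := by rintro rfl; exact h1 rfl
  have e2 : z ≠ B := by rintro rfl; exact h2 h.height_B
  have e3 : z ≠ C := by rintro rfl; exact h3 h.height_C
  have e4 : z ≠ neg s := by rintro rfl; simp [Letter.height] at h4; omega
  simp [h.prev_eq, h.next_eq, *]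

/-- Rows are read from right to left, hence the order s̄, C, B, s; the letters of the frame carry no
arrow of colour i. -/
theorem segBrackets_rowForm (h : Arrows n i s B C) {L M N : List Letter} (hf : Frame n s L M N)
    (j a b c d : ℕ) : segBrackets n i j 0 (rowForm s B C L M N a b c d) =
      fourRuns (run j (L.length + a + b + M.length + c) d (neg s))
        (run j (L.length + a + b + M.length) c C) (run j (L.length + a) b B)
        (run j L.length a (pos s)) := by
  have hlt := h.lt
  have hL : ∀ t, segBrackets n i j t L = [] := fun t => segBrackets_eq_nil fun z hz => by
    have := hf.left z hz
    exact h.no_arrows (by omega) (by omega) (by omega) (by omega)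
  have hM : ∀ t, segBrackets n i j t M = [] := fun t => segBrackets_eq_nil fun z hz => by
    have := hf.middle z hz
    exact h.no_arrows (by omega) (by omega) (by omega) (by omega)
  have hN : ∀ t, segBrackets n i j t N = [] := fun t => segBrackets_eq_nil fun z hz => by
    have := hf.right z hz
    exact h.no_arrows (by omega) (by omega) (by omega) (by omega)
  simp only [rowForm, segBrackets_append, hL, hM, hN, segBrackets_replicate h.boxBracket_pos,
    segBrackets_replicate h.boxBracket_B, segBrackets_replicate h.boxBracket_C,
    segBrackets_replicate h.boxBracket_neg, fourRuns, List.length_replicate, zero_add,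
    List.append_nil, List.nil_append]

end Arrows

theorem set_replicate_last (X Y : List Letter) (x z : Letter) (k : ℕ) :
    (X ++ (List.replicate (k + 1) x ++ Y)).set (X.length + k) z =
      X ++ (List.replicate k x ++ z :: Y) := by
  rw [List.set_append_right _ _ (by omega), Nat.add_sub_cancel_left,
    List.replicate_succ', List.append_assoc, List.set_append_right _ _ (by simp)]
  simp

theorem set_replicate_first (X Y : List Letter) (x z : Letter) (k : ℕ) :
    (X ++ (List.replicate (k + 1) x ++ Y)).set X.length z =
      X ++ z :: (List.replicate k x ++ Y) := by
  rw [List.set_append_right _ _ (by omega), Nat.sub_self]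
  simp [List.replicate_succ]

/-! ### The box on which an operator acts -/

theorem getElem?_replicate_middle (X Y : List Letter) (x : Letter) {k m : ℕ} (hk : k < m) :
    (X ++ (List.replicate m x ++ Y))[X.length + k]? = some x := by
  rw [List.getElem?_append_right (by omega), Nat.add_sub_cancel_left,
    List.getElem?_append_left (by simpa using hk)]
  simp [hk]

/-- The conditions on a single row of a marginally large tableau. -/
structure IsRow (n : ℕ) (r : List Letter) : Prop where
  sorted : r.Pairwise (Letter.Le n)
  idx_le : ∀ z ∈ r, z.idx ≤ n
  not_both : ¬ (pos n ∈ r ∧ neg n ∈ r)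

theorem IsMarginallyLarge.isRow {n : ℕ} {R : Filling} (h : IsMarginallyLarge n R) (j : ℕ) :
    IsRow n (R j) :=
  ⟨h.weakly_increasing j, fun z hz => ((isMarginallyLarge_iff.1 h).2.1 j z hz).2, h.not_both j⟩

/-- The signature of a row. -/
def rowSig (s : ℕ) (B C : Letter) (r : List Letter) : ℕ × ℕ :=
  (r.count (neg s) + (r.count B - r.count C), (r.count C - r.count B) + r.count (pos s))

namespace Arrows

variable {n i s : ℕ} {B C : Letter}

theorem count_eq_zero_or (h : Arrows n i s B C) {r : List Letter} (hr : IsRow n r)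
    (hs : s + 1 = n) : r.count B = 0 ∨ r.count C = 0 := by
  by_contra hc
  simp only [not_or, ← Nat.pos_iff_ne_zero, List.count_pos_iff] at hc
  rcases h.cases with ⟨rfl, rfl⟩ | ⟨e, rfl, rfl⟩
  · rw [hs] at hc
    exact hr.not_both hc
  · exact hr.not_both hc.symm

theorem sig_row (h : Arrows n i s B C) {r : List Letter} (hr : IsRow n r) (j : ℕ) :
    sig (segBrackets n i j 0 r) = rowSig s B C r := by
  obtain ⟨L, M, N, hf, e⟩ := h.exists_rowForm hr.sorted hr.idx_le hr.not_both
  rw [e, h.segBrackets_rowForm hf, ← e, sig_fourRuns]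
  simp [length_run, rowSig]

/-- The first box read in a run is its rightmost one, and it can be changed without disturbing the
order of the row. The next three lemmas treat the other cases in the same way; e_i acts on the
leftmost box of a run. -/
theorem row_head_C (h : Arrows n i s B C) {r : List Letter} (hr : IsRow n r) (j : ℕ)
    (hc : r.count B < r.count C) :
    ∃ c, (uncanceled (segBrackets n i j 0 r)).2.head? = some (j, c, C) ∧ r[c]? = some C ∧
      (r.set c (neg s)).Pairwise (Letter.Le n) := by
  have hbc := h.count_eq_zero_or hr
  obtain ⟨L, M, N, hf, e⟩ := h.exists_rowForm hr.sorted hr.idx_le hr.not_both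
  generalize r.count (pos s) = a, r.count B = b, r.count (neg s) = d at *
  obtain ⟨c, hc'⟩ : ∃ c, r.count C = c + 1 := ⟨r.count C - 1, by omega⟩
  rw [hc'] at e hbc hc
  let X := L ++ (List.replicate a (pos s) ++ (List.replicate b B ++ M))
  have hX : X.length = L.length + a + b + M.length := by simp [X]; omega
  have e1 : r = X ++ (List.replicate (c + 1) C ++ (List.replicate d (neg s) ++ N)) := by
    simp [e, X, rowForm]
  refine ⟨X.length + c, ?_, ?_, ?_⟩
  · rw [e, h.segBrackets_rowForm hf, uncanceled_fourRuns]
    simp only [length_run]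
    obtain ⟨m, hm⟩ : ∃ m, c + 1 - b = m + 1 := ⟨c - b, by omega⟩
    rw [List.head?_append, List.head?_take, if_neg (by omega), head?_run, hX]
    rfl
  · rw [e1]
    exact getElem?_replicate_middle _ _ _ (by omega)
  · rw [e1, set_replicate_last]
    have := h.sorted_rowForm hf (a := a) (b := b) (c := c) (d := d + 1) (by omega)
    simpa [X, rowForm, List.replicate_succ] using this

theorem row_head_pos (h : Arrows n i s B C) {r : List Letter} (hr : IsRow n r) (j : ℕ)
    (hc : r.count C ≤ r.count B) (hp : 0 < r.count (pos s)) :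
    ∃ c, (uncanceled (segBrackets n i j 0 r)).2.head? = some (j, c, pos s) ∧
      r[c]? = some (pos s) ∧ (r.set c B).Pairwise (Letter.Le n) := by
  have hbc := h.count_eq_zero_or hr
  obtain ⟨L, M, N, hf, e⟩ := h.exists_rowForm hr.sorted hr.idx_le hr.not_both
  generalize r.count C = c, r.count B = b, r.count (neg s) = d at *
  obtain ⟨a, ha⟩ : ∃ a, r.count (pos s) = a + 1 := ⟨r.count (pos s) - 1, by omega⟩
  rw [ha] at e hp
  refine ⟨L.length + a, ?_, ?_, ?_⟩
  · rw [e, h.segBrackets_rowForm hf, uncanceled_fourRuns]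
    simp only [length_run]
    rw [Nat.sub_eq_zero_of_le hc, List.take_zero, List.nil_append, head?_run]
  · rw [e]
    exact getElem?_replicate_middle _ _ _ (by omega)
  · rw [e, rowForm, set_replicate_last]
    have := h.sorted_rowForm hf (a := a) (b := b + 1) (c := c) (d := d) (by omega)
    simpa [rowForm, List.replicate_succ] using this

theorem row_last_B (h : Arrows n i s B C) {r : List Letter} (hr : IsRow n r) (j : ℕ)
    (hc : r.count C < r.count B) :
    ∃ c, (uncanceled (segBrackets n i j 0 r)).1.getLast? = some (j, c, B) ∧ r[c]? = some B ∧
      (r.set c (pos s)).Pairwise (Letter.Le n) := by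
  have hbc := h.count_eq_zero_or hr
  obtain ⟨L, M, N, hf, e⟩ := h.exists_rowForm hr.sorted hr.idx_le hr.not_both
  generalize r.count (pos s) = a, r.count C = c, r.count (neg s) = d at *
  obtain ⟨b, hb'⟩ : ∃ b, r.count B = b + 1 := ⟨r.count B - 1, by omega⟩
  rw [hb'] at e hbc hc
  let X := L ++ List.replicate a (pos s)
  have hX : X.length = L.length + a := by simp [X]
  have e1 : r = X ++ (List.replicate (b + 1) B ++ (M ++ (List.replicate c C ++
      (List.replicate d (neg s) ++ N)))) := by
    simp [e, X, rowForm]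
  refine ⟨X.length, ?_, ?_, ?_⟩
  · rw [e, h.segBrackets_rowForm hf, uncanceled_fourRuns]
    simp only [length_run]
    rw [List.getLast?_append_of_ne_nil, List.getLast?_drop, length_run, if_neg (by omega),
      getLast?_run, hX]
    rw [← List.length_pos_iff, List.length_drop, length_run]
    omega
  · rw [e1]
    exact getElem?_replicate_middle _ _ _ (k := 0) (by omega)
  · rw [e1, set_replicate_first]
    have := h.sorted_rowForm hf (a := a + 1) (b := b) (c := c) (d := d) (by omega)
    simpa [X, rowForm, List.replicate_succ'] using this

theorem row_last_neg (h : Arrows n i s B C) {r : List Letter} (hr : IsRow n r) (j : ℕ)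
    (hc : r.count B ≤ r.count C) (hp : 0 < r.count (neg s)) :
    ∃ c, (uncanceled (segBrackets n i j 0 r)).1.getLast? = some (j, c, neg s) ∧
      r[c]? = some (neg s) ∧ (r.set c C).Pairwise (Letter.Le n) := by
  have hbc := h.count_eq_zero_or hr
  obtain ⟨L, M, N, hf, e⟩ := h.exists_rowForm hr.sorted hr.idx_le hr.not_both
  generalize r.count (pos s) = a, r.count C = c, r.count B = b at *
  obtain ⟨d, hd⟩ : ∃ d, r.count (neg s) = d + 1 := ⟨r.count (neg s) - 1, by omega⟩
  rw [hd] at e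
  let X := L ++ (List.replicate a (pos s) ++ (List.replicate b B ++ (M ++ List.replicate c C)))
  have hX : X.length = L.length + a + b + M.length + c := by simp [X]; omega
  have e1 : r = X ++ (List.replicate (d + 1) (neg s) ++ N) := by
    simp [e, X, rowForm]
  refine ⟨X.length, ?_, ?_, ?_⟩
  · rw [e, h.segBrackets_rowForm hf, uncanceled_fourRuns]
    simp only [length_run]
    rw [List.drop_eq_nil_of_le (by rwa [length_run]), List.append_nil, getLast?_run, hX]
  · rw [e1]
    exact getElem?_replicate_middle _ _ _ (k := 0) (by omega)
  · rw [e1, set_replicate_first]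
    have := h.sorted_rowForm hf (a := a) (b := b) (c := c + 1) (d := d) (by omega)
    simpa [X, rowForm, List.replicate_succ'] using this

end Arrows

/-! ### The bracket sequence of a tableau -/

namespace Arrows

variable {n i s : ℕ} {B C : Letter}

/-- The brackets in the rows below row `s`. -/
def lowerBrackets (n i s : ℕ) (R : Filling) : List (Bracket × (ℕ × ℕ × Letter)) :=
  (List.range' (s + 1) (n - 1 - s)).flatMap (fun j => segBrackets n i j 0 (R j))

theorem brackets_split (h : Arrows n i s B C) (R : Filling) : brackets n i R =
    (List.range' 1 (s - 1)).flatMap (fun j => segBrackets n i j 0 (R j)) ++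
      (segBrackets n i s 0 (R s) ++ lowerBrackets n i s R) := by
  have h1 := h.one_le
  have h2 := h.lt
  have e := @List.range'_append_1 1 (s - 1) (n - s)
  rw [show 1 + (s - 1) = s by omega, show n - s = (n - 1 - s) + 1 by omega, List.range'_succ,
    show s - 1 + (n - 1 - s + 1) = n - 1 by omega] at e
  rw [brackets_eq, ← e, List.flatMap_append, List.flatMap_cons, lowerBrackets]

/-- Below row s + 1 all letters have index at least s + 2 and carry no arrow of colour i. -/
theorem length_lowerBrackets_le (h : Arrows n i s B C) {R : Filling}
    (hR : IsMarginallyLarge n R) : (lowerBrackets n i s R).length ≤ (R (s + 1)).length := by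
  have h1 := h.one_le
  have h2 := h.lt
  rcases Nat.eq_zero_or_pos (n - 1 - s) with hz | hz
  · simp [lowerBrackets, hz]
  · rw [lowerBrackets, show n - 1 - s = n - 2 - s + 1 by omega, List.range'_succ,
      List.flatMap_cons]
    have : (List.range' (s + 1 + 1) (n - 2 - s)).flatMap
        (fun j => segBrackets n i j 0 (R j)) = [] := by
      rw [List.flatMap_eq_nil_iff]
      intro j hj
      rw [List.mem_range'_1] at hj
      refine segBrackets_eq_nil fun z hz => ?_
      have hi := (isMarginallyLarge_iff.1 hR).2.1 j z hz
      have d1 : z ≠ B := by rintro rfl; rw [h.idx_B] at hi; omega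
      have d2 : z ≠ C := by rintro rfl; rw [h.idx_C] at hi; omega
      have d3 : z ≠ pos s := by rintro rfl; simp at hi; omega
      have d4 : z ≠ neg s := by rintro rfl; simp at hi; omega
      simp [h.prev_eq, h.next_eq, *]
    rw [this, List.append_nil]
    exact length_segBrackets_le _ _ _ _ _

/-- Marginal largeness is what makes this work: row s has one letter s more than row s + 1 has
boxes. So the lower rows never influence the action, and f_i always finds a `(`. -/
theorem sig_lowerBrackets_lt (h : Arrows n i s B C) {R : Filling} (hR : IsMarginallyLarge n R) :
    (sig (lowerBrackets n i s R)).1 < (rowSig s B C (R s)).2 := by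
  have h1 := (sig_fst_le_length (lowerBrackets n i s R)).trans (h.length_lowerBrackets_le hR)
  have h2 := hR.marginal s h.one_le h.lt
  simp only [rowSig]
  omega

/-- The signatures of the rows of a tableau. -/
def tabSig (s : ℕ) (B C : Letter) (R : Filling) (j : ℕ) : ℕ × ℕ := rowSig s B C (R j)

theorem sig_segBrackets (h : Arrows n i s B C) {R : Filling} (hR : IsMarginallyLarge n R) :
    (fun j => sig (segBrackets n i j 0 (R j))) = tabSig s B C R := by
  funext j
  exact h.sig_row (hR.isRow j) j

theorem sig_lower_fst (h : Arrows n i s B C) {R : Filling} (hR : IsMarginallyLarge n R) :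
    (sig (segBrackets n i s 0 (R s) ++ lowerBrackets n i s R)).1 = (tabSig s B C R s).1 := by
  have := h.sig_lowerBrackets_lt hR
  rw [sig_append, h.sig_row (hR.isRow s) s]
  simp only [bmul, tabSig]
  omega

theorem tabEps_eq (h : Arrows n i s B C) {R : Filling} (hR : IsMarginallyLarge n R) :
    tabEps n i R = ((bmul (sigProd (tabSig s B C R) (List.range' 1 (s - 1)))
      ((tabSig s B C R s).1, 0)).1 : ℕ) := by
  have := h.sig_lower_fst hR
  rw [tabEps, h.brackets_split]
  change ((sig _).1 : ℤ) = _
  rw [sig_append, sig_flatMap, h.sig_segBrackets hR]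
  simp [bmul, this]

theorem head?_brackets_row (h : Arrows n i s B C) {R : Filling} (hR : IsMarginallyLarge n R)
    {j : ℕ} (hs : SelF (tabSig s B C R) (List.range' 1 (s - 1)) (tabSig s B C R s).1 j) :
    (uncanceled (brackets n i R)).2.head? = (uncanceled (segBrackets n i j 0 (R j))).2.head? := by
  rw [← h.sig_lower_fst hR, ← h.sig_segBrackets hR] at hs
  rw [h.brackets_split]
  exact SelF.head?_eq hs

theorem getLast?_brackets_row (h : Arrows n i s B C) {R : Filling} (hR : IsMarginallyLarge n R)
    {j : ℕ} (hs : SelE (tabSig s B C R) (List.range' 1 (s - 1)) (tabSig s B C R s).1 j) :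
    (uncanceled (brackets n i R)).1.getLast? =
      (uncanceled (segBrackets n i j 0 (R j))).1.getLast? := by
  rw [← h.sig_lower_fst hR, ← h.sig_segBrackets hR] at hs
  rw [h.brackets_split]
  exact SelE.getLast?_eq hs

theorem head?_brackets_last (h : Arrows n i s B C) {R : Filling} (hR : IsMarginallyLarge n R)
    (hs : (sigProd (tabSig s B C R) (List.range' 1 (s - 1))).2 ≤ (tabSig s B C R s).1) :
    (uncanceled (brackets n i R)).2.head? = (uncanceled (segBrackets n i s 0 (R s))).2.head? := by
  rw [h.brackets_split]
  refine head?_uncanceled_append _ _ _ ?_ ?_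
  · rwa [sig_flatMap, h.sig_segBrackets hR, h.sig_row (hR.isRow s) s]
  · rw [h.sig_row (hR.isRow s) s]
    exact h.sig_lowerBrackets_lt hR

theorem getLast?_brackets_last (h : Arrows n i s B C) {R : Filling} (hR : IsMarginallyLarge n R)
    (hs : (sigProd (tabSig s B C R) (List.range' 1 (s - 1))).2 < (tabSig s B C R s).1) :
    (uncanceled (brackets n i R)).1.getLast? =
      (uncanceled (segBrackets n i s 0 (R s))).1.getLast? := by
  rw [h.brackets_split]
  refine getLast?_uncanceled_append _ _ _ ?_ ?_
  · rwa [sig_flatMap, h.sig_segBrackets hR, h.sig_row (hR.isRow s) s]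
  · rw [h.sig_row (hR.isRow s) s]
    exact (h.sig_lowerBrackets_lt hR).le

end Arrows

/-! ### The operators on tableaux -/

/-- The conditions on row `j` of a marginally large tableau, except for its number of
letters `j`. -/
structure IsRowAt (n j : ℕ) (r : List Letter) : Prop where
  sorted : r.Pairwise (Letter.Le n)
  idx : ∀ z ∈ r, j ≤ z.idx ∧ z.idx ≤ n
  not_both : ¬ (pos n ∈ r ∧ neg n ∈ r)

theorem isMarginallyLarge_iff_isRowAt {n : ℕ} {R : Filling} : IsMarginallyLarge n R ↔
    (∀ j, ¬ (1 ≤ j ∧ j < n) → R j = []) ∧ (∀ j, 1 ≤ j → j < n → IsRowAt n j (R j)) ∧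
    ∀ j, 1 ≤ j → j < n → (R j).count (pos j) = (R (j + 1)).length + 1 := by
  rw [isMarginallyLarge_iff]
  constructor
  · rintro ⟨h1, h2, h3, h4, h5⟩
    exact ⟨h1, fun j _ _ => ⟨h3 j, h2 j, h5 j⟩, h4⟩
  · rintro ⟨h1, h2, h3⟩
    have h4 : ∀ j, R j = [] ∨ IsRowAt n j (R j) := by
      intro j
      by_cases hj : 1 ≤ j ∧ j < n
      · exact Or.inr (h2 j hj.1 hj.2)
      · exact Or.inl (h1 j hj)
    refine ⟨h1, fun j => ?_, fun j => ?_, h3, fun j => ?_⟩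
    · rcases h4 j with e | e
      · simp [e]
      · exact e.idx
    · rcases h4 j with e | e
      · simp [e]
      · exact e.sorted
    · rcases h4 j with e | e
      · simp [e]
      · exact e.not_both

theorem IsMarginallyLarge.isRowAt {n : ℕ} {R : Filling} (h : IsMarginallyLarge n R) (j : ℕ) :
    IsRowAt n j (R j) :=
  have h' := isMarginallyLarge_iff.1 h
  ⟨h'.2.2.1 j, h'.2.1 j, h'.2.2.2.2 j⟩

theorem pos_le_of_idx {n j : ℕ} {z : Letter} (hj : j < n) (h : j ≤ z.idx ∧ z.idx ≤ n) :
    (pos j).Le n z := by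
  cases z <;> simp [Letter.Le, Letter.height] at * <;> omega

theorem IsRowAt.cons {n j : ℕ} {r : List Letter} (hj : j < n) (h : IsRowAt n j r) :
    IsRowAt n j (pos j :: r) where
  sorted := List.pairwise_cons.2 ⟨fun z hz => pos_le_of_idx hj (h.idx z hz), h.sorted⟩
  idx z hz := by
    rcases List.mem_cons.1 hz with rfl | hz
    · exact ⟨le_rfl, hj.le⟩
    · exact h.idx z hz
  not_both := by
    simpa [hj.ne'] using h.not_both

theorem IsRowAt.of_cons {n j : ℕ} {x : Letter} {r : List Letter} (h : IsRowAt n j (x :: r)) :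
    IsRowAt n j r where
  sorted := h.sorted.of_cons
  idx z hz := h.idx z (List.mem_cons_of_mem _ hz)
  not_both hc := h.not_both ⟨List.mem_cons_of_mem _ hc.1, List.mem_cons_of_mem _ hc.2⟩

theorem IsRowAt.eq_cons {n j : ℕ} {r : List Letter} (hj : j < n) (h : IsRowAt n j r)
    (hm : pos j ∈ r) : r = pos j :: r.tail := by
  rcases r with _ | ⟨y, r⟩
  · simp at hm
  · have : y = pos j := by
      have h1 := pos_le_of_idx hj (h.idx y (by simp))
      rcases List.mem_cons.1 hm with e | hm
      · exact e.symm
      · exact ((List.pairwise_cons.1 h.sorted).1 _ hm).antisymm h1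
    simp [this]

/-! ### Changing a row, and restoring marginality by a column. -/

section Update

variable {n j : ℕ} {R : Filling} {r : List Letter}

theorem isMarginallyLarge_update (hR : IsMarginallyLarge n R) (h1 : 1 ≤ j) (h2 : j < n)
    (hr : IsRowAt n j r) (hl : r.length = (R j).length)
    (hc : r.count (pos j) = (R j).count (pos j)) :
    IsMarginallyLarge n (Function.update R j r) := by
  have hlen : ∀ k, (Function.update R j r k).length = (R k).length := by
    intro k
    by_cases hk : k = j
    · subst hk
      simpa using hl
    · simp [hk]
  refine isMarginallyLarge_iff_isRowAt.2 ⟨fun k hk => ?_, fun k _ _ => ?_, fun k k1 k2 => ?_⟩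
  · rw [Function.update_of_ne (by rintro rfl; exact hk ⟨h1, h2⟩), hR.rows k hk]
  · by_cases hk : k = j
    · subst hk
      simpa using hr
    · simpa [hk] using hR.isRowAt k
  · rw [hlen, ← hR.marginal k k1 k2]
    by_cases hk : k = j
    · subst hk
      simpa using hc
    · simp [hk]

/-- When the number of placeholders changes, `correct` has to take its second branch. -/
theorem not_isMarginallyLarge_update (hR : IsMarginallyLarge n R) (h1 : 1 ≤ j) (h2 : j < n)
    (hc : r.count (pos j) ≠ (R j).count (pos j)) :
    ¬ IsMarginallyLarge n (Function.update R j r) := by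
  intro h
  have e := h.marginal j h1 h2
  rw [Function.update_self, Function.update_of_ne (by omega), ← hR.marginal j h1 h2] at e
  exact hc e

/-- The column returns the lost placeholder to row j. Above row j, placeholders and the length of
the next row grow together, so marginality persists there. -/
theorem isMarginallyLarge_insertColumn {i : ℕ} (hR : IsMarginallyLarge n R) (h1 : 1 ≤ j)
    (h2 : j < n) (hi : ∀ k, (1 ≤ k ∧ k ≤ i ∧ k < n) ↔ (1 ≤ k ∧ k ≤ j))
    (hr : IsRowAt n j r) (hl : r.length = (R j).length)
    (hc : r.count (pos j) + 1 = (R j).count (pos j)) :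
    IsMarginallyLarge n (insertColumn n i (Function.update R j r)) := by
  have e : ∀ k, insertColumn n i (Function.update R j r) k =
      if 1 ≤ k ∧ k ≤ j then pos k :: Function.update R j r k else R k := by
    intro k
    simp only [insertColumn, hi]
    split_ifs with hk
    · rfl
    · rw [Function.update_of_ne (by omega)]
  have hlen : ∀ k, (Function.update R j r k).length = (R k).length := by
    intro k
    by_cases hk : k = j
    · subst hk
      simpa using hl
    · simp [hk]
  refine isMarginallyLarge_iff_isRowAt.2 ⟨fun k hk => ?_, fun k k1 k2 => ?_, fun k k1 k2 => ?_⟩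
  · rw [e, if_neg (by omega), hR.rows k hk]
  · rw [e]
    split_ifs with hk
    · refine IsRowAt.cons k2 ?_
      by_cases hk : k = j
      · subst hk
        simpa using hr
      · simpa [hk] using hR.isRowAt k
    · exact hR.isRowAt k
  · have hm := hR.marginal k k1 k2
    rw [e, e]
    rcases lt_trichotomy k j with hk | rfl | hk
    · rw [if_pos (by omega), if_pos (by omega), Function.update_of_ne hk.ne]
      simp [hlen, hm]
    · rw [if_pos (by omega), if_neg (by omega)]
      simp
      omega
    · rw [if_neg (by omega), if_neg (by omega), hm]

/-- The second conclusion ensures that only placeholders are deleted. -/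
theorem isMarginallyLarge_deleteColumn {i : ℕ} (hR : IsMarginallyLarge n R) (h1 : 1 ≤ j)
    (h2 : j < n) (hi : ∀ k, (1 ≤ k ∧ k ≤ i ∧ k < n) ↔ (1 ≤ k ∧ k ≤ j))
    (hr : IsRowAt n j r) (hl : r.length = (R j).length)
    (hc : r.count (pos j) = (R j).count (pos j) + 1) :
    IsMarginallyLarge n (deleteColumn n i (Function.update R j r)) ∧
      ∀ k, 1 ≤ k → k ≤ j → Function.update R j r k =
        pos k :: deleteColumn n i (Function.update R j r) k := by
  have e : ∀ k, deleteColumn n i (Function.update R j r) k =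
      if 1 ≤ k ∧ k ≤ j then (Function.update R j r k).tail else R k := by
    intro k
    simp only [deleteColumn, hi]
    split_ifs with hk
    · rfl
    · rw [Function.update_of_ne (by omega)]
  have hlen : ∀ k, (Function.update R j r k).length = (R k).length := by
    intro k
    by_cases hk : k = j
    · subst hk
      simpa using hl
    · simp [hk]
  have hrow : ∀ k, IsRowAt n k (Function.update R j r k) := by
    intro k
    by_cases hk : k = j
    · subst hk
      simpa using hr
    · simpa [hk] using hR.isRowAt k
  have hcons : ∀ k, 1 ≤ k → k ≤ j → Function.update R j r k =
        pos k :: (Function.update R j r k).tail := by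
    intro k k1 k2
    refine (hrow k).eq_cons (by omega) (List.count_pos_iff.1 ?_)
    have hm := hR.marginal k k1 (by omega)
    by_cases hk : k = j
    · subst hk
      rw [Function.update_self]
      omega
    · rw [Function.update_of_ne hk]
      omega
  constructor
  swap
  · intro k k1 k2
    rw [e, if_pos ⟨k1, k2⟩]
    exact hcons k k1 k2
  refine isMarginallyLarge_iff_isRowAt.2 ⟨fun k hk => ?_, fun k k1 k2 => ?_, fun k k1 k2 => ?_⟩
  · rw [e, if_neg (by omega), hR.rows k hk]
  · rw [e]
    split_ifs with hk
    · have := hrow k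
      rw [hcons k k1 hk.2] at this
      exact this.of_cons
    · exact hR.isRowAt k
  · have hm := hR.marginal k k1 k2
    rw [e, e]
    rcases lt_trichotomy k j with hk | rfl | hk
    · have c1 := congrArg (List.count (pos k)) (hcons k k1 hk.le)
      have c2 := congrArg List.length (hcons (k + 1) (by omega) hk)
      rw [Function.update_of_ne hk.ne, List.count_cons_self] at c1
      rw [hlen, List.length_cons] at c2
      rw [if_pos (by omega), if_pos (by omega), Function.update_of_ne hk.ne]
      omega
    · have c1 := congrArg (List.count (pos k)) (hcons k k1 le_rfl)
      rw [List.count_cons_self, Function.update_self] at c1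
      rw [if_pos (by omega), if_neg (by omega), Function.update_self]
      omega
    · rw [if_neg (by omega), if_neg (by omega), hm]

end Update

theorem count_set_of_getElem? {r : List Letter} {c : ℕ} {x : Letter} (h : r[c]? = some x)
    (x' z : Letter) : (r.set c x').count z + (if z = x then 1 else 0) =
      r.count z + (if z = x' then 1 else 0) := by
  obtain ⟨hc, hx⟩ := List.getElem?_eq_some_iff.1 h
  rw [List.count_set hc, hx]
  simp only [beq_iff_eq, eq_comm (a := x), eq_comm (a := x')]
  by_cases hz : z = x
  · have : 0 < r.count z := List.count_pos_iff.2 (by rw [hz, ← hx]; exact List.getElem_mem hc)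
    simp only [if_pos hz]
    omega
  · simp [hz]

/-- The condition `hb` prevents a new n or n̄ from meeting its opposite. -/
theorem IsRowAt.set {n j c : ℕ} {r : List Letter} {x' : Letter} (h : IsRowAt n j r)
    (hs : (r.set c x').Pairwise (Letter.Le n)) (h1 : j ≤ x'.idx) (h2 : x'.idx ≤ n)
    (hb : x'.idx = n → ∀ z ∈ r, z.idx = n → z = x') : IsRowAt n j (r.set c x') where
  sorted := hs
  idx z hz := by
    rcases List.mem_or_eq_of_mem_set hz with hz | rfl
    · exact h.idx z hz
    · exact ⟨h1, h2⟩
  not_both := by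
    rintro ⟨hp, hq⟩
    rcases List.mem_or_eq_of_mem_set hp with hp' | rfl
    · rcases List.mem_or_eq_of_mem_set hq with hq' | rfl
      · exact h.not_both ⟨hp', hq'⟩
      · exact absurd (hb rfl (pos n) hp' rfl) (by simp)
    · rcases List.mem_or_eq_of_mem_set hq with hq' | hq
      · exact absurd (hb rfl (neg n) hq' rfl) (by simp)
      · simp at hq

/-- Up to the placeholders, `R'` arises from `R` by changing a letter `x` in row `j` to `x'`. -/
def Step (R R' : Filling) (j : ℕ) (x x' : Letter) : Prop :=
  ∀ k z, z ≠ pos k → (R' k).count z + (if k = j ∧ z = x then 1 else 0) =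
    (R k).count z + (if k = j ∧ z = x' then 1 else 0)

theorem step_setBox {R : Filling} {j c : ℕ} {x : Letter} (h : (R j)[c]? = some x) (x' : Letter) :
    Step R (setBox R j c x') j x x' := by
  intro k z _
  by_cases hk : k = j
  · subst hk
    simpa [setBox] using count_set_of_getElem? h x' z
  · simp [setBox, hk]

theorem correct_of_left {n : ℕ} {R R' : Filling} (h : IsMarginallyLarge n R) :
    correct n R R' = some ⟨R, h⟩ := by
  simp [correct, h]

theorem correct_of_right {n : ℕ} {R R' : Filling} (h : ¬ IsMarginallyLarge n R)
    (h' : IsMarginallyLarge n R') : correct n R R' = some ⟨R', h'⟩ := by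
  simp [correct, h, h']

theorem exists_correct_setBox {n j c : ℕ} {x x' : Letter} {T : MLT n} (R' : Filling) (h1 : 1 ≤ j)
    (h2 : j < n) (hx : (T.1 j)[c]? = some x) (hne : x ≠ pos j) (hne' : x' ≠ pos j)
    (hr : IsRowAt n j ((T.1 j).set c x')) :
    ∃ T', correct n (setBox T.1 j c x') R' = some T' ∧ Step T.1 T'.1 j x x' := by
  refine ⟨⟨setBox T.1 j c x', isMarginallyLarge_update T.2 h1 h2 hr (by simp) ?_⟩,
    correct_of_left _, step_setBox hx x'⟩
  simpa [hne.symm, hne'.symm] using count_set_of_getElem? hx x' (pos j)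

theorem exists_correct_insertColumn {n i j c : ℕ} {x' : Letter} {T : MLT n} (h1 : 1 ≤ j)
    (h2 : j < n) (hi : ∀ k, (1 ≤ k ∧ k ≤ i ∧ k < n) ↔ (1 ≤ k ∧ k ≤ j))
    (hx : (T.1 j)[c]? = some (pos j)) (hne' : x' ≠ pos j)
    (hr : IsRowAt n j ((T.1 j).set c x')) :
    ∃ T', correct n (setBox T.1 j c x') (insertColumn n i (setBox T.1 j c x')) = some T' ∧
      Step T.1 T'.1 j (pos j) x' := by
  have hc := count_set_of_getElem? hx x' (pos j)
  rw [if_pos rfl, if_neg hne'.symm] at hc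
  refine ⟨⟨_, isMarginallyLarge_insertColumn T.2 h1 h2 hi hr (by simp) hc⟩,
    correct_of_right (not_isMarginallyLarge_update T.2 h1 h2 (by omega)) _, ?_⟩
  intro k z hz
  have := step_setBox hx x' k z hz
  rw [← this]
  simp only [insertColumn, setBox]
  split_ifs <;> simp [hz.symm]

theorem exists_correct_deleteColumn {n i j c : ℕ} {x : Letter} {T : MLT n} (h1 : 1 ≤ j)
    (h2 : j < n) (hi : ∀ k, (1 ≤ k ∧ k ≤ i ∧ k < n) ↔ (1 ≤ k ∧ k ≤ j))
    (hx : (T.1 j)[c]? = some x) (hne : x ≠ pos j)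
    (hr : IsRowAt n j ((T.1 j).set c (pos j))) :
    ∃ T', correct n (setBox T.1 j c (pos j)) (deleteColumn n i (setBox T.1 j c (pos j))) =
      some T' ∧ Step T.1 T'.1 j x (pos j) := by
  have hc := count_set_of_getElem? hx (pos j) (pos j)
  rw [if_pos rfl, if_neg hne.symm] at hc
  obtain ⟨hd, he⟩ := isMarginallyLarge_deleteColumn T.2 h1 h2 hi hr (by simp) (by omega)
  refine ⟨⟨_, hd⟩, correct_of_right (not_isMarginallyLarge_update T.2 h1 h2 (by omega)) _, ?_⟩
  intro k z hz
  have := step_setBox hx (pos j) k z hz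
  rw [← this]
  congr 1
  by_cases hk : 1 ≤ k ∧ k ≤ j
  · rw [setBox, he k hk.1 hk.2]
    simp [hz.symm]
  · have : ¬ (1 ≤ k ∧ k ≤ i ∧ k < n) := by rwa [hi]
    simp only [deleteColumn, if_neg this]
    rfl

namespace Arrows

variable {n i s : ℕ} {B C : Letter}

theorem tabF_of_head? {T : MLT n} {j c : ℕ} {x x' : Letter}
    (hh : (uncanceled (brackets n i T.1)).2.head? = some (j, c, x)) (hx : x.next n i = some x') :
    tabF n i T = correct n (setBox T.1 j c x') (insertColumn n i (setBox T.1 j c x')) := by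
  simp [tabF, hh, hx]

theorem tabE_of_getLast? {T : MLT n} {j c : ℕ} {x x' : Letter}
    (hh : (uncanceled (brackets n i T.1)).1.getLast? = some (j, c, x))
    (hx : x.prev n i = some x') :
    tabE n i T = correct n (setBox T.1 j c x') (deleteColumn n i (setBox T.1 j c x')) := by
  simp [tabE, hh, hx]

theorem next_pos (h : Arrows n i s B C) : (pos s).next n i = some B := by
  simp [h.next_eq]

theorem next_C (h : Arrows n i s B C) : C.next n i = some (neg s) := by
  simp [h.next_eq, h.C_ne_pos]

theorem prev_B (h : Arrows n i s B C) : B.prev n i = some (pos s) := by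
  simp [h.prev_eq]

theorem prev_neg (h : Arrows n i s B C) : (neg s).prev n i = some C := by
  simp [h.prev_eq, h.B_ne_neg.symm]

/-- If B is n or n̄, then at most one of B and C occurs in the row, and the inequality excludes C.
This supplies `hb` of `IsRowAt.set` for the move s → B. -/
theorem eq_B_of_idx (h : Arrows n i s B C) {r : List Letter} (hr : IsRow n r)
    (hc : r.count C ≤ r.count B) (hB : B.idx = n) : ∀ z ∈ r, z.idx = n → z = B := by
  intro z hz e
  rw [h.idx_B] at hB
  rcases h.eq_of_idx (e.trans hB.symm) with e | rfl
  · exact e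
  · have := h.count_eq_zero_or hr hB
    have := List.count_pos_iff.2 hz
    omega

theorem eq_C_of_idx (h : Arrows n i s B C) {r : List Letter} (hr : IsRow n r)
    (hc : r.count B ≤ r.count C) (hC : C.idx = n) : ∀ z ∈ r, z.idx = n → z = C := by
  intro z hz e
  rw [h.idx_C] at hC
  rcases h.eq_of_idx (e.trans hC.symm) with rfl | e
  · have := h.count_eq_zero_or hr hC
    have := List.count_pos_iff.2 hz
    omega
  · exact e

theorem B_ne_pos_of_le (h : Arrows n i s B C) {j : ℕ} (hj : j ≤ s) : B ≠ pos j := by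
  intro e
  have := h.idx_B
  simp [e] at this
  omega

theorem C_ne_pos_of_le (h : Arrows n i s B C) {j : ℕ} (hj : j ≤ s) : C ≠ pos j := by
  intro e
  have := h.idx_C
  simp [e] at this
  omega

/-- `f_i` on a tableau when the leftmost uncanceled `(` is in row `j`. -/
theorem tabF_step (h : Arrows n i s B C) (T : MLT n) {j : ℕ} (h1 : 1 ≤ j) (h2 : j ≤ s)
    (hh : (uncanceled (brackets n i T.1)).2.head? =
      (uncanceled (segBrackets n i j 0 (T.1 j))).2.head?)
    (hp : 0 < (tabSig s B C T.1 j).2) :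
    ∃ T', tabF n i T = some T' ∧
      if (T.1 j).count B < (T.1 j).count C then Step T.1 T'.1 j C (neg s)
      else 0 < (T.1 j).count (pos s) ∧ Step T.1 T'.1 j (pos s) B := by
  have hlt := h.lt
  have hr := T.2.isRow j
  have hra := T.2.isRowAt j
  split_ifs with hc
  · obtain ⟨c, e1, e2, e3⟩ := h.row_head_C hr j hc
    rw [tabF_of_head? (hh.trans e1) h.next_C]
    exact exists_correct_setBox _ h1 (by omega) e2 (h.C_ne_pos_of_le h2) (by simp)
      (hra.set e3 h2 hlt.le fun e => absurd e hlt.ne)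
  · have hp' : 0 < (T.1 j).count (pos s) := by
      simp only [tabSig, rowSig] at hp
      omega
    obtain ⟨c, e1, e2, e3⟩ := h.row_head_pos hr j (by omega) hp'
    rw [tabF_of_head? (hh.trans e1) h.next_pos]
    have hset : IsRowAt n j ((T.1 j).set c B) :=
      hra.set e3 (by rw [h.idx_B]; omega) (by rw [h.idx_B]; omega)
        (h.eq_B_of_idx hr (by omega))
    rcases h2.lt_or_eq with h2 | rfl
    · obtain ⟨T', t1, t2⟩ := exists_correct_setBox
        (insertColumn n i (setBox T.1 j c B)) h1 (by omega) e2 (by simp; omega)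
        (h.B_ne_pos_of_le h2.le) hset
      exact ⟨T', t1, hp', t2⟩
    · obtain ⟨T', t1, t2⟩ := exists_correct_insertColumn h1 hlt h.column_iff e2 h.B_ne_pos hset
      exact ⟨T', t1, hp', t2⟩

/-- `e_i` on a tableau when the rightmost uncanceled `)` is in row `j`. -/
theorem tabE_step (h : Arrows n i s B C) (T : MLT n) {j : ℕ} (h1 : 1 ≤ j) (h2 : j ≤ s)
    (hh : (uncanceled (brackets n i T.1)).1.getLast? =
      (uncanceled (segBrackets n i j 0 (T.1 j))).1.getLast?)
    (hp : 0 < (tabSig s B C T.1 j).1) :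
    ∃ T', tabE n i T = some T' ∧
      if (T.1 j).count C < (T.1 j).count B then Step T.1 T'.1 j B (pos s)
      else 0 < (T.1 j).count (neg s) ∧ Step T.1 T'.1 j (neg s) C := by
  have hlt := h.lt
  have hr := T.2.isRow j
  have hra := T.2.isRowAt j
  split_ifs with hc
  · obtain ⟨c, e1, e2, e3⟩ := h.row_last_B hr j hc
    rw [tabE_of_getLast? (hh.trans e1) h.prev_B]
    have hset : IsRowAt n j ((T.1 j).set c (pos s)) :=
      hra.set e3 h2 hlt.le fun e => absurd e hlt.ne
    rcases h2.lt_or_eq with h2 | rfl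
    · exact exists_correct_setBox _ h1 (by omega) e2 (h.B_ne_pos_of_le h2.le) (by simp; omega)
        hset
    · exact exists_correct_deleteColumn h1 hlt h.column_iff e2 h.B_ne_pos hset
  · have hp' : 0 < (T.1 j).count (neg s) := by
      simp only [tabSig, rowSig] at hp
      omega
    obtain ⟨c, e1, e2, e3⟩ := h.row_last_neg hr j (by omega) hp'
    rw [tabE_of_getLast? (hh.trans e1) h.prev_neg]
    obtain ⟨T', t1, t2⟩ := exists_correct_setBox (deleteColumn n i (setBox T.1 j c C)) h1
      (by omega) e2 (by simp) (h.C_ne_pos_of_le h2)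
      (hra.set e3 (by rw [h.idx_C]; omega) (by rw [h.idx_C]; omega)
        (h.eq_C_of_idx hr (by omega)))
    exact ⟨T', t1, hp', t2⟩

theorem tabE_none (h : Arrows n i s B C) (T : MLT n)
    (hs : (bmul (sigProd (tabSig s B C T.1) (List.range' 1 (s - 1)))
      ((tabSig s B C T.1 s).1, 0)).1 = 0) : tabE n i T = none := by
  have e := h.tabEps_eq T.2
  rw [hs, tabEps] at e
  have : (uncanceled (brackets n i T.1)).1 = [] := by
    rw [← List.length_eq_zero_iff]
    exact_mod_cast e
  simp [tabE, this]

end Arrows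

/-! ### The coefficients of `psi` -/

/-- The number of pairs `k, k̄` in row `j`, where the letters `j̄` of row `j` count as paired. -/
def pr (r : List Letter) (j k : ℕ) : ℕ :=
  if k = j then r.count (neg j) else pairs r k

/-- The coefficient of `root n j z` in the image of the row `r` in position `j`. -/
def rowCf (r : List Letter) (j : ℕ) (z : Letter) : ℕ :=
  pr r j (z.idx - 1) + (r.count z - pr r j z.idx)

theorem cf_part_beta {n j k m : ℕ} {z : Letter} (h1 : 1 ≤ j) (h2 : j ≤ k) (h3 : k + 1 ≤ n)
    (hz : IsRt n m z) :
    cf n (part n (beta n j k)) m z = if m = j ∧ z = pos (k + 1) then 1 else 0 := by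
  rw [beta_eq_root, cf_part hz ⟨h1, by simp; omega, by simpa using h3⟩]

theorem cf_part_gamma {n j k m : ℕ} {z : Letter} (h1 : 1 ≤ j) (h2 : j < k) (h3 : k ≤ n)
    (hz : IsRt n m z) :
    cf n (part n (gamma n j k)) m z = if m = j ∧ z = neg k then 1 else 0 := by
  rw [gamma_eq_root, cf_part hz ⟨h1, by simpa using h2, by simpa using h3⟩]

/-- A pair of index k contributes the roots of both letters of index k + 1. So the coefficient at z
counts all pairs of the preceding index and the unpaired letters z; the rule for j̄ is the case k =
j. -/
theorem cf_psiRow {n j m : ℕ} {z : Letter} (r : List Letter) (h1 : 1 ≤ j) (h2 : j < n)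
    (hz : IsRt n m z) : cf n (psiRow n j r) m z = if m = j then rowCf r j z else 0 := by
  have e1 : ∀ k, j ≤ k → k + 1 ≤ n →
      cf n (part n (beta n j k)) m z + cf n (part n (gamma n j (k + 1))) m z =
        if m = j ∧ z.idx = k + 1 then 1 else 0 := by
    intro k k1 k2
    rw [cf_part_beta h1 k1 k2 hz, cf_part_gamma h1 (by omega) k2 hz]
    by_cases hc : m = j ∧ z.idx = k + 1
    · rw [if_pos hc]
      cases z <;> simp_all
    · rw [if_neg hc, if_neg fun h => hc ⟨h.1, by rw [h.2, idx_pos]⟩,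
        if_neg fun h => hc ⟨h.1, by rw [h.2, idx_neg]⟩]
  have e2 : ∀ k ∈ Finset.Icc (j + 1) (n - 1),
      cf n (pairs r k • (part n (beta n j k) + part n (gamma n j (k + 1)))) m z =
        if m = j ∧ z.idx - 1 = k then pairs r (z.idx - 1) else 0 := by
    intro k hk
    rw [Finset.mem_Icc] at hk
    rw [cf_smul, cf_add, e1 k (by omega) (by omega)]
    by_cases hc : m = j ∧ z.idx = k + 1
    · rw [if_pos hc, if_pos (by omega), show z.idx - 1 = k by omega, mul_one]
    · have := hz.2.1
      rw [if_neg hc, if_neg (by omega), mul_zero]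
  have e3 : ∀ k ∈ Finset.Icc (j + 1) n,
      cf n ((r.count (pos k) - pairs r k) • part n (beta n j (k - 1))) m z =
        if z.idx = k then (if m = j ∧ z = pos z.idx then r.count z - pairs r z.idx else 0)
          else 0 := by
    intro k hk
    rw [Finset.mem_Icc] at hk
    rw [cf_smul, cf_part_beta h1 (by omega) (by omega) hz, Nat.sub_add_cancel (by omega)]
    by_cases hc : m = j ∧ z = pos k
    · obtain ⟨rfl, rfl⟩ := hc
      simp
    · rw [if_neg hc, mul_zero]
      by_cases hk : z.idx = k
      · rw [if_pos hk, hk, if_neg hc]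
      · rw [if_neg hk]
  have e4 : ∀ k ∈ Finset.Icc (j + 1) n,
      cf n ((r.count (neg k) - pairs r k) • part n (gamma n j k)) m z =
        if z.idx = k then (if m = j ∧ z = neg z.idx then r.count z - pairs r z.idx else 0)
          else 0 := by
    intro k hk
    rw [Finset.mem_Icc] at hk
    rw [cf_smul, cf_part_gamma h1 (by omega) (by omega) hz]
    by_cases hc : m = j ∧ z = neg k
    · obtain ⟨rfl, rfl⟩ := hc
      simp
    · rw [if_neg hc, mul_zero]
      by_cases hk : z.idx = k
      · rw [if_pos hk, hk, if_neg hc]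
      · rw [if_neg hk]
  obtain ⟨z1, z2, z3⟩ := hz
  rw [psiRow, cf_add, cf_add, cf_add, cf_sum, cf_sum, cf_sum, cf_smul, cf_add,
    e1 j le_rfl h2, Finset.sum_congr rfl e2, Finset.sum_congr rfl e3, Finset.sum_congr rfl e4]
  by_cases hm : m = j
  · subst hm
    simp only [true_and, if_true, Finset.sum_ite_eq, Finset.mem_Icc]
    have hmem : m + 1 ≤ z.idx ∧ z.idx ≤ n := ⟨z2, z3⟩
    rw [if_pos hmem, if_pos hmem, rowCf]
    have hpr : pr r m z.idx = pairs r z.idx := by simp [pr, show z.idx ≠ m by omega]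
    have h12 : (r.count (neg m) * if z.idx = m + 1 then 1 else 0) +
        (if m + 1 ≤ z.idx - 1 ∧ z.idx - 1 ≤ n - 1 then pairs r (z.idx - 1) else 0) =
          pr r m (z.idx - 1) := by
      rw [pr]
      by_cases h : z.idx = m + 1
      · rw [if_pos h, if_neg (by omega), if_pos (by omega)]
        simp
      · rw [if_neg h, if_pos (by omega), if_neg (by omega)]
        simp
    rw [h12, hpr, add_assoc]
    congr 1
    cases z with
    | pos k => rw [if_pos (show pos k = pos (pos k).idx from rfl), if_neg (by simp), add_zero]
    | neg k => rw [if_neg (by simp), if_pos (show neg k = neg (neg k).idx from rfl), zero_add]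
  · simp [hm]

theorem cf_psi {n m : ℕ} {z : Letter} (T : MLT n) (hz : IsRt n m z) :
    cf n (psi n T) m z = rowCf (T.1 m) m z := by
  obtain ⟨z1, z2, z3⟩ := hz
  rw [psi, cf_sum, Finset.sum_congr rfl (g := fun j => if m = j then rowCf (T.1 m) m z else 0)]
  · rw [Finset.sum_ite_eq, if_pos (Finset.mem_Icc.2 ⟨z1, by omega⟩)]
  · intro j hj
    rw [Finset.mem_Icc] at hj
    rw [cf_psiRow _ hj.1 (by omega) ⟨z1, z2, z3⟩]
    split_ifs with h
    · rw [h]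
    · rfl

/-- After pairing, at least one of m and m̄ has no unpaired letter left, so the smaller of the two
coefficients consists of the pairs of index m - 1 alone. -/
theorem pr_eq_min {r : List Letter} {j m : ℕ} (h : j < m) :
    pr r j (m - 1) = min (rowCf r j (pos m)) (rowCf r j (neg m)) := by
  have : pr r j m = min (r.count (pos m)) (r.count (neg m)) := by
    simp [pr, h.ne', pairs]
  simp only [rowCf, idx_pos, idx_neg, this]
  omega

theorem count_eq_rowCf {r : List Letter} {j : ℕ} {z : Letter} (h : j < z.idx) :
    r.count z = rowCf r j z - pr r j (z.idx - 1) + pr r j z.idx := by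
  have : pr r j z.idx ≤ r.count z := by
    rw [pr, if_neg h.ne', pairs]
    cases z
    · exact min_le_left _ _
    · exact min_le_right _ _
  rw [rowCf]
  omega

/-- A row is determined by its coefficients and its number of placeholders. -/
theorem row_ext_rowCf {n j : ℕ} {r r' : List Letter} (hj : j < n) (hr : IsRowAt n j r)
    (hr' : IsRowAt n j r') (hp : r.count (pos j) = r'.count (pos j))
    (hc : ∀ z : Letter, j < z.idx → z.idx ≤ n → rowCf r j z = rowCf r' j z) : r = r' := by
  have hpr : ∀ k, j ≤ k → k ≤ n → pr r j k = pr r' j k := by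
    intro k k1 k2
    rcases k2.lt_or_eq with k2 | rfl
    · have e := pr_eq_min (r := r) (j := j) (m := k + 1) (by omega)
      have e' := pr_eq_min (r := r') (j := j) (m := k + 1) (by omega)
      rw [hc (pos (k + 1)) (by simp; omega) (by simpa using k2),
        hc (neg (k + 1)) (by simp; omega) (by simpa using k2), ← e'] at e
      exact e
    · have hz : ∀ r : List Letter, IsRowAt k j r → pr r j k = 0 := by
        intro r hr
        rw [pr, if_neg hj.ne', pairs]
        by_contra hne
        refine hr.not_both ⟨List.count_pos_iff.1 ?_, List.count_pos_iff.1 ?_⟩ <;> omega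
      rw [hz r hr, hz r' hr']
  refine row_ext hr.sorted hr'.sorted fun z => ?_
  by_cases h1 : j ≤ z.idx ∧ z.idx ≤ n
  · by_cases h2 : j = z.idx
    · cases z with
      | pos k =>
        obtain rfl : j = k := h2
        exact hp
      | neg k =>
        obtain rfl : j = k := h2
        simpa [pr] using hpr j le_rfl h1.2
    · have h3 : j < z.idx := by omega
      rw [count_eq_rowCf h3, count_eq_rowCf h3, hc z h3 h1.2, hpr _ (by omega) h1.2,
        hpr _ (by omega) (by omega)]
  · rw [List.count_eq_zero.2 fun hz => h1 (hr.idx z hz),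
      List.count_eq_zero.2 fun hz => h1 (hr'.idx z hz)]

theorem psi_injective (n : ℕ) : Function.Injective (psi n) := by
  intro T T' e
  -- Induction from the bottom row upwards: the number of placeholders in a row is determined by the
  -- length of the next row.
  have key : ∀ d j, n ≤ j + d → T.1 j = T'.1 j := by
    intro d
    induction d with
    | zero =>
      intro j hj
      rw [T.2.rows j (by omega), T'.2.rows j (by omega)]
    | succ d ih =>
      intro j hj
      by_cases hj' : 1 ≤ j ∧ j < n
      · refine row_ext_rowCf hj'.2 (T.2.isRowAt j) (T'.2.isRowAt j) ?_ ?_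
        · rw [T.2.marginal j hj'.1 hj'.2, T'.2.marginal j hj'.1 hj'.2, ih (j + 1) (by omega)]
        · intro z z1 z2
          rw [← cf_psi T ⟨hj'.1, z1, z2⟩, ← cf_psi T' ⟨hj'.1, z1, z2⟩, e]
      · rw [T.2.rows j hj', T'.2.rows j hj']
  exact Subtype.ext (funext fun j => key n j (by omega))

/-! ### `psi` and the operators -/

namespace Arrows

variable {n i s : ℕ} {B C : Letter}

theorem pr_succ (h : Arrows n i s B C) (r : List Letter) {j : ℕ} (hj : j ≤ s) :
    pr r j (s + 1) = min (r.count B) (r.count C) := by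
  rw [pr, if_neg (by omega), pairs]
  rcases h.cases with ⟨rfl, rfl⟩ | ⟨e, rfl, rfl⟩
  · rfl
  · rw [e, min_comm]

theorem pr_self (r : List Letter) {j : ℕ} (hj : j < s) :
    pr r j s = min (r.count (pos s)) (r.count (neg s)) := by
  rw [pr, if_neg hj.ne', pairs]

theorem rowCf_pos (r : List Letter) {j : ℕ} (hj : j < s) :
    rowCf r j (pos s) + min (r.count (pos s)) (r.count (neg s)) =
      pr r j (s - 1) + r.count (pos s) := by
  rw [rowCf, idx_pos, pr_self r hj]
  omega

theorem rowCf_neg (r : List Letter) {j : ℕ} (hj : j < s) :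
    rowCf r j (neg s) + min (r.count (pos s)) (r.count (neg s)) =
      pr r j (s - 1) + r.count (neg s) := by
  rw [rowCf, idx_neg, pr_self r hj]
  omega

theorem rowCf_B (h : Arrows n i s B C) (r : List Letter) {j : ℕ} (hj : j ≤ s) :
    rowCf r j B + min (r.count B) (r.count C) = pr r j s + r.count B := by
  rw [rowCf, h.idx_B, h.pr_succ r hj, Nat.add_sub_cancel]
  omega

theorem rowCf_C (h : Arrows n i s B C) (r : List Letter) {j : ℕ} (hj : j ≤ s) :
    rowCf r j C + min (r.count B) (r.count C) = pr r j s + r.count C := by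
  rw [rowCf, h.idx_C, h.pr_succ r hj, Nat.add_sub_cancel]
  omega

/-- The pairs of index s - 1 cancel in the difference of the coefficients of s and s̄; the pairs of
index s, which enter the coefficients of B and C, restore the canceled s and s̄. -/
theorem kpSig_psi (h : Arrows n i s B C) (T : MLT n) {j : ℕ} (h1 : 1 ≤ j) (h2 : j < s) :
    kpSig n s B C (psi n T) j = tabSig s B C T.1 j := by
  simp only [kpSig, tabSig, rowSig, cf_psi T (h.isRt_B h1 h2.le), cf_psi T (h.isRt_C h1 h2.le),
    cf_psi T (h.isRt_pos h1 h2), cf_psi T (h.isRt_neg h1 h2), Prod.mk.injEq]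
  have fA := rowCf_pos (T.1 j) h2
  have fD := rowCf_neg (T.1 j) h2
  have fB := h.rowCf_B (T.1 j) h2.le
  have fC := h.rowCf_C (T.1 j) h2.le
  rw [pr_self _ h2] at fB fC
  omega

theorem cf_psi_last (h : Arrows n i s B C) (T : MLT n) :
    cf n (psi n T) s B = (tabSig s B C T.1 s).1 := by
  have fB := h.rowCf_B (T.1 s) le_rfl
  rw [pr, if_pos rfl] at fB
  rw [cf_psi T (h.isRt_B h.one_le le_rfl)]
  simp only [tabSig, rowSig]
  omega

theorem sigProd_psi (h : Arrows n i s B C) (T : MLT n) :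
    sigProd (kpSig n s B C (psi n T)) (List.range' 1 (s - 1)) =
      sigProd (tabSig s B C T.1) (List.range' 1 (s - 1)) :=
  sigProd_congr fun _ hj => h.kpSig_psi T (mem_rows hj).1 (mem_rows hj).2

theorem kpEps_psi (h : Arrows n i s B C) (T : MLT n) :
    kpEps n i (psi n T) = tabEps n i T.1 := by
  rw [h.kpEps_eq, h.tabEps_eq T.2, h.sigProd_psi, h.cf_psi_last]

/-- The letters on the arrows of colour `i`. -/
def OnArrow (s : ℕ) (B C z : Letter) : Prop := z = pos s ∨ z = neg s ∨ z = B ∨ z = C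

theorem onArrow_iff (h : Arrows n i s B C) {z : Letter} :
    OnArrow s B C z ↔ z.idx = s ∨ z.idx = s + 1 := by
  constructor
  · rintro (rfl | rfl | rfl | rfl)
    · exact Or.inl rfl
    · exact Or.inl rfl
    · exact Or.inr h.idx_B
    · exact Or.inr h.idx_C
  · rintro (e | e)
    · cases z <;> simp only [idx_pos, idx_neg] at e <;> simp [OnArrow, e]
    · rcases h.eq_of_idx e with e | e <;> simp [OnArrow, e]

theorem pr_congr (h : Arrows n i s B C) {r r' : List Letter} {j k : ℕ} (hk : j ≤ k)
    (hs : k ≠ s) (hs' : k ≠ s + 1)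
    (hc : ∀ z, z ≠ pos j → ¬ OnArrow s B C z → r'.count z = r.count z) :
    pr r' j k = pr r j k := by
  have e1 : ¬ OnArrow s B C (pos k) := by rw [h.onArrow_iff]; simp [hs, hs']
  have e2 : ¬ OnArrow s B C (neg k) := by rw [h.onArrow_iff]; simp [hs, hs']
  unfold pr pairs
  split_ifs with e
  · subst e
    exact hc _ (by simp) e2
  · rw [hc (pos k) (by simp [e]) e1, hc (neg k) (by simp) e2]

/-- A letter off the arrows can notice the change only through the pairs of index s + 1, when its
own index is s + 2; `hm` keeps that number fixed. -/
theorem rowCf_congr (h : Arrows n i s B C) {r r' : List Letter} {j : ℕ} {z : Letter}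
    (hj : j ≤ s) (hz : j < z.idx) (hn : ¬ OnArrow s B C z)
    (hc : ∀ z, z ≠ pos j → ¬ OnArrow s B C z → r'.count z = r.count z)
    (hm : min (r'.count B) (r'.count C) = min (r.count B) (r.count C)) :
    rowCf r' j z = rowCf r j z := by
  have hn' := hn
  rw [h.onArrow_iff, not_or] at hn
  have h1 : pr r' j (z.idx - 1) = pr r j (z.idx - 1) := by
    by_cases e : z.idx - 1 = s + 1
    · rw [e, h.pr_succ r' hj, h.pr_succ r hj, hm]
    · exact h.pr_congr (by omega) (by omega) e hc
  rw [rowCf, rowCf, h1, h.pr_congr hz.le hn.1 hn.2 hc,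
    hc z (by rintro rfl; simp at hz) hn']

end Arrows

theorem Step.symm {R R' : Filling} {j : ℕ} {x x' : Letter} (h : Step R R' j x x') :
    Step R' R j x' x := fun k z hz => (h k z hz).symm

theorem Step.rowCf_of_ne {R R' : Filling} {j k : ℕ} {x x' z : Letter} (h : Step R R' j x x')
    (hk : k ≠ j) (hz : k < z.idx) : rowCf (R' k) k z = rowCf (R k) k z := by
  have hc : ∀ z, z ≠ pos k → (R' k).count z = (R k).count z := by
    intro z hz
    simpa [hk] using h k z hz
  have hp : ∀ m, k ≤ m → pr (R' k) k m = pr (R k) k m := by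
    intro m hm
    unfold pr pairs
    split_ifs with e
    · exact hc _ (by simp)
    · rw [hc (pos m) (by simp [e]), hc (neg m) (by simp)]
  rw [rowCf, rowCf, hp _ (by omega), hp _ hz.le, hc z (by rintro rfl; simp at hz)]

namespace Arrows

variable {n i s : ℕ} {B C : Letter}

/-- The effect on row `j` of the operator `f_i`. -/
def FStep (s : ℕ) (B C : Letter) (R R' : Filling) (j : ℕ) : Prop :=
  ((R j).count B < (R j).count C ∧ Step R R' j C (neg s)) ∨
    ((R j).count C ≤ (R j).count B ∧ 0 < (R j).count (pos s) ∧ Step R R' j (pos s) B)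

/-- Lower case letters count s, B, C, s̄ in the row, upper case letters are the coefficients, and q,
p, o count the pairs of index s-1, s, s+1. The tableau decides between C → s̄ and s → B by comparing
b with c; the Kostant partition decides by comparing a with d. Each tableau move can produce either
partition move, because it may change p: for d < a, the move C → s̄ forms a new pair s, s̄, and for
a ≤ d, the move s → B breaks one. -/
theorem fStep_numbers {a b c d a' b' c' d' q p p' o o' A B C D A' B' C' D' : ℕ}
    (hnum : (b < c ∧ b' = b ∧ c' + 1 = c ∧ a' = a ∧ d' = d + 1) ∨
      (c ≤ b ∧ b' = b + 1 ∧ c' = c ∧ a' + 1 = a ∧ d' = d))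
    (hp : min a d = p) (hp' : min a' d' = p') (ho : min b c = o) (ho' : min b' c' = o')
    (fA : A + p = q + a) (fD : D + p = q + d) (fB : B + o = p + b) (fC : C + o = p + c)
    (fA' : A' + p' = q + a') (fD' : D' + p' = q + d') (fB' : B' + o' = p' + b')
    (fC' : C' + o' = p' + c') :
    o' = o ∧ 0 < A - D + C ∧ (D < A → A' = A - 1 ∧ D' = D ∧ B' = B + 1 ∧ C' = C) ∧
      (¬ D < A → A' = A ∧ D' = D + 1 ∧ B' = B ∧ C' = C - 1) := by
  have e1 : o' = o := by omega
  subst e1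
  by_cases h : d < a
  · have e2 : p = d := by omega
    have e3 : p' = d' := by omega
    subst e2 e3
    refine ⟨rfl, ?_, ?_, ?_⟩ <;> omega
  · have e2 : p = a := by omega
    have e3 : p' = a' := by omega
    subst e2 e3
    refine ⟨rfl, ?_, ?_, ?_⟩ <;> omega

theorem psi_fStep_row (h : Arrows n i s B C) {T T' : MLT n} {j : ℕ} (h1 : 1 ≤ j) (h2 : j < s)
    (hs : FStep s B C T.1 T'.1 j) :
    psi n T' = (if cf n (psi n T) j (neg s) < cf n (psi n T) j (pos s) then
      move n (psi n T) j (pos s) B else move n (psi n T) j C (neg s)) ∧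
    0 < cf n (psi n T) j (pos s) - cf n (psi n T) j (neg s) + cf n (psi n T) j C := by
  have hA := h.isRt_pos h1 h2
  have hD := h.isRt_neg h1 h2
  have hB := h.isRt_B h1 h2.le
  have hC := h.isRt_C h1 h2.le
  have hBC := h.B_ne_C
  have hBs := h.B_ne_pos
  have hBs' := h.B_ne_neg
  have hCs := h.C_ne_pos
  have hCs' := h.C_ne_neg
  have d1 : (pos s) ≠ pos j := by simp; omega
  have d2 := h.B_ne_pos_of_le h2.le
  have d3 := h.C_ne_pos_of_le h2.le
  have hother : (∀ z, z ≠ pos j → ¬ OnArrow s B C z → (T'.1 j).count z = (T.1 j).count z) := by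
    intro z hz ho
    simp only [OnArrow, not_or] at ho
    rcases hs with ⟨-, hs⟩ | ⟨-, -, hs⟩ <;> simpa [ho] using hs j z hz
  have hnum : (((T.1 j).count B < (T.1 j).count C ∧ (T'.1 j).count B = (T.1 j).count B ∧
      (T'.1 j).count C + 1 = (T.1 j).count C ∧
      (T'.1 j).count (pos s) = (T.1 j).count (pos s) ∧
      (T'.1 j).count (neg s) = (T.1 j).count (neg s) + 1)) ∨
      ((T.1 j).count C ≤ (T.1 j).count B ∧ (T'.1 j).count B = (T.1 j).count B + 1 ∧
      (T'.1 j).count C = (T.1 j).count C ∧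
      (T'.1 j).count (pos s) + 1 = (T.1 j).count (pos s) ∧
      (T'.1 j).count (neg s) = (T.1 j).count (neg s)) := by
    rcases hs with ⟨hc, hs⟩ | ⟨hc, hp, hs⟩
    · left
      have c1 := hs j B d2
      have c2 := hs j C d3
      have c3 := hs j (pos s) d1
      have c4 := hs j (neg s) (by simp)
      simp [hBC, hBs', hCs', hCs.symm, hCs'.symm] at c1 c2 c3 c4
      exact ⟨hc, c1, c2, c3, c4⟩
    · right
      have c1 := hs j B d2
      have c2 := hs j C d3
      have c3 := hs j (pos s) d1
      have c4 := hs j (neg s) (by simp)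
      simp [hBC.symm, hBs, hBs.symm, hBs'.symm, hCs] at c1 c2 c3 c4
      exact ⟨hc, c1, c2, c3, c4⟩
  have hpr : pr (T'.1 j) j (s - 1) = pr (T.1 j) j (s - 1) :=
    h.pr_congr (by omega) (by omega) (by omega) hother
  have fA := rowCf_pos (T.1 j) h2
  have fD := rowCf_neg (T.1 j) h2
  have fB := h.rowCf_B (T.1 j) h2.le
  have fC := h.rowCf_C (T.1 j) h2.le
  have fA' := rowCf_pos (T'.1 j) h2
  have fD' := rowCf_neg (T'.1 j) h2
  have fB' := h.rowCf_B (T'.1 j) h2.le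
  have fC' := h.rowCf_C (T'.1 j) h2.le
  rw [pr_self _ h2] at fB fC fB' fC'
  rw [hpr] at fA' fD'
  rw [cf_psi T hA, cf_psi T hD, cf_psi T hC]
  obtain ⟨hmin, hpos, hlt, hge⟩ :=
    fStep_numbers hnum rfl rfl rfl rfl fA fD fB fC fA' fD' fB' fC'
  refine ⟨?_, hpos⟩
  have key : ∀ x x' : Letter, IsRt n j x → IsRt n j x' → OnArrow s B C x → OnArrow s B C x' →
      (∀ z, OnArrow s B C z → rowCf (T'.1 j) j z =
        rowCf (T.1 j) j z - (if z = x then 1 else 0) + (if z = x' then 1 else 0)) →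
      psi n T' = move n (psi n T) j x x' := by
    intro x x' hx hx' ox ox' hz
    refine ext_cf fun k z hk => ?_
    rw [cf_move _ hx hx' hk, cf_psi T hk, cf_psi T' hk]
    by_cases e : k = j
    · subst e
      by_cases o : OnArrow s B C z
      · simpa using hz z o
      · rw [h.rowCf_congr h2.le hk.2.1 o hother hmin]
        have o1 : z ≠ x := by rintro rfl; exact o ox
        have o2 : z ≠ x' := by rintro rfl; exact o ox'
        simp [o1, o2]
    · have : rowCf (T'.1 k) k z = rowCf (T.1 k) k z := by
        rcases hs with ⟨-, hs⟩ | ⟨-, -, hs⟩ <;> exact hs.rowCf_of_ne e hk.2.1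
      simp [this, e]
  split_ifs with hc
  · obtain ⟨g1, g2, g3, g4⟩ := hlt hc
    refine key _ _ hA hB (Or.inl rfl) (Or.inr (Or.inr (Or.inl rfl))) ?_
    rintro z (rfl | rfl | rfl | rfl)
    · simp [hBs.symm, g1]
    · simp [hBs'.symm, g2]
    · simp [hBs, g3]
    · simp [hBC.symm, hCs, g4]
  · obtain ⟨g1, g2, g3, g4⟩ := hge hc
    refine key _ _ hC hD (Or.inr (Or.inr (Or.inr rfl))) (Or.inr (Or.inl rfl)) ?_
    rintro z (rfl | rfl | rfl | rfl)
    · simp [hCs.symm, g1]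
    · simp [hCs'.symm, g2]
    · simp [hBC, hBs', g3]
    · simp [hCs', g4]

/-- In row s every s̄ counts as a pair. So C → s̄ raises the coefficient of B through the new pair
and leaves that of C unchanged, while s → B turns a placeholder into a B. -/
theorem psi_fStep_last (h : Arrows n i s B C) {T T' : MLT n} (hs : FStep s B C T.1 T'.1 s) :
    psi n T' = psi n T + part n (root n s B) := by
  have h1 := h.one_le
  have hB := h.isRt_B h1 le_rfl
  have hBC := h.B_ne_C
  have hBs := h.B_ne_pos
  have hBs' := h.B_ne_neg
  have hCs := h.C_ne_pos
  have hCs' := h.C_ne_neg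
  have hother : (∀ z, z ≠ pos s → ¬ OnArrow s B C z → (T'.1 s).count z = (T.1 s).count z) := by
    intro z hz ho
    simp only [OnArrow, not_or] at ho
    rcases hs with ⟨-, hs⟩ | ⟨-, -, hs⟩ <;> simpa [ho] using hs s z hz
  have hnum : (((T.1 s).count B < (T.1 s).count C ∧ (T'.1 s).count B = (T.1 s).count B ∧
      (T'.1 s).count C + 1 = (T.1 s).count C ∧
      (T'.1 s).count (neg s) = (T.1 s).count (neg s) + 1)) ∨
      ((T.1 s).count C ≤ (T.1 s).count B ∧ (T'.1 s).count B = (T.1 s).count B + 1 ∧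
      (T'.1 s).count C = (T.1 s).count C ∧
      (T'.1 s).count (neg s) = (T.1 s).count (neg s)) := by
    rcases hs with ⟨hc, hs⟩ | ⟨hc, hp, hs⟩
    · left
      have c1 := hs s B hBs
      have c2 := hs s C hCs
      have c4 := hs s (neg s) (by simp)
      simp [hBC, hBs', hCs', hCs'.symm] at c1 c2 c4
      exact ⟨hc, c1, c2, c4⟩
    · right
      have c1 := hs s B hBs
      have c2 := hs s C hCs
      have c4 := hs s (neg s) (by simp)
      simp [hBC.symm, hBs, hBs'.symm, hCs] at c1 c2 c4
      exact ⟨hc, c1, c2, c4⟩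
  have fB := h.rowCf_B (T.1 s) le_rfl
  have fC := h.rowCf_C (T.1 s) le_rfl
  have fB' := h.rowCf_B (T'.1 s) le_rfl
  have fC' := h.rowCf_C (T'.1 s) le_rfl
  rw [pr, if_pos rfl] at fB fC fB' fC'
  refine ext_cf fun k z hk => ?_
  rw [cf_add, cf_part hk hB, cf_psi T hk, cf_psi T' hk]
  by_cases e : k = s
  · subst e
    by_cases o : OnArrow k B C z
    · rcases o with rfl | rfl | rfl | rfl
      · exact absurd hk.2.1 (by simp)
      · exact absurd hk.2.1 (by simp)
      · simp only [true_and, if_true]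
        omega
      · simp only [hBC.symm, true_and, if_false]
        omega
    · rw [h.rowCf_congr le_rfl hk.2.1 o hother (by omega)]
      simp only [OnArrow, not_or] at o
      simp [o.2.2.1]
  · have : rowCf (T'.1 k) k z = rowCf (T.1 k) k z := by
      rcases hs with ⟨-, hs⟩ | ⟨-, -, hs⟩ <;> exact hs.rowCf_of_ne e hk.2.1
    simp [this, e]

end Arrows

namespace Arrows

variable {n i s : ℕ} {B C : Letter}

theorem exists_tabF (h : Arrows n i s B C) (T : MLT n) :
    ∃ T' j, tabF n i T = some T' ∧ 1 ≤ j ∧ j ≤ s ∧ FStep s B C T.1 T'.1 j ∧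
      kpF n i (psi n T) = psi n T' := by
  have aux : ∀ j, 1 ≤ j → j ≤ s → (uncanceled (brackets n i T.1)).2.head? =
      (uncanceled (segBrackets n i j 0 (T.1 j))).2.head? → 0 < (tabSig s B C T.1 j).2 →
      ∃ T', tabF n i T = some T' ∧ FStep s B C T.1 T'.1 j := by
    intro j h1 h2 hh hp
    obtain ⟨T', e, hT⟩ := h.tabF_step T h1 h2 hh hp
    refine ⟨T', e, ?_⟩
    split_ifs at hT with hc
    · exact Or.inl ⟨hc, hT⟩
    · exact Or.inr ⟨not_lt.1 hc, hT⟩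
  rcases exists_selF (tabSig s B C T.1) (List.range' 1 (s - 1)) (tabSig s B C T.1 s).1 with
    hs | ⟨j, hs⟩
  · obtain ⟨T', e, hT⟩ := aux s h.one_le le_rfl (h.head?_brackets_last T.2 hs)
      ((Nat.zero_le _).trans_lt (h.sig_lowerBrackets_lt T.2))
    refine ⟨T', s, e, h.one_le, le_rfl, hT, ?_⟩
    rw [h.kpF_last (by rwa [h.sigProd_psi, h.cf_psi_last]), h.psi_fStep_last hT]
  · obtain ⟨h1, h2⟩ := mem_rows hs.mem
    obtain ⟨T', e, hT⟩ := aux j h1 h2.le (h.head?_brackets_row T.2 hs) hs.pos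
    refine ⟨T', j, e, h1, h2.le, hT, ?_⟩
    rw [h.kpF_row (j := j), (h.psi_fStep_row h1 h2 hT).1]
    rw [h.cf_psi_last]
    exact hs.congr fun k hk => (h.kpSig_psi T (mem_rows hk).1 (mem_rows hk).2).symm

theorem kpE_psi (h : Arrows n i s B C) (T : MLT n) :
    kpE n i (psi n T) = (tabE n i T).map (psi n) := by
  have aux : ∀ j, 1 ≤ j → j ≤ s → (uncanceled (brackets n i T.1)).1.getLast? =
      (uncanceled (segBrackets n i j 0 (T.1 j))).1.getLast? → 0 < (tabSig s B C T.1 j).1 →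
      ∃ T', tabE n i T = some T' ∧ FStep s B C T'.1 T.1 j := by
    intro j h1 h2 hh hp
    obtain ⟨T', e, hT⟩ := h.tabE_step T h1 h2 hh hp
    refine ⟨T', e, ?_⟩
    split_ifs at hT with hc
    · right
      have c1 := hT j B (h.B_ne_pos_of_le h2)
      have c2 := hT j C (h.C_ne_pos_of_le h2)
      simp only [true_and, if_true, h.B_ne_pos, h.B_ne_C.symm, h.C_ne_pos, if_false] at c1 c2
      refine ⟨by omega, ?_, hT.symm⟩
      rcases h2.lt_or_eq with h2 | rfl
      · have c3 := hT j (pos s) (by simp; omega)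
        simp only [true_and, if_true, h.B_ne_pos.symm, if_false] at c3
        omega
      -- In row s the column correction blurs the count of placeholders, but marginality guarantees
      -- one.
      · rw [T'.2.marginal j h1 h.lt]
        omega
    · left
      have c1 := hT.2 j B (h.B_ne_pos_of_le h2)
      have c2 := hT.2 j C (h.C_ne_pos_of_le h2)
      simp only [true_and, if_true, h.B_ne_neg, h.B_ne_C, h.C_ne_neg, if_false] at c1 c2
      exact ⟨by omega, hT.2.symm⟩
  rcases exists_selE (tabSig s B C T.1) (List.range' 1 (s - 1)) (tabSig s B C T.1 s).1 with
    hs | ⟨j, hs⟩ | hs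
  · obtain ⟨T', e, hT⟩ := aux s h.one_le le_rfl (h.getLast?_brackets_last T.2 hs)
      ((Nat.zero_le _).trans_lt hs)
    rw [h.kpE_last (by rwa [h.sigProd_psi, h.cf_psi_last]), e, h.psi_fStep_last hT,
      add_tsub_cancel_right]
    rfl
  · obtain ⟨h1, h2⟩ := mem_rows hs.mem
    obtain ⟨T', e, hT⟩ := aux j h1 h2.le (h.getLast?_brackets_row T.2 hs) hs.pos
    obtain ⟨e1, e2⟩ := h.psi_fStep_row h1 h2 hT
    have hs' : SelE (kpSig n s B C (psi n T)) (List.range' 1 (s - 1)) (cf n (psi n T) s B) j := by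
      rw [h.cf_psi_last]
      exact hs.congr fun k hk => (h.kpSig_psi T (mem_rows hk).1 (mem_rows hk).2).symm
    -- The reverse of a tableau e-step is an f-step, so the claim follows from `psi_fStep_row` and
    -- `kpE_kpF`, once f_i is known to select row j in `psi n T'`.
    have hF : kpF n i (psi n T') = psi n T := by
      split_ifs at e1 with hc
      · rw [h.kpF_row (j := j), if_pos hc, e1]
        rw [e1, h.cf_move_last h2 (h.isRt_pos h1 h2) (h.isRt_B h1 h2.le)] at hs'
        exact hs'.selF List.nodup_range' (h.flip_move_pos h1 h2 (fun k => mem_rows) hc)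
      · rw [h.kpF_row (j := j), if_neg hc, e1]
        rw [e1, h.cf_move_last h2 (h.isRt_C h1 h2.le) (h.isRt_neg h1 h2)] at hs'
        exact hs'.selF List.nodup_range'
          (h.flip_move_C h1 h2 (fun k => mem_rows) (by omega) (by omega))
    rw [← hF, h.kpE_kpF, e]
    rfl
  · rw [h.tabE_none T hs, h.kpE_none (by rwa [h.sigProd_psi, h.cf_psi_last])]
    rfl

end Arrows

/-! ### The highest weight element and weights -/

/-- The tableau without letters other than placeholders. -/
def emptyTableau (n : ℕ) : Filling :=
  fun j => if 1 ≤ j then List.replicate (n - j) (pos j) else []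

theorem emptyTableau_isMarginallyLarge (n : ℕ) : IsMarginallyLarge n (emptyTableau n) := by
  refine isMarginallyLarge_iff_isRowAt.2 ⟨fun j hj => ?_, fun j j1 j2 => ?_, fun j j1 j2 => ?_⟩
  · unfold emptyTableau
    split_ifs
    · rw [Nat.sub_eq_zero_of_le (by omega), List.replicate_zero]
    · rfl
  · rw [emptyTableau, if_pos j1]
    refine ⟨List.pairwise_replicate.2 (Or.inr (Or.inl rfl)), fun z hz => ?_, fun hc => ?_⟩
    · rw [List.eq_of_mem_replicate hz]
      exact ⟨le_rfl, j2.le⟩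
    · have := List.eq_of_mem_replicate hc.2
      simp at this
  · rw [emptyTableau, if_pos j1, List.count_replicate_self, emptyTableau,
      if_pos (by omega), List.length_replicate]
    omega

theorem psi_emptyTableau (n : ℕ) : psi n ⟨_, emptyTableau_isMarginallyLarge n⟩ = 0 := by
  refine ext_cf fun k z hz => ?_
  have hc : ∀ y, y ≠ pos k → (emptyTableau n k).count y = 0 := by
    intro y hy
    rw [emptyTableau, if_pos hz.1, List.count_replicate, if_neg]
    simpa using hy.symm
  have hp : ∀ m, pr (emptyTableau n k) k m = 0 := by
    intro m
    simp [pr, pairs, hc]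
  rw [cf_psi _ hz, cf_zero, rowCf, hp, hp, hc]
  rintro rfl
  exact absurd hz.2.1 (by simp)

theorem tabWt_emptyTableau (n : ℕ) : tabWt n (emptyTableau n) = 0 := by
  refine Finset.sum_eq_zero fun j _ => List.sum_eq_zero fun w hw => ?_
  obtain ⟨z, hz, rfl⟩ := List.mem_map.1 hw
  unfold emptyTableau at hz
  split_ifs at hz
  · rw [List.eq_of_mem_replicate hz]
    simp [Letter.weight]
  · simp at hz

theorem sum_map_filter_ne {M : Type*} [AddCommMonoid M] {f : Letter → M} {x : Letter}
    (hf : f x = 0) (r : List Letter) : ((r.filter (· ≠ x)).map f).sum = (r.map f).sum := by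
  induction r with
  | nil => rfl
  | cons y r ih =>
    by_cases hy : y = x
    · simpa [hy, hf] using ih
    · rw [List.filter_cons_of_pos (by simpa using hy), List.map_cons, List.map_cons,
        List.sum_cons, List.sum_cons, ih]

theorem sum_map_eq_of_count {M : Type*} [AddCommMonoid M] {f : Letter → M} {x : Letter}
    (hf : f x = 0) {r r' : List Letter} (hc : ∀ z, z ≠ x → r.count z = r'.count z) :
    (r.map f).sum = (r'.map f).sum := by
  rw [← sum_map_filter_ne hf r, ← sum_map_filter_ne hf r']
  refine (List.Perm.map f (List.perm_iff_count.2 fun z => ?_)).sum_eq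
  by_cases hz : z = x
  · rw [List.count_eq_zero.2 (by simp [hz]), List.count_eq_zero.2 (by simp [hz])]
  · rw [List.count_filter (by simpa using hz), List.count_filter (by simpa using hz), hc z hz]

theorem Step.tabWt_eq {n j : ℕ} {R R' : Filling} {x x' : Letter} (h : Step R R' j x x')
    (h1 : 1 ≤ j) (h2 : j < n) : tabWt n R' + x.weight n = tabWt n R + x'.weight n := by
  have h0 : ∀ k, (pos k).weight n - ep n k = 0 := fun k => by simp [Letter.weight]
  have hj : j ∈ Finset.Icc 1 (n - 1) := Finset.mem_Icc.2 ⟨h1, by omega⟩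
  have hrow : ((R' j).map (fun z => z.weight n - ep n j)).sum + (x.weight n - ep n j) =
      ((R j).map (fun z => z.weight n - ep n j)).sum + (x'.weight n - ep n j) := by
    have := sum_map_eq_of_count (f := fun z : Letter => z.weight n - ep n j) (h0 j)
      (r := x :: R' j) (r' := x' :: R j) (fun z hz => by
        have := h j z hz
        simpa [List.count_cons, eq_comm (a := z)] using this)
    simpa [add_comm] using this
  have hoff : ∀ k ∈ (Finset.Icc 1 (n - 1)).erase j,
      ((R' k).map (fun z => z.weight n - ep n k)).sum =
        ((R k).map (fun z => z.weight n - ep n k)).sum := by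
    intro k hk
    have hne := Finset.ne_of_mem_erase hk
    refine sum_map_eq_of_count (h0 k) fun z hz => ?_
    simpa [hne] using h k z hz
  rw [tabWt, tabWt, ← Finset.add_sum_erase _ _ hj, ← Finset.add_sum_erase _ _ hj,
    Finset.sum_congr rfl hoff]
  have e : ∀ S S' u v w W : Weight n, S + (u - w) = S' + (v - w) → S + W + u = S' + W + v := by
    intro S S' u v w W e
    have : S + u = S' + v := by
      have := congrArg (· + w) e
      simpa [add_assoc] using this
    rw [add_right_comm, this, add_right_comm]
  exact e _ _ _ _ _ _ hrow

theorem Arrows.tabWt_fStep {n i s j : ℕ} {B C : Letter} (h : Arrows n i s B C) {R R' : Filling}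
    (h1 : 1 ≤ j) (h2 : j ≤ s) (hs : FStep s B C R R' j) :
    tabWt n R' = tabWt n R - simpleRoot n i := by
  have hlt := h.lt
  rcases hs with ⟨-, hs⟩ | ⟨-, -, hs⟩
  · have e := hs.tabWt_eq h1 (h2.trans_lt hlt)
    -- The row 0 is arbitrary: ε_j cancels, and only the difference of the two letter weights is
    -- used.
    have e' := h.root_C_add 0
    simp only [root] at e'
    rw [eq_sub_of_add_eq e, ← sub_eq_of_eq_add' e'.symm]
    abel
  · have e := hs.tabWt_eq h1 (h2.trans_lt hlt)
    have e' := h.root_pos_add 0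
    simp only [root] at e'
    rw [eq_sub_of_add_eq e, ← sub_eq_of_eq_add' e'.symm]
    abel

/-- Both claims propagate along f_i from the empty tableau. Since `psi n` is injective, the tableau
found is the only preimage, so weights are compared without computing the weight of `psi n T` row by
row. -/
theorem psi_surjective_and_tabWt {n : ℕ} (hn : 2 ≤ n) (a : Kp n) :
    ∃ T, psi n T = a ∧ tabWt n T.1 = kpWt n a := by
  refine kp_induction hn (p := fun a => ∃ T, psi n T = a ∧ tabWt n T.1 = kpWt n a) ?_ ?_ a
  · exact ⟨_, psi_emptyTableau n, by rw [tabWt_emptyTableau, kpWt_zero]⟩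
  · rintro i a h1 h2 ⟨T, rfl, hT⟩
    obtain ⟨s, B, C, h⟩ := exists_arrows hn h1 h2
    obtain ⟨T', j, -, j1, j2, hs, e⟩ := h.exists_tabF T
    exact ⟨T', e.symm, by rw [h.tabWt_fStep j1 j2 hs, h.kpWt_kpF, hT]⟩

theorem kpWt_psi {n : ℕ} (hn : 2 ≤ n) (T : MLT n) : kpWt n (psi n T) = tabWt n T.1 := by
  obtain ⟨T', e, hT⟩ := psi_surjective_and_tabWt hn (psi n T)
  rw [← hT, psi_injective n e]

/-! ### The isomorphism -/

theorem psi_isCrystalIso {n : ℕ} (hn : 2 ≤ n) :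
    IsCrystalIso (tabCrystal n) (kpCrystal n) (psi n) where
  bijective := ⟨psi_injective n, fun a =>
    (psi_surjective_and_tabWt hn a).imp fun _ hT => hT.1⟩
  wt_eq := kpWt_psi hn
  eps_eq i h1 h2 T := by
    obtain ⟨s, B, C, h⟩ := exists_arrows hn h1 h2
    exact h.kpEps_psi T
  phi_eq i h1 h2 T := by
    obtain ⟨s, B, C, h⟩ := exists_arrows hn h1 h2
    change kpEps n i (psi n T) + pairing n i (kpWt n (psi n T)) =
      tabEps n i T.1 + pairing n i (tabWt n T.1)
    rw [h.kpEps_psi, kpWt_psi hn]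
  e_eq i h1 h2 T := by
    obtain ⟨s, B, C, h⟩ := exists_arrows hn h1 h2
    exact h.kpE_psi T
  f_eq i h1 h2 T := by
    obtain ⟨s, B, C, h⟩ := exists_arrows hn h1 h2
    obtain ⟨T', j, e, -, -, -, e'⟩ := h.exists_tabF T
    change some (kpF n i (psi n T)) = (tabF n i T).map (psi n)
    rw [e, e']
    rfl

/-- The axioms of a crystal are transported along an isomorphism. -/
theorem IsCrystalIso.isCrystal {n : ℕ} {X Y : Type} {D : CrystalData n X} {D' : CrystalData n Y}
    {F : X → Y} (hF : IsCrystalIso D D' F) (hD : D'.IsCrystal) : D.IsCrystal := by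
  have he : ∀ i, 1 ≤ i → i ≤ n → ∀ b b', D.e i b = some b' ↔ D'.e i (F b) = some (F b') := by
    intro i h1 h2 b b'
    rw [hF.e_eq i h1 h2, ← Option.map_some, (Option.map_injective hF.bijective.1).eq_iff]
  have hf : ∀ i, 1 ≤ i → i ≤ n → ∀ b b', D.f i b = some b' ↔ D'.f i (F b) = some (F b') := by
    intro i h1 h2 b b'
    rw [hF.f_eq i h1 h2, ← Option.map_some, (Option.map_injective hF.bijective.1).eq_iff]
  refine ⟨fun i h1 h2 b => ?_, fun i h1 h2 b b' e => ?_, fun i h1 h2 b b' e => ?_,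
    fun i h1 h2 b b' => ?_⟩
  · rw [← hF.phi_eq i h1 h2, ← hF.eps_eq i h1 h2, ← hF.wt_eq, hD.phi_eq i h1 h2]
  · have := hD.of_e i h1 h2 _ _ ((he i h1 h2 b b').1 e)
    rwa [hF.wt_eq, hF.wt_eq, hF.eps_eq i h1 h2, hF.eps_eq i h1 h2, hF.phi_eq i h1 h2,
      hF.phi_eq i h1 h2] at this
  · have := hD.of_f i h1 h2 _ _ ((hf i h1 h2 b b').1 e)
    rwa [hF.wt_eq, hF.wt_eq, hF.eps_eq i h1 h2, hF.eps_eq i h1 h2, hF.phi_eq i h1 h2,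
      hF.phi_eq i h1 h2] at this
  · rw [hf i h1 h2, he i h1 h2]
    exact hD.f_iff_e i h1 h2 _ _

end TypeD

/-! ### The crystal structures and their unique isomorphism. -/

theorem theorem3p1 (n : ℕ) (hn : 2 ≤ n) :
    (TypeD.tabCrystal n).IsCrystal ∧ (TypeD.kpCrystal n).IsCrystal ∧
      TypeD.IsCrystalIso (TypeD.tabCrystal n) (TypeD.kpCrystal n) (TypeD.psi n) ∧
      ∀ F : TypeD.MLT n → TypeD.Kp n,
        TypeD.IsCrystalIso (TypeD.tabCrystal n) (TypeD.kpCrystal n) F → F = TypeD.psi n := by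
  have hK := TypeD.kpCrystal_isCrystal hn
  have hI := TypeD.psi_isCrystalIso hn
  exact ⟨hI.isCrystal hK, hK, hI, fun F hF => TypeD.crystalIso_unique hn hF hI⟩
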